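/- **Conventions.** A graph $G$ is loopless and undirected, has $n=|G|\ge 1$ vertices labelled $1,\dots,n$, and carries a total order on its edges. $X_G$ is its chromatic symmetric function, $e_m$ ($m \ge 0$) are the elementary symmetric functions, and $e_\lambda=\prod_j e_{\lambda_j}$. A *broken circuit* is a cycle minus its largest edge. A *forest triple* $\mathcal F$ of $G$ is a set consisting of one triple $(T,\alpha,r)$ for each component $T$ of some spanning subgraph of $G$ that contains no broken circuit (so each $T$ is a tree), where $\alpha=(\alpha_1,\dots,\alpha_l)$ is a composition of $|T|$ and $1\le r\le\alpha_1$. $\mathrm{FT}(G)$ is the set of forest triples of $G$; $\mathrm{type}(\mathcal F)$ is the partition formed by all parts of all the compositions; $\mathrm{sign}(\mathcal F)=\prod_{(T,\alpha,r)\in\mathcal F}(-1)^{\ell(\alpha)-1}$; $\mathcal F$ is *unit* if every composition has length $1$. $(T_{\min},\alpha^{(\min)},r_{\min})$ is the triple of $\mathcal F$ whose tree contains vertex $1$, and $\mathrm{type}'(\mathcal F)$ is $\mathrm{type}(\mathcal F)$ with one part equal to $\alpha^{(\min)}_1$ removed. A *first-preserving involution* on $\mathrm{FT}(G)$ is a map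 $\varphi:\mathrm{FT}(G)\to\mathrm{FT}(G)$ with $\varphi\circ\varphi=\mathrm{id}$ that preserves $\mathrm{type}$, $\alpha^{(\min)}_1$ and $r_{\min}$, changes the sign of every $\mathcal F$ with $\varphi(\mathcal F)\ne\mathcal F$, and all of whose fixed points have sign $1$ and are unit. Put $$X_G^{(i)}=\sum_{\mathcal F\in\mathrm{FT}(G),\ \alpha^{(\min)}_1=i,\ r_{\min}=1}\mathrm{sign}(\mathcal F)\,e_{\mathrm{type}'(\mathcal F)}.$$ For graphs $G_1,G_2$ on $k_1,k_2$ vertices, $G_1+G_2$ is the graph on $1,\dots,k_1+k_2-1$ with edge set $E(G_1)\cup\{(p+k_1-1,q+k_1-1):(p,q)\in E(G_2)\}$, the orders within $E(G_1)$ and $E(G_2)$ being kept and the edges from $G_1$ being smaller than those from $G_2$. For $a\ge2$, $C_a$ is the cycle on $1,\dots,a$ with edges $(1,2)<(2,3)<\dots<(a-1,a)<(a,1)$. For a tree $U_k$ with $k\ge1$ vertices (with any labelling and any edge order), let $\mathrm{FT}'(C_a+U_k)$ be the set of those $\mathcal F\in\mathrm{FT}(C_a+U_k)$ such that the triple $(T,\alpha,r)\in\mathcal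 F$ with $a\in V(T)$ satisfies $E(U_k)\subseteq E(T)$ and has last part $\alpha_l\ge k$. Put $$B_{a,k}=\sum_{\mathcal F\in\mathrm{FT}'(C_a+U_k)}\mathrm{sign}(\mathcal F)\,e_{\mathrm{type}(\mathcal F)},\qquad B^{(i)}_{a,k}=\sum_{\mathcal F\in\mathrm{FT}'(C_a+U_k),\ \alpha^{(\min)}_1=i,\ r_{\min}=1}\mathrm{sign}(\mathcal F)\,e_{\mathrm{type}'(\mathcal F)}.$$ **Theorem.** Let $a\ge2$, let $G'$ be a graph such that $\mathrm{FT}(G')$ has a first-preserving involution, and let $G=C_a+G'$. Then $\mathrm{FT}(G)$ has a first-preserving involution. Moreover, for every choice of trees $U_k$ with $k$ vertices ($1\le k\le|G'|$), $$X_G=\sum_{k=1}^{|G'|}X^{(k)}_{G'}\,B_{a,k},\qquad\text{and}\qquad X^{(i)}_G=\sum_{k=1}^{|G'|}X^{(k)}_{G'}\,B^{(i)}_{a,k}\quad\text{for every integer } i\ge0.$$ -/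

import Mathlib

/-- A loopless undirected graph whose vertices are labelled `1, …, n` (with `n ≥ 1`) and whose edges
are totally ordered. The edges are listed in increasing order, so that an edge is named by its
position in the list and a larger position means a larger edge. Parallel edges are allowed. -/
structure LabeledGraph where
  n : ℕ
  pos : 1 ≤ n
  edges : List (Sym2 ℕ)
  mem_range : ∀ e ∈ edges, ∀ v ∈ e, 1 ≤ v ∧ v ≤ n
  loopless : ∀ e ∈ edges, ¬ e.IsDiag

/-- A tree `T` (given by its vertex set `V` and the set `E` of positions of its edges), together
with a list `α` and a number `r`. -/
@[ext]
structure TreeTriple where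
  V : Finset ℕ
  E : Finset ℕ
  α : List ℕ
  r : ℕ

namespace TreeTriple

/-- The first part `α₁` of the composition. -/
def firstPart (T : TreeTriple) : ℕ := T.α.headD 0

/-- The last part of the composition. -/
def lastPart (T : TreeTriple) : ℕ := T.α.getLastD 0

end TreeTriple

/-- `α` is a composition of `N`. -/
def IsCompositionOf (α : List ℕ) (N : ℕ) : Prop :=
  (∀ p ∈ α, 1 ≤ p) ∧ α.sum = N

/-- The sign `(-1) ^ ∑ (len α - 1)` of a set of tree triples. -/
def signOf (S : Finset TreeTriple) : ℤ := (-1) ^ (∑ T ∈ S, (T.α.length - 1))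

/-- The type of a set of tree triples: the multiset of all parts of all its compositions. -/
def typeOf (S : Finset TreeTriple) : Multiset ℕ := ∑ T ∈ S, (T.α : Multiset ℕ)

/-- The reduced type: as `typeOf`, with the first part of the composition on the tree
containing vertex `1` left out. -/
def reducedType (S : Finset TreeTriple) : Multiset ℕ :=
  ∑ T ∈ S, if 1 ∈ T.V then (T.α.tail : Multiset ℕ) else (T.α : Multiset ℕ)

/-- All the compositions have length one. -/
def IsUnitForest (S : Finset TreeTriple) : Prop := ∀ T ∈ S, T.α.length = 1

/-- The elementary symmetric function `e_k` in the variables `x_0, x_1, x_2, …`, as a formal power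
series: the sum of all squarefree monomials of degree `k`. -/
noncomputable def elem (k : ℕ) : MvPowerSeries ℕ ℤ := by
  classical
  exact fun d => if (∀ j, d j ≤ 1) ∧ d.degree = k then 1 else 0

/-- `e_μ`, the product of the `e_p` over the parts `p` of `μ`. -/
noncomputable def elemProd (μ : Multiset ℕ) : MvPowerSeries ℕ ℤ := (μ.map elem).prod

namespace LabeledGraph

/-- `κ` is a proper colouring of `G` with colours in `ℕ`. -/
def IsProper (G : LabeledGraph) (κ : Finset.Icc 1 G.n → ℕ) : Prop :=
  ∀ u v : Finset.Icc 1 G.n, s((u : ℕ), (v : ℕ)) ∈ G.edges → κ u ≠ κ v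

/-- The chromatic symmetric function `∑_κ ∏_v x_{κ(v)}`: the coefficient of a monomial is the
number of proper colourings `κ` with that monomial. -/
noncomputable def chromaticSymm (G : LabeledGraph) : MvPowerSeries ℕ ℤ := fun d =>
  (Set.ncard {κ : Finset.Icc 1 G.n → ℕ | G.IsProper κ ∧ ∑ v, Finsupp.single (κ v) 1 = d} : ℤ)

/-- `C` is the set of edges of a cycle of `G` (of length at least two). -/
def IsCycle (G : LabeledGraph) (C : Finset ℕ) : Prop :=
  ∃ (k : ℕ) (v e : Fin (k + 2) → ℕ), Function.Injective v ∧ Function.Injective e ∧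
    (∀ j, G.edges[e j]? = some s(v j, v (j + 1))) ∧ C = Finset.univ.image e

/-- `B` is a broken circuit of `G`: a cycle without its largest edge. -/
def IsBrokenCircuit (G : LabeledGraph) (B : Finset ℕ) : Prop :=
  ∃ C, G.IsCycle C ∧ ∃ e ∈ C, (∀ f ∈ C, f ≤ e) ∧ B = C.erase e

/-- `F` is the edge set of a (spanning) subgraph of `G` that contains no broken circuit. -/
def IsNonBroken (G : LabeledGraph) (F : Finset ℕ) : Prop :=
  (∀ i ∈ F, i < G.edges.length) ∧ ∀ B, G.IsBrokenCircuit B → ¬ B ⊆ F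

/-- The adjacency given by the edges in `F`. -/
def sub (G : LabeledGraph) (F : Finset ℕ) : SimpleGraph ℕ :=
  SimpleGraph.fromEdgeSet {e | ∃ i ∈ F, G.edges[i]? = some e}

/-- `V` and `E` are the vertices and the edges of a connected component of the spanning subgraph
of `G` with edge set `F`. -/
def IsComponent (G : LabeledGraph) (F V E : Finset ℕ) : Prop :=
  (∃ v, 1 ≤ v ∧ v ≤ G.n ∧ ∀ u, u ∈ V ↔ (G.sub F).Reachable v u) ∧
    ∀ i, i ∈ E ↔ i ∈ F ∧ ∃ e, G.edges[i]? = some e ∧ ∀ x ∈ e, x ∈ V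

/-- `S` is a forest triple of `G`: for some non-broken circuit `F`, it consists of exactly one
tree triple for each tree of `F`. -/
def IsForestTriple (G : LabeledGraph) (S : Finset TreeTriple) : Prop :=
  ∃ F, G.IsNonBroken F ∧
    (∀ T ∈ S, G.IsComponent F T.V T.E ∧ IsCompositionOf T.α T.V.card ∧
      1 ≤ T.r ∧ T.r ≤ T.firstPart) ∧
    ∀ v, 1 ≤ v → v ≤ G.n → ∃! T, T ∈ S ∧ v ∈ T.V

/-- `FT(G)`, the set of all forest triples. -/
def FT (G : LabeledGraph) : Set (Finset TreeTriple) := {S | G.IsForestTriple S}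

/-- `FT(G)` is finite, so the finite sums below are genuine sums. -/
theorem FT_finite (G : LabeledGraph) : G.FT.Finite := by
  have hmem : ∀ (F : Finset ℕ) (u v : ℕ), (G.sub F).Adj u v → 1 ≤ v ∧ v ≤ G.n := by
    intro F u v h
    simp only [sub, SimpleGraph.fromEdgeSet_adj, Set.mem_ofPred_eq] at h
    obtain ⟨⟨i, -, hi⟩, -⟩ := h
    exact G.mem_range _ (List.mem_of_getElem? hi) v (Sym2.mem_mk_right u v)
  have hreach : ∀ (F : Finset ℕ) (u v : ℕ), 1 ≤ u ∧ u ≤ G.n → (G.sub F).Reachable u v →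
      1 ≤ v ∧ v ≤ G.n := by
    intro F u v hu h
    obtain ⟨w⟩ := h
    induction w with
    | nil => exact hu
    | cons hadj _ ih => exact ih (hmem F _ _ hadj)
  have hlists : {l : List ℕ | (∀ p ∈ l, p ∈ Set.Iic G.n) ∧ l.length ≤ G.n}.Finite := by
    have h1 := List.finite_length_le (Set.Iic G.n) G.n
    refine (h1.image (List.map Subtype.val)).subset ?_
    rintro l ⟨hl, hlen⟩
    refine ⟨l.attachWith _ hl, ?_, ?_⟩
    · simpa using hlen
    · simp
  have hfin : {T : TreeTriple | T.V ⊆ Finset.Icc 1 G.n ∧ T.E ⊆ Finset.range G.edges.length ∧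
      T.α ∈ {l : List ℕ | (∀ p ∈ l, p ∈ Set.Iic G.n) ∧ l.length ≤ G.n} ∧ T.r ≤ G.n}.Finite := by
    have h2 := ((Finset.Icc 1 G.n).powerset.finite_toSet.prod
      ((Finset.range G.edges.length).powerset.finite_toSet.prod
        (hlists.prod (Set.finite_Iic G.n))))
    refine (h2.image (fun p => (⟨p.1, p.2.1, p.2.2.1, p.2.2.2⟩ : TreeTriple))).subset ?_
    rintro ⟨V, E, α, r⟩ ⟨hV, hE, hα, hr⟩
    refine ⟨(V, E, α, r), ⟨?_, ?_, hα, hr⟩, rfl⟩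
    · exact Finset.mem_coe.2 (Finset.mem_powerset.2 hV)
    · exact Finset.mem_coe.2 (Finset.mem_powerset.2 hE)
  have hsub := hfin.toFinset.powerset.finite_toSet
  refine hsub.subset ?_
  rintro S ⟨F, hF, hT, -⟩
  simp only [Finset.coe_powerset, Set.mem_preimage, Set.mem_powerset_iff]
  intro T hTS
  obtain ⟨⟨⟨v, hv1, hv2, hV⟩, hE⟩, ⟨hpos, hsum⟩, hr1, hr2⟩ := hT T (by simpa using hTS)
  have hVs : T.V ⊆ Finset.Icc 1 G.n := by
    intro u hu
    simpa using hreach F v u ⟨hv1, hv2⟩ ((hV u).1 hu)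
  have hcard : T.V.card ≤ G.n := by
    simpa using Finset.card_le_card hVs
  have hp : ∀ p ∈ T.α, p ≤ G.n := fun p hp =>
    ((List.single_le_sum (fun _ _ => Nat.zero_le _) p hp).trans hsum.le).trans hcard
  have hlen : T.α.length ≤ G.n :=
    ((List.length_le_sum_of_one_le T.α hpos).trans hsum.le).trans hcard
  simp only [Set.Finite.coe_toFinset, Set.mem_ofPred_eq]
  refine ⟨hVs, fun i hi => ?_, ⟨hp, hlen⟩, hr2.trans ?_⟩
  · simpa using hF.1 i ((hE i).1 hi).1
  · unfold TreeTriple.firstPart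
    cases hα : T.α with
    | nil => simp
    | cons x l => simpa using hp x (by simp [hα])

/-- `α₁ = i` and `r = 1` hold for the tree triple of `S` that contains vertex `1`. -/
def MinIs (S : Finset TreeTriple) (i : ℕ) : Prop :=
  ∃ T ∈ S, 1 ∈ T.V ∧ T.firstPart = i ∧ T.r = 1

/-- `FT^{(i)}(G)`. -/
def FTPiece (G : LabeledGraph) (i : ℕ) : Set (Finset TreeTriple) := {S ∈ G.FT | MinIs S i}

/-- `X_G^{(i)}`, the sum of `sign(S) e_{type'(S)}` over `FT^{(i)}(G)`. -/
noncomputable def chromaticPiece (G : LabeledGraph) (i : ℕ) : MvPowerSeries ℕ ℤ :=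
  ∑ᶠ S ∈ G.FTPiece i, signOf S • elemProd (reducedType S)

/-- `φ` is a sign-reversing involution on `FT(G)`. -/
def IsSignReversing (G : LabeledGraph) (φ : G.FT → G.FT) : Prop :=
  (∀ S : G.FT, φ (φ S) = S) ∧
  (∀ S : G.FT, typeOf (φ S : Finset TreeTriple) = typeOf (S : Finset TreeTriple)) ∧
  (∀ S : G.FT, φ S ≠ S → signOf (φ S : Finset TreeTriple) ≠ signOf (S : Finset TreeTriple)) ∧
  (∀ S : G.FT, φ S = S → signOf (S : Finset TreeTriple) = 1)

/-- `φ` is a first-preserving involution on `FT(G)`: it is a sign-reversing involution, its fixed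
points are unit, and it preserves `α₁` and `r` of the tree triple that contains vertex `1`. -/
def IsFirstPreserving (G : LabeledGraph) (φ : G.FT → G.FT) : Prop :=
  G.IsSignReversing φ ∧
  (∀ S : G.FT, φ S = S → IsUnitForest (S : Finset TreeTriple)) ∧
  (∀ S : G.FT, ∀ T ∈ (S : Finset TreeTriple), ∀ T' ∈ (φ S : Finset TreeTriple),
    1 ∈ T.V → 1 ∈ T'.V → T.firstPart = T'.firstPart ∧ T.r = T'.r)

/-- `FT(G)` has a first-preserving involution. -/
def HasFirstPreservingInvolution (G : LabeledGraph) : Prop :=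
  ∃ φ : G.FT → G.FT, G.IsFirstPreserving φ

/-- `G₁ + G₂`: the last vertex of `G₁` is identified with the first vertex of `G₂`, and the edges
of `G₁` are smaller than those of `G₂`. -/
instance : Add LabeledGraph where
  add G₁ G₂ :=
    { n := G₁.n + G₂.n - 1
      pos := by have := G₁.pos; have := G₂.pos; omega
      edges := G₁.edges ++ G₂.edges.map (Sym2.map (fun j => j + (G₁.n - 1)))
      mem_range := by
        intro e he v hv
        have h1 := G₁.pos
        have h2 := G₂.pos
        rcases List.mem_append.1 he with he | he
        · have := G₁.mem_range e he v hv
          omega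
        · obtain ⟨e', he', rfl⟩ := List.mem_map.1 he
          obtain ⟨w, hw, rfl⟩ := Sym2.mem_map.1 hv
          have := G₂.mem_range e' he' w hw
          omega
      loopless := by
        intro e he
        rcases List.mem_append.1 he with he | he
        · exact G₁.loopless e he
        · obtain ⟨e', he', rfl⟩ := List.mem_map.1 he
          rw [Sym2.isDiag_map (add_left_injective _)]
          exact G₂.loopless e' he' }

/-- The cycle `C_a` on `1, …, a` for `a ≥ 2`, with edges
`(1,2) < (2,3) < ⋯ < (a-1,a) < (a,1)`. -/
def cycle (a : ℕ) (ha : 2 ≤ a) : LabeledGraph where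
  n := a
  pos := by omega
  edges := (List.range' 1 (a - 1)).map (fun i => s(i, i + 1)) ++ [s(a, 1)]
  mem_range := by
    intro e he v hv
    rcases List.mem_append.1 he with he | he
    · obtain ⟨i, hi, rfl⟩ := List.mem_map.1 he
      rw [List.mem_range'_1] at hi
      rcases Sym2.mem_iff.1 hv with rfl | rfl <;> omega
    · rw [List.mem_singleton] at he
      subst he
      rcases Sym2.mem_iff.1 hv with rfl | rfl <;> omega
  loopless := by
    intro e he
    rcases List.mem_append.1 he with he | he
    · obtain ⟨i, hi, rfl⟩ := List.mem_map.1 he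
      simp
    · rw [List.mem_singleton] at he
      subst he
      simp only [Sym2.mk_isDiag_iff]
      omega

/-- `G` is a tree: connected and without cycles. -/
def IsTree (G : LabeledGraph) : Prop :=
  (∀ u v, 1 ≤ u → u ≤ G.n → 1 ≤ v → v ≤ G.n →
    (G.sub (Finset.range G.edges.length)).Reachable u v) ∧ ∀ C, ¬ G.IsCycle C

/-- `FT'(C_a + U)`: the forest triples of `C_a + U` such that the tree containing vertex `a`
contains all the edges of `U` (those at positions `≥ |E(C_a)|`) and the last part of its
composition is at least the number of vertices of `U`. -/
def FTPrime (a : ℕ) (ha : 2 ≤ a) (U : LabeledGraph) : Set (Finset TreeTriple) :=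
  {S ∈ (cycle a ha + U).FT | ∃ T ∈ S, a ∈ T.V ∧
    (∀ i, (cycle a ha).edges.length ≤ i → i < (cycle a ha + U).edges.length → i ∈ T.E) ∧
    U.n ≤ T.lastPart}

/-- `B_{a,k}`, the sum of `sign(S) e_{type(S)}` over `FT'(C_a + U)`, where `U` is a tree on `k`
vertices. -/
noncomputable def B (a : ℕ) (ha : 2 ≤ a) (U : LabeledGraph) : MvPowerSeries ℕ ℤ :=
  ∑ᶠ S ∈ FTPrime a ha U, signOf S • elemProd (typeOf S)

/-- `B_{a,k}^{(i)}`, the sum of `sign(S) e_{type'(S)}` over those `S` in `FT'(C_a + U)` with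
`α₁ = i` and `r = 1` at vertex `1`, where `U` is a tree on `k` vertices. -/
noncomputable def BPiece (a : ℕ) (ha : 2 ≤ a) (U : LabeledGraph) (i : ℕ) : MvPowerSeries ℕ ℤ :=
  ∑ᶠ S ∈ {S ∈ FTPrime a ha U | MinIs S i}, signOf S • elemProd (reducedType S)

end LabeledGraph

/-!
The composition on a tree through the common vertex of `H + K` is cut at the part that crosses
from the `H`-side to the `K`-side. On one tree this is the convolution identity `headSum_add`:
a composition of `m + t - 1` is an initial composition of `m + k - 1` with last part at least `k`,
followed by a composition of `t - k`. As neither the components nor the broken circuits of a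
one-vertex join interact beyond the tree at the common vertex (`sum_nbc_add`, `prod_comps_join`),
every weighted sum over `FT(H + K)` equals `∑ k, (sum over FT(K) with α₁ = k, r = 1) * c_k(H)`;
this is `forestSum_add`, where `c_k(H)` is `joinCoeff`. For a tree `U` with `k` vertices the forest
triples in `FT'(H + U)` are counted by the same `c_k(H)` (`sum_coversTree`), which identifies the
coefficients as `B_{a,k}` and `B_{a,k}^{(i)}` (`B_eq`, `BPiece_eq`). This gives the formula for the
pieces. The formula for `X_G` follows because `X_G` is itself a signed sum over all forest triples
(`chromaticSymm_eq`): expand `X_G` in power sums over the edge sets without broken circuits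
(Whitney's theorem, `sum_isProper`) and each power sum in elementary symmetric functions (Newton's
identities, `headSum_esymm`).

The existence of a first-preserving involution is a statement about numbers. Sort the forest triples
by type, `α₁` and `r`. An involution exists if and only if in each class the signed count is
nonnegative and at most the number of unit forest triples (`IsCancelling.sum_bounds` and
`exists_isCancelling`). In terms of the generating polynomials `forestSum` with a parameter `z` that
marks all parts but the first ones, these inequalities say that the value at `z = -1` and the
difference between the values at `z = 0` and `z = -1` have nonnegative coefficients
(`hasFirstPreservingInvolution_iff_nonneg`). By `forestSum_add` it remains to prove both
inequalities for the coefficients `c_k` of the cycle. The edge sets of the cycle without broken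
circuits are sorted by the first and the last edge omitted, which yields the coefficients as a
double convolution (`joinCoeff_cycle`). In generating functions the one at `z = -1` collapses to

  `(i - k) t^i (P [k ≤ i] - E_k D)`, with `E_k = ∑_{n ≥ k} x_n t^n`,
  `D = 1 / (1 - ∑ (n - 1) x_n t^n)` and `P = D (1 + E_1)`

(`joinCoeff_cycle_neg_one`). Both factors change sign together, so the coefficients are nonnegative
(`joinCoeff_cycle_nonneg`), and the comparison with the unit count is a similar identity between
series with nonnegative coefficients (`joinCoeff_cycle_le`).
-/

/-! ### Components and broken circuits -/

namespace LabeledGraph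

variable (G : LabeledGraph)

/-- The vertex set of the connected component of `v` in the spanning subgraph with edge set `F`. -/
noncomputable def comp (F : Finset ℕ) (v : ℕ) : Finset ℕ := by
  classical exact {u ∈ Finset.Icc 1 G.n | (G.sub F).Reachable v u}

/-- The vertex sets of all connected components of the spanning subgraph with edge set `F`. -/
noncomputable def comps (F : Finset ℕ) : Finset (Finset ℕ) := by
  classical exact (Finset.Icc 1 G.n).image (G.comp F)

/-- The positions of the edges of `F` both ends of which lie in `V`. -/
noncomputable def edgesIn (F V : Finset ℕ) : Finset ℕ := by
  classical exact {i ∈ F | ∃ e, G.edges[i]? = some e ∧ ∀ x ∈ e, x ∈ V}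

variable {G} {F V E : Finset ℕ} {u v w i : ℕ}

theorem ne_of_edge (h : G.edges[i]? = some s(u, v)) : u ≠ v := by
  rintro rfl
  exact G.loopless _ (List.mem_of_getElem? h) (by simp)

theorem mem_Icc_of_edge (h : G.edges[i]? = some s(u, v)) :
    u ∈ Finset.Icc 1 G.n ∧ v ∈ Finset.Icc 1 G.n := by
  have := G.mem_range _ (List.mem_of_getElem? h)
  simp only [Finset.mem_Icc]
  exact ⟨this u (by simp), this v (by simp)⟩

theorem lt_of_edge {e : Sym2 ℕ} (h : G.edges[i]? = some e) : i < G.edges.length :=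
  (List.getElem?_eq_some_iff.1 h).1

theorem sub_adj : (G.sub F).Adj u v ↔ ∃ i ∈ F, G.edges[i]? = some s(u, v) := by
  simp only [sub, SimpleGraph.fromEdgeSet_adj, Set.mem_ofPred_eq]
  exact ⟨fun h => h.1, fun h => ⟨h, by obtain ⟨i, -, hi⟩ := h; exact ne_of_edge hi⟩⟩

theorem reachable_of_edge (hi : i ∈ F) (h : G.edges[i]? = some s(u, v)) :
    (G.sub F).Reachable u v := (sub_adj.2 ⟨i, hi, h⟩).reachable

/-- Every reflexive and transitive relation that holds along the edges of `F` holds between vertices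
connected by `F`. No symmetry is needed, since `hs` covers both orientations of an edge. -/
theorem rel_of_reachable {r : ℕ → ℕ → Prop} (hr : ∀ x, r x x)
    (ht : ∀ x y z, r x y → r y z → r x z)
    (hs : ∀ i ∈ F, ∀ x y, G.edges[i]? = some s(x, y) → r x y)
    (h : (G.sub F).Reachable u v) : r u v := by
  obtain ⟨p⟩ := h
  induction p with
  | nil => exact hr _
  | cons hadj _ ih =>
    obtain ⟨i, hi, he⟩ := sub_adj.1 hadj
    exact ht _ _ _ (hs i hi _ _ he) ih

theorem eq_of_reachable {β : Type*} (f : ℕ → β)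
    (hs : ∀ i ∈ F, ∀ x y, G.edges[i]? = some s(x, y) → f x = f y)
    (h : (G.sub F).Reachable u v) : f u = f v :=
  rel_of_reachable (r := fun x y => f x = f y) (fun _ => rfl) (fun _ _ _ => Eq.trans) hs h

theorem reachable_mono {F' : Finset ℕ} (hF : F ⊆ F') (h : (G.sub F).Reachable u v) :
    (G.sub F').Reachable u v :=
  rel_of_reachable (fun _ => SimpleGraph.Reachable.refl _)
    (fun _ _ _ => SimpleGraph.Reachable.trans) (fun _ hi _ _ he => reachable_of_edge (hF hi) he) h

theorem mem_Icc_of_reachable (hu : u ∈ Finset.Icc 1 G.n) (h : (G.sub F).Reachable u v) :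
    v ∈ Finset.Icc 1 G.n :=
  rel_of_reachable (r := fun x y => x ∈ Finset.Icc 1 G.n → y ∈ Finset.Icc 1 G.n)
    (fun _ => id) (fun _ _ _ h1 h2 h3 => h2 (h1 h3))
    (fun _ _ _ _ he _ => (mem_Icc_of_edge he).2) h hu

theorem mem_comp (hv : v ∈ Finset.Icc 1 G.n) :
    u ∈ G.comp F v ↔ (G.sub F).Reachable v u := by
  classical
  simp only [comp, Finset.mem_filter, and_iff_right_iff_imp]
  exact mem_Icc_of_reachable hv

theorem self_mem_comp (hv : v ∈ Finset.Icc 1 G.n) : v ∈ G.comp F v :=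
  (mem_comp hv).2 (SimpleGraph.Reachable.refl _)

theorem comp_subset : G.comp F v ⊆ Finset.Icc 1 G.n := by
  classical
  exact Finset.filter_subset _ _

theorem comp_eq_of_reachable (h : (G.sub F).Reachable u v) : G.comp F u = G.comp F v := by
  classical
  ext x
  simp only [comp, Finset.mem_filter, and_congr_right_iff]
  exact fun _ => ⟨fun hx => h.symm.trans hx, fun hx => h.trans hx⟩

theorem comp_eq_iff (hu : u ∈ Finset.Icc 1 G.n) :
    G.comp F u = G.comp F v ↔ (G.sub F).Reachable u v := by
  classical
  refine ⟨fun h => ?_, comp_eq_of_reachable⟩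
  have h1 := self_mem_comp (F := F) hu
  rw [h] at h1
  exact (Finset.mem_filter.1 h1).2.symm

theorem mem_comps : V ∈ G.comps F ↔ ∃ v ∈ Finset.Icc 1 G.n, G.comp F v = V := by
  classical
  simp [comps]

theorem comp_mem_comps (hv : v ∈ Finset.Icc 1 G.n) : G.comp F v ∈ G.comps F :=
  mem_comps.2 ⟨v, hv, rfl⟩

theorem eq_comp_of_mem (hV : V ∈ G.comps F) (hv : v ∈ V) : V = G.comp F v := by
  obtain ⟨u, hu, rfl⟩ := mem_comps.1 hV
  exact comp_eq_of_reachable ((mem_comp hu).1 hv)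

theorem subset_of_mem_comps (hV : V ∈ G.comps F) : V ⊆ Finset.Icc 1 G.n := by
  obtain ⟨u, hu, rfl⟩ := mem_comps.1 hV
  exact comp_subset

theorem nonempty_of_mem_comps (hV : V ∈ G.comps F) : V.Nonempty := by
  obtain ⟨u, hu, rfl⟩ := mem_comps.1 hV
  exact ⟨u, self_mem_comp hu⟩

/-- A family of vertex sets is the family of components as soon as it covers all vertices and its
members are closed under reachability and connected. -/
theorem comps_eq {P : Finset (Finset ℕ)}
    (hne : ∀ V ∈ P, ∃ v ∈ Finset.Icc 1 G.n, v ∈ V)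
    (hP : ∀ V ∈ P, ∀ v ∈ V, ∀ u, u ∈ V ↔ (G.sub F).Reachable v u)
    (hcov : ∀ v ∈ Finset.Icc 1 G.n, ∃ V ∈ P, v ∈ V) : G.comps F = P := by
  have key : ∀ V ∈ P, ∀ v ∈ Finset.Icc 1 G.n, v ∈ V → G.comp F v = V := by
    intro V hV v hv hvV
    ext u
    rw [mem_comp hv, hP V hV v hvV]
  ext V
  rw [mem_comps]
  constructor
  · rintro ⟨v, hv, rfl⟩
    obtain ⟨V, hV, hvV⟩ := hcov v hv
    rwa [key V hV v hv hvV]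
  · intro hV
    obtain ⟨v, hv, hvV⟩ := hne V hV
    exact ⟨v, hv, key V hV v hv hvV⟩

theorem mem_edgesIn : i ∈ G.edgesIn F V ↔
    i ∈ F ∧ ∃ e, G.edges[i]? = some e ∧ ∀ x ∈ e, x ∈ V := by
  classical
  simp [edgesIn]

theorem isComponent_iff : G.IsComponent F V E ↔ V ∈ G.comps F ∧ E = G.edgesIn F V := by
  unfold IsComponent
  refine and_congr ?_ ?_
  · rw [mem_comps]
    refine exists_congr fun v => ?_
    rw [Finset.mem_Icc, ← and_assoc]
    refine and_congr_right fun hv => ?_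
    rw [Finset.ext_iff]
    refine forall_congr' fun u => ?_
    rw [mem_comp (Finset.mem_Icc.2 hv)]
    exact Iff.comm
  · rw [Finset.ext_iff]
    exact forall_congr' fun i => by rw [mem_edgesIn]

/-- Every edge of `F` lies in the component of either of its ends. -/
theorem exists_mem_edgesIn (hF : ∀ i ∈ F, i < G.edges.length) (hi : i ∈ F) :
    ∃ V ∈ G.comps F, i ∈ G.edgesIn F V := by
  obtain ⟨e, he⟩ : ∃ e, G.edges[i]? = some e := ⟨_, List.getElem?_eq_getElem (hF i hi)⟩
  induction e using Sym2.ind with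
  | _ x y =>
    obtain ⟨hx, hy⟩ := mem_Icc_of_edge he
    refine ⟨G.comp F x, comp_mem_comps hx, mem_edgesIn.2 ⟨hi, _, he, ?_⟩⟩
    intro z hz
    rw [mem_comp hx]
    rcases Sym2.mem_iff.1 hz with rfl | rfl
    · exact SimpleGraph.Reachable.refl _
    · exact reachable_of_edge hi he

/-- An edge larger than those of `F'` closes a cycle with a path of `F'` between its ends. -/
theorem exists_cycle_of_reachable {F' : Finset ℕ} (h : (G.sub F').Reachable u v)
    (hi : G.edges[i]? = some s(u, v)) (hlt : ∀ j ∈ F', j < i) :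
    ∃ C, G.IsCycle C ∧ i ∈ C ∧ ∀ j ∈ C, j = i ∨ j ∈ F' := by
  classical
  have huv := ne_of_edge hi
  obtain ⟨p, hp⟩ := h.exists_isPath
  have hpos : p.length ≠ 0 := fun h0 => huv (SimpleGraph.Walk.eq_of_length_eq_zero h0)
  obtain ⟨k, hk⟩ := Nat.exists_eq_succ_of_ne_zero hpos
  have hstep : ∀ j, j < p.length → ∃ m ∈ F', G.edges[m]? = some s(p.getVert j, p.getVert (j+1)) :=
    fun j hj => sub_adj.1 (p.adj_getVert_succ hj)
  choose! m hm1 hm2 using hstep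
  have hinj : ∀ a b, a ≤ p.length → b ≤ p.length → p.getVert a = p.getVert b → a = b :=
    fun a b ha hb hab => hp.getVert_injOn (by simpa using ha) (by simpa using hb) hab
  refine ⟨Finset.univ.image (fun j : Fin (k + 2) => if (j : ℕ) < p.length then m j else i),
    ⟨k, fun j => p.getVert j, fun j => if (j : ℕ) < p.length then m j else i, ?_, ?_, ?_, rfl⟩,
    ?_, ?_⟩
  · intro a b hab
    exact Fin.ext (hinj _ _ (by omega) (by omega) hab)
  · intro a b hab
    dsimp only at hab
    split_ifs at hab with h1 h2 h2
    · have e1 := hm2 a h1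
      rw [hab, hm2 b h2] at e1
      have e2 := Option.some.inj e1
      rw [Sym2.eq_iff] at e2
      rcases e2 with ⟨e2, -⟩ | ⟨e2, e3⟩
      · exact Fin.ext (hinj _ _ (by omega) (by omega) e2.symm)
      · have := hinj _ _ (by omega) (by omega) e2
        have := hinj _ _ (by omega) (by omega) e3
        omega
    · have := hlt _ (hm1 a h1); omega
    · have := hlt _ (hm1 b h2); omega
    · exact Fin.ext (by omega)
  · intro j
    dsimp only
    split_ifs with h1
    · rw [hm2 j h1]
      have : ((j + 1 : Fin (k + 2)) : ℕ) = j + 1 := by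
        rw [Fin.val_add_one_of_lt]
        rw [Fin.lt_def, Fin.val_last]; omega
      rw [this]
    · have hj : j = Fin.last (k + 1) := Fin.ext (by rw [Fin.val_last]; omega)
      subst hj
      have h3 : (Fin.last (k + 1) : ℕ) = p.length := by rw [Fin.val_last]; omega
      rw [h3, p.getVert_length, Fin.last_add_one, Fin.val_zero, p.getVert_zero, hi, Sym2.eq_swap]
  · rw [Finset.mem_image]
    refine ⟨Fin.last (k + 1), Finset.mem_univ _, if_neg ?_⟩
    rw [Fin.val_last]; omega
  · intro j hj
    obtain ⟨a, -, rfl⟩ := Finset.mem_image.1 hj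
    split_ifs with h1
    · exact Or.inr (hm1 _ h1)
    · exact Or.inl rfl

open scoped Fin.CommRing in
/-- The rest of a cycle connects the ends of any of its edges. -/
theorem reachable_of_brokenCircuit {C : Finset ℕ} (hC : G.IsCycle C) (hi : i ∈ C)
    (hF : C.erase i ⊆ F) :
    ∃ u v, G.edges[i]? = some s(u, v) ∧ (G.sub F).Reachable u v := by
  obtain ⟨k, v, e, hv, he, hed, rfl⟩ := hC
  obtain ⟨j, -, rfl⟩ := Finset.mem_image.1 hi
  refine ⟨v j, v (j + 1), hed j, SimpleGraph.Reachable.symm ?_⟩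
  have key : ∀ t : ℕ, t ≤ k + 1 →
      (G.sub F).Reachable (v (j + 1)) (v (j + 1 + (t : Fin (k + 2)))) := by
    intro t
    induction t with
    | zero => intro _; simp
    | succ t ih =>
      intro ht
      refine (ih (by omega)).trans ?_
      have h1 := hed (j + 1 + (t : Fin (k + 2)))
      rw [add_assoc _ (t : Fin (k + 2)) 1] at h1
      push_cast
      refine reachable_of_edge (hF ?_) h1
      rw [Finset.mem_erase]
      refine ⟨fun h => ?_, Finset.mem_image_of_mem _ (Finset.mem_univ _)⟩
      have h2 := he h
      rw [add_assoc, add_eq_left] at h2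
      have h3 : ((1 + t : ℕ) : Fin (k + 2)) = 0 := by push_cast; exact h2
      rw [Fin.natCast_eq_zero] at h3
      have := Nat.le_of_dvd (by omega) h3
      omega
  have h1 := key (k + 1) le_rfl
  have h2 : j + 1 + ((k + 1 : ℕ) : Fin (k + 2)) = j := by
    rw [add_assoc, add_eq_left]
    have h3 : ((1 + (k + 1) : ℕ) : Fin (k + 2)) = 0 := by
      rw [Fin.natCast_eq_zero]; exact ⟨1, by omega⟩
    rw [← h3]; push_cast; ring
  rwa [h2] at h1

/-- An edge set contains no broken circuit if and only if no edge of the graph joins two vertices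
that are already connected by smaller edges of the set. -/
theorem isNonBroken_iff : G.IsNonBroken F ↔ F ⊆ Finset.range G.edges.length ∧
    ∀ i u v, G.edges[i]? = some s(u, v) → ¬ (G.sub {j ∈ F | j < i}).Reachable u v := by
  unfold IsNonBroken
  refine and_congr ?_ ⟨fun h i u v hi hr => ?_, ?_⟩
  · simp only [Finset.subset_iff, Finset.mem_range]
  · obtain ⟨C, hC, hiC, hCF⟩ := exists_cycle_of_reachable hr hi
      (fun j hj => (Finset.mem_filter.1 hj).2)
    refine h (C.erase i) ⟨C, hC, i, hiC, fun f hf => ?_, rfl⟩ fun j hj => ?_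
    · rcases hCF f hf with rfl | h1
      · exact le_rfl
      · exact (Finset.mem_filter.1 h1).2.le
    · rw [Finset.mem_erase] at hj
      rcases hCF j hj.2 with h1 | h1
      · exact absurd h1 hj.1
      · exact (Finset.mem_filter.1 h1).1
  · rintro h B ⟨C, hC, e, heC, hmax, rfl⟩ hB
    obtain ⟨u, v, he, hr⟩ := reachable_of_brokenCircuit (F := {j ∈ F | j < e}) hC heC (by
      intro j hj
      refine Finset.mem_filter.2 ⟨hB hj, ?_⟩
      rw [Finset.mem_erase] at hj
      exact lt_of_le_of_ne (hmax j hj.2) hj.1)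
    exact h e u v he hr

variable (G) in
/-- The finite set of all edge sets that contain no broken circuit. -/
noncomputable def nbc : Finset (Finset ℕ) := by
  classical exact (Finset.range G.edges.length).powerset.filter G.IsNonBroken

theorem mem_nbc : F ∈ G.nbc ↔ G.IsNonBroken F := by
  classical
  simp only [nbc, Finset.mem_filter, Finset.mem_powerset, and_iff_right_iff_imp]
  exact fun h => (isNonBroken_iff.1 h).1

end LabeledGraph

/-! ### Compositions and sums over forest triples -/

/-- The finite set of all compositions of `n`, as lists of parts. -/
def compositions (n : ℕ) : Finset (List ℕ) :=
  Finset.univ.image (fun c : Composition n => c.blocks)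

theorem mem_compositions {n : ℕ} {α : List ℕ} : α ∈ compositions n ↔ IsCompositionOf α n := by
  simp only [compositions, Finset.mem_image, Finset.mem_univ, true_and, IsCompositionOf]
  constructor
  · rintro ⟨c, rfl⟩
    exact ⟨fun p hp => c.one_le_blocks hp, c.blocks_sum⟩
  · rintro ⟨h1, h2⟩
    exact ⟨⟨α, fun {i} hi => h1 i hi, h2⟩, rfl⟩

theorem compositions_zero : compositions 0 = {[]} := by
  ext α
  rw [mem_compositions, Finset.mem_singleton]
  constructor
  · rintro ⟨h1, h2⟩
    have := List.length_le_sum_of_one_le α h1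
    rw [h2] at this
    exact List.length_eq_zero_iff.1 (by omega)
  · rintro rfl
    exact ⟨by simp, by simp⟩

theorem ne_nil_of_mem_compositions {n : ℕ} {α : List ℕ} (hn : 1 ≤ n) (h : α ∈ compositions n) :
    α ≠ [] := by
  rintro rfl
  have := (mem_compositions.1 h).2
  simp at this
  omega

theorem cons_mem_compositions {n j : ℕ} {β : List ℕ} :
    j :: β ∈ compositions n ↔ (1 ≤ j ∧ j ≤ n) ∧ β ∈ compositions (n - j) := by
  simp only [mem_compositions, IsCompositionOf, List.mem_cons, forall_eq_or_imp, List.sum_cons]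
  constructor
  · rintro ⟨⟨h1, h2⟩, h3⟩
    exact ⟨⟨h1, by omega⟩, h2, by omega⟩
  · rintro ⟨⟨h1, h2⟩, h3, h4⟩
    exact ⟨⟨h1, h3⟩, by omega⟩

theorem reverse_mem_compositions {n : ℕ} {α : List ℕ} :
    α.reverse ∈ compositions n ↔ α ∈ compositions n := by
  simp [mem_compositions, IsCompositionOf]

section Sums

variable {M : Type*} [AddCommMonoid M]

theorem sum_compositions {n : ℕ} (hn : 1 ≤ n) (f : List ℕ → M) :
    ∑ α ∈ compositions n, f α =
      ∑ j ∈ Finset.Icc 1 n, ∑ β ∈ compositions (n - j), f (j :: β) := by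
  rw [Finset.sum_sigma']
  refine Finset.sum_bij' (fun α _ => (⟨α.headD 0, α.tail⟩ : (_ : ℕ) × List ℕ))
    (fun p _ => p.1 :: p.2) ?_ ?_ ?_ ?_ ?_
  · intro α hα
    obtain ⟨j, β, rfl⟩ := List.exists_cons_of_ne_nil (ne_nil_of_mem_compositions hn hα)
    rw [cons_mem_compositions] at hα
    simpa using hα
  · rintro ⟨j, β⟩ h
    rw [cons_mem_compositions]
    simpa using h
  · intro α hα
    obtain ⟨j, β, rfl⟩ := List.exists_cons_of_ne_nil (ne_nil_of_mem_compositions hn hα)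
    rfl
  · rintro ⟨j, β⟩ h
    rfl
  · intro α hα
    obtain ⟨j, β, rfl⟩ := List.exists_cons_of_ne_nil (ne_nil_of_mem_compositions hn hα)
    rfl

theorem sum_compositions_reverse (n : ℕ) (f : List ℕ → M) :
    ∑ α ∈ compositions n, f α.reverse = ∑ α ∈ compositions n, f α :=
  Finset.sum_bij' (fun α _ => α.reverse) (fun α _ => α.reverse)
    (fun _ h => reverse_mem_compositions.2 h) (fun _ h => reverse_mem_compositions.2 h)
    (fun α _ => α.reverse_reverse) (fun α _ => α.reverse_reverse) (fun _ _ => rfl)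

end Sums

namespace LabeledGraph

variable {G : LabeledGraph} {F : Finset ℕ} {R : Type*} [CommRing R]

/-- All pairs `(α, r)` that can be put on a tree with `n` vertices. -/
def labels (n : ℕ) : Finset ((_ : List ℕ) × ℕ) :=
  (compositions n).sigma (fun α => Finset.Icc 1 (α.headD 0))

/-- The forest triple with edge set `F` and with labels `p` on its trees. -/
noncomputable def mkForest (G : LabeledGraph) (F : Finset ℕ)
    (p : ∀ V ∈ G.comps F, (_ : List ℕ) × ℕ) : Finset TreeTriple := by
  classical
  exact (G.comps F).attach.image
    (fun V => ⟨V.1, G.edgesIn F V.1, (p V.1 V.2).1, (p V.1 V.2).2⟩)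

theorem mem_mkForest {p : ∀ V ∈ G.comps F, (_ : List ℕ) × ℕ} {T : TreeTriple} :
    T ∈ G.mkForest F p ↔
      ∃ (V : Finset ℕ) (hV : V ∈ G.comps F), T = ⟨V, G.edgesIn F V, (p V hV).1, (p V hV).2⟩ := by
  classical
  simp only [mkForest, Finset.mem_image, Finset.mem_attach, true_and, Subtype.exists]
  exact exists_congr fun V => exists_congr fun hV => eq_comm

theorem mkForest_mem_FT (hF : F ∈ G.nbc) {p : ∀ V ∈ G.comps F, (_ : List ℕ) × ℕ}
    (hp : p ∈ (G.comps F).pi (fun V => labels V.card)) : G.mkForest F p ∈ G.FT := by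
  refine ⟨F, mem_nbc.1 hF, ?_, ?_⟩
  · intro T hT
    obtain ⟨V, hV, rfl⟩ := mem_mkForest.1 hT
    have h1 := Finset.mem_pi.1 hp V hV
    rw [labels, Finset.mem_sigma, Finset.mem_Icc] at h1
    exact ⟨isComponent_iff.2 ⟨hV, rfl⟩, mem_compositions.1 h1.1, h1.2.1, h1.2.2⟩
  · intro v h1 h2
    have hv : v ∈ Finset.Icc 1 G.n := Finset.mem_Icc.2 ⟨h1, h2⟩
    refine ⟨_, ⟨mem_mkForest.2 ⟨G.comp F v, comp_mem_comps hv, rfl⟩, self_mem_comp hv⟩, ?_⟩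
    rintro T ⟨hT, hvT⟩
    obtain ⟨V, hV, rfl⟩ := mem_mkForest.1 hT
    obtain rfl := eq_comp_of_mem hV hvT
    rfl

/-- The edge set can be read off from the forest triple, because every edge lies in a component. -/
theorem edgeSet_mkForest (hF : F ∈ G.nbc) {p : ∀ V ∈ G.comps F, (_ : List ℕ) × ℕ} {i : ℕ} :
    i ∈ F ↔ ∃ T ∈ G.mkForest F p, i ∈ T.E := by
  constructor
  · intro hi
    obtain ⟨V, hV, hiV⟩ := exists_mem_edgesIn (mem_nbc.1 hF).1 hi
    exact ⟨_, mem_mkForest.2 ⟨V, hV, rfl⟩, hiV⟩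
  · rintro ⟨T, hT, hi⟩
    obtain ⟨V, hV, rfl⟩ := mem_mkForest.1 hT
    exact (mem_edgesIn.1 hi).1

theorem exists_eq_mkForest {S : Finset TreeTriple} (hS : S ∈ G.FT) :
    ∃ F ∈ G.nbc, ∃ p ∈ (G.comps F).pi (fun V => labels V.card), G.mkForest F p = S := by
  obtain ⟨F, hF, hT, hv⟩ := hS
  have hex : ∀ V ∈ G.comps F, ∃ T ∈ S, T.V = V := by
    intro V hV
    obtain ⟨v, hv'⟩ := nonempty_of_mem_comps hV
    have hmem := Finset.mem_Icc.1 (subset_of_mem_comps hV hv')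
    obtain ⟨T, ⟨hTS, hvT⟩, -⟩ := hv v hmem.1 hmem.2
    refine ⟨T, hTS, ?_⟩
    rw [eq_comp_of_mem hV hv', eq_comp_of_mem (isComponent_iff.1 (hT T hTS).1).1 hvT]
  have huniq : ∀ T ∈ S, ∀ T' ∈ S, T.V = T'.V → T = T' := by
    intro T hTS T' hTS' h
    have h1 := (isComponent_iff.1 (hT T hTS).1).1
    obtain ⟨v, hvT⟩ := nonempty_of_mem_comps h1
    have hmem := Finset.mem_Icc.1 (subset_of_mem_comps h1 hvT)
    exact (hv v hmem.1 hmem.2).unique ⟨hTS, hvT⟩ ⟨hTS', h ▸ hvT⟩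
  choose t htS htV using hex
  refine ⟨F, mem_nbc.2 hF, fun V hV => ⟨(t V hV).α, (t V hV).r⟩, ?_, ?_⟩
  · rw [Finset.mem_pi]
    intro V hV
    obtain ⟨-, h2, h3, h4⟩ := hT _ (htS V hV)
    rw [labels, Finset.mem_sigma, Finset.mem_Icc, mem_compositions]
    rw [htV] at h2
    exact ⟨h2, h3, h4⟩
  · ext T
    rw [mem_mkForest]
    have heq : ∀ V hV, t V hV = ⟨V, G.edgesIn F V, (t V hV).α, (t V hV).r⟩ := by
      intro V hV
      have h1 := (isComponent_iff.1 (hT _ (htS V hV)).1).2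
      rw [htV] at h1
      ext1
      · exact htV V hV
      · exact h1
      · rfl
      · rfl
    constructor
    · rintro ⟨V, hV, rfl⟩
      rw [← heq]
      exact htS V hV
    · intro hTS
      have h1 := (isComponent_iff.1 (hT T hTS).1).1
      refine ⟨T.V, h1, ?_⟩
      rw [← heq]
      exact huniq _ hTS _ (htS _ h1) (htV _ h1).symm

/-- A sum over forest triples of products over trees is a sum over edge sets without broken
circuits of products over components. -/
theorem sum_FT (G : LabeledGraph) (g : TreeTriple → R) :
    ∑ S ∈ G.FT_finite.toFinset, ∏ T ∈ S, g T =
      ∑ F ∈ G.nbc, ∏ V ∈ G.comps F, ∑ α ∈ compositions V.card,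
        ∑ r ∈ Finset.Icc 1 (α.headD 0), g ⟨V, G.edgesIn F V, α, r⟩ := by
  classical
  have h1 : ∀ F ∈ G.nbc, ∏ V ∈ G.comps F, ∑ α ∈ compositions V.card,
        ∑ r ∈ Finset.Icc 1 (α.headD 0), g ⟨V, G.edgesIn F V, α, r⟩ =
      ∑ p ∈ (G.comps F).pi (fun V => labels V.card),
        ∏ V ∈ (G.comps F).attach,
          g ⟨V.1, G.edgesIn F V.1, (p V.1 V.2).1, (p V.1 V.2).2⟩ := by
    intro F _
    rw [← Finset.prod_sum (G.comps F) (fun V => labels V.card)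
      (fun V p => g ⟨V, G.edgesIn F V, p.1, p.2⟩)]
    refine Finset.prod_congr rfl fun V _ => ?_
    rw [labels, Finset.sum_sigma]
  rw [Finset.sum_congr rfl h1, Finset.sum_sigma']
  symm
  refine Finset.sum_bij (fun x _ => G.mkForest x.1 x.2) ?_ ?_ ?_ ?_
  · rintro ⟨F, p⟩ h
    rw [Finset.mem_sigma] at h
    rw [Set.Finite.mem_toFinset]
    exact mkForest_mem_FT h.1 h.2
  · rintro ⟨F, p⟩ h ⟨F', p'⟩ h' heq
    rw [Finset.mem_sigma] at h h'
    dsimp only at h h' heq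
    obtain rfl : F = F' := by
      ext i
      rw [edgeSet_mkForest h.1 (p := p), edgeSet_mkForest h'.1 (p := p'), heq]
    congr 1
    funext V hV
    have h2 : (⟨V, G.edgesIn F V, (p V hV).1, (p V hV).2⟩ : TreeTriple) ∈ G.mkForest F p' :=
      heq ▸ mem_mkForest.2 ⟨V, hV, rfl⟩
    obtain ⟨V', hV', h3⟩ := mem_mkForest.1 h2
    rw [TreeTriple.mk.injEq] at h3
    obtain ⟨rfl, -, h4, h5⟩ := h3
    exact Sigma.ext h4 (heq_of_eq h5)
  · intro S hS
    rw [Set.Finite.mem_toFinset] at hS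
    obtain ⟨F, hF, p, hp, rfl⟩ := exists_eq_mkForest hS
    exact ⟨⟨F, p⟩, Finset.mem_sigma.2 ⟨hF, hp⟩, rfl⟩
  · rintro ⟨F, p⟩ h
    rw [mkForest, Finset.prod_image]
    rintro ⟨V, hV⟩ - ⟨V', hV'⟩ - h
    simp only [TreeTriple.mk.injEq] at h
    exact Subtype.ext h.1

end LabeledGraph

/-! ### The one-vertex join of two graphs -/

namespace LabeledGraph

variable {H K : LabeledGraph} {F₁ F₂ : Finset ℕ} {i u v x : ℕ}

/-- The edge set of `H + K` that consists of `F₁` in `H` and of `F₂` in `K`. -/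
def joinE (H : LabeledGraph) (F₁ F₂ : Finset ℕ) : Finset ℕ :=
  F₁ ∪ F₂.map (addRightEmbedding H.edges.length)

/-- The vertex set in `H + K` that corresponds to the vertex set `V` of `K`. -/
def shiftV (H : LabeledGraph) (V : Finset ℕ) : Finset ℕ := V.map (addRightEmbedding (H.n - 1))

/-- The component of the common vertex in `H + K`. -/
noncomputable def joinV (H K : LabeledGraph) (F₁ F₂ : Finset ℕ) : Finset ℕ :=
  H.comp F₁ H.n ∪ shiftV H (K.comp F₂ 1)

theorem mem_joinE : i ∈ joinE H F₁ F₂ ↔ i ∈ F₁ ∨ ∃ j ∈ F₂, j + H.edges.length = i := by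
  simp [joinE]

theorem mem_shiftV {V : Finset ℕ} : x ∈ shiftV H V ↔ ∃ y ∈ V, y + (H.n - 1) = x := by
  simp [shiftV]

theorem add_n : (H + K).n = H.n + K.n - 1 := rfl

theorem add_edges : (H + K).edges =
    H.edges ++ K.edges.map (Sym2.map (fun j => j + (H.n - 1))) := rfl

theorem add_length : (H + K).edges.length = H.edges.length + K.edges.length := by
  simp [add_edges]

theorem edge_left (hi : i < H.edges.length) : (H + K).edges[i]? = H.edges[i]? := by
  rw [add_edges, List.getElem?_append_left hi]

theorem edge_right : (H + K).edges[i + H.edges.length]? =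
    K.edges[i]?.map (Sym2.map (fun j => j + (H.n - 1))) := by
  rw [add_edges, List.getElem?_append_right (by omega), List.getElem?_map, Nat.add_sub_cancel]

theorem edge_right' (h : K.edges[i]? = some s(u, v)) :
    (H + K).edges[i + H.edges.length]? = some s(u + (H.n - 1), v + (H.n - 1)) := by
  rw [edge_right, h]; rfl

theorem exists_of_edge_right (h : (H + K).edges[i + H.edges.length]? = some s(u, v)) :
    ∃ u' v', K.edges[i]? = some s(u', v') ∧ u = u' + (H.n - 1) ∧ v = v' + (H.n - 1) := by
  rw [edge_right, Option.map_eq_some_iff] at h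
  obtain ⟨e, he, h⟩ := h
  induction e using Sym2.ind with
  | _ x y =>
    rw [Sym2.map_mk, Sym2.eq_iff] at h
    rcases h with ⟨rfl, rfl⟩ | ⟨rfl, rfl⟩
    · exact ⟨x, y, he, rfl, rfl⟩
    · exact ⟨y, x, he.trans (by rw [Sym2.eq_swap]), rfl, rfl⟩

/-- Reachability in `H + K` is tested after collapsing `K`, respectively `H`, to the common
vertex. -/
theorem reachable_join (hF : F₁ ⊆ Finset.range H.edges.length) :
    ((H + K).sub (joinE H F₁ F₂)).Reachable u v ↔
      (H.sub F₁).Reachable (min u H.n) (min v H.n) ∧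
      (K.sub F₂).Reachable (max 1 (u - (H.n - 1))) (max 1 (v - (H.n - 1))) := by
  have hn := H.pos
  constructor
  · intro h
    refine rel_of_reachable (r := fun u v => (H.sub F₁).Reachable (min u H.n) (min v H.n) ∧
      (K.sub F₂).Reachable (max 1 (u - (H.n - 1))) (max 1 (v - (H.n - 1))))
      (fun x => ⟨SimpleGraph.Reachable.refl _, SimpleGraph.Reachable.refl _⟩)
      (fun x y z h1 h2 => ⟨h1.1.trans h2.1, h1.2.trans h2.2⟩) ?_ h
    intro i hi x y he
    rcases mem_joinE.1 hi with hi | ⟨j, hj, rfl⟩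
    · rw [edge_left (Finset.mem_range.1 (hF hi))] at he
      obtain ⟨hx, hy⟩ := mem_Icc_of_edge he
      rw [Finset.mem_Icc] at hx hy
      rw [min_eq_left hx.2, min_eq_left hy.2, show x - (H.n - 1) = max 0 (x - (H.n - 1)) by simp,
        show max 1 (max 0 (x - (H.n - 1))) = 1 by omega,
        show max 1 (y - (H.n - 1)) = 1 by omega]
      exact ⟨reachable_of_edge hi he, SimpleGraph.Reachable.refl _⟩
    · obtain ⟨x', y', he', rfl, rfl⟩ := exists_of_edge_right he
      obtain ⟨hx, hy⟩ := mem_Icc_of_edge he'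
      rw [Finset.mem_Icc] at hx hy
      rw [show min (x' + (H.n - 1)) H.n = H.n by omega,
        show min (y' + (H.n - 1)) H.n = H.n by omega,
        show max 1 (x' + (H.n - 1) - (H.n - 1)) = x' by omega,
        show max 1 (y' + (H.n - 1) - (H.n - 1)) = y' by omega]
      exact ⟨SimpleGraph.Reachable.refl _, reachable_of_edge hj he'⟩
  · have h1 : ∀ x y, (H.sub F₁).Reachable x y → ((H + K).sub (joinE H F₁ F₂)).Reachable x y :=
      fun x y h => rel_of_reachable (fun _ => SimpleGraph.Reachable.refl _)
        (fun _ _ _ => SimpleGraph.Reachable.trans)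
        (fun i hi x y he => reachable_of_edge (mem_joinE.2 (Or.inl hi))
          ((edge_left (Finset.mem_range.1 (hF hi))).trans he)) h
    have h2 : ∀ x y, (K.sub F₂).Reachable x y →
        ((H + K).sub (joinE H F₁ F₂)).Reachable (x + (H.n - 1)) (y + (H.n - 1)) :=
      fun x y h => rel_of_reachable (r := fun x y =>
        ((H + K).sub (joinE H F₁ F₂)).Reachable (x + (H.n - 1)) (y + (H.n - 1)))
        (fun _ => SimpleGraph.Reachable.refl _)
        (fun _ _ _ => SimpleGraph.Reachable.trans)
        (fun i hi x y he => reachable_of_edge (mem_joinE.2 (Or.inr ⟨i, hi, rfl⟩))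
          (edge_right' he)) h
    rintro ⟨h3, h4⟩
    replace h3 := h1 _ _ h3
    replace h4 := h2 _ _ h4
    rcases le_total u H.n with hu | hu <;> rcases le_total v H.n with hv | hv
    · rwa [min_eq_left hu, min_eq_left hv] at h3
    · rw [min_eq_left hu, min_eq_right hv] at h3
      rw [show max 1 (u - (H.n - 1)) + (H.n - 1) = H.n by omega,
        show max 1 (v - (H.n - 1)) + (H.n - 1) = v by omega] at h4
      exact h3.trans h4
    · rw [min_eq_right hu, min_eq_left hv] at h3
      rw [show max 1 (u - (H.n - 1)) + (H.n - 1) = u by omega,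
        show max 1 (v - (H.n - 1)) + (H.n - 1) = H.n by omega] at h4
      exact h4.trans h3
    · rwa [show max 1 (u - (H.n - 1)) + (H.n - 1) = u by omega,
        show max 1 (v - (H.n - 1)) + (H.n - 1) = v by omega] at h4

theorem filter_joinE : {j ∈ joinE H F₁ F₂ | j < i} =
    joinE H {j ∈ F₁ | j < i} {j ∈ F₂ | j + H.edges.length < i} := by
  ext x
  simp only [Finset.mem_filter, mem_joinE]
  constructor
  · rintro ⟨h | ⟨j, hj, rfl⟩, hx⟩
    · exact Or.inl ⟨h, hx⟩
    · exact Or.inr ⟨j, ⟨hj, hx⟩, rfl⟩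
  · rintro (⟨h, hx⟩ | ⟨j, ⟨hj, hx⟩, rfl⟩)
    · exact ⟨Or.inl h, hx⟩
    · exact ⟨Or.inr ⟨j, hj, rfl⟩, hx⟩

/-- Broken circuits do not mix the two sides of a one-vertex join. -/
theorem joinE_mem_nbc (hF : F₁ ⊆ Finset.range H.edges.length) :
    joinE H F₁ F₂ ∈ (H + K).nbc ↔ F₁ ∈ H.nbc ∧ F₂ ∈ K.nbc := by
  have hn := H.pos
  have hfil : ∀ i, {j ∈ F₁ | j < i} ⊆ Finset.range H.edges.length :=
    fun i => (Finset.filter_subset _ _).trans hF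
  simp only [mem_nbc, isNonBroken_iff, filter_joinE, reachable_join (hfil _)]
  constructor
  · rintro ⟨h1, h2⟩
    refine ⟨⟨hF, fun i u v hi hr => ?_⟩, fun i hi => ?_, fun i u v hi hr => ?_⟩
    · refine h2 i u v ((edge_left (lt_of_edge hi)).trans hi) ⟨?_, ?_⟩
      · obtain ⟨hu, hv⟩ := mem_Icc_of_edge hi
        rw [Finset.mem_Icc] at hu hv
        rwa [min_eq_left hu.2, min_eq_left hv.2]
      · obtain ⟨hu, hv⟩ := mem_Icc_of_edge hi
        rw [Finset.mem_Icc] at hu hv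
        rw [show max 1 (u - (H.n - 1)) = 1 by omega, show max 1 (v - (H.n - 1)) = 1 by omega]
    · have := h1 (mem_joinE.2 (Or.inr ⟨i, hi, rfl⟩))
      rw [Finset.mem_range, add_length] at this
      rw [Finset.mem_range]; omega
    · obtain ⟨hu, hv⟩ := mem_Icc_of_edge hi
      rw [Finset.mem_Icc] at hu hv
      refine h2 _ _ _ (edge_right' hi) ⟨?_, ?_⟩
      · rw [show min (u + (H.n - 1)) H.n = H.n by omega,
          show min (v + (H.n - 1)) H.n = H.n by omega]
      · rw [show max 1 (u + (H.n - 1) - (H.n - 1)) = u by omega,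
          show max 1 (v + (H.n - 1) - (H.n - 1)) = v by omega]
        simpa using hr
  · rintro ⟨⟨-, h2⟩, h3, h4⟩
    refine ⟨fun i hi => ?_, fun i u v hi => ?_⟩
    · rw [Finset.mem_range, add_length]
      rcases mem_joinE.1 hi with hi | ⟨j, hj, rfl⟩
      · have := Finset.mem_range.1 (hF hi); omega
      · have := Finset.mem_range.1 (h3 hj); omega
    · rcases lt_or_ge i H.edges.length with hlt | hge
      · rw [edge_left hlt] at hi
        obtain ⟨hu, hv⟩ := mem_Icc_of_edge hi
        rw [Finset.mem_Icc] at hu hv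
        rw [min_eq_left hu.2, min_eq_left hv.2]
        exact fun h => h2 i u v hi h.1
      · obtain ⟨j, rfl⟩ := Nat.exists_eq_add_of_le' hge
        obtain ⟨u', v', he', rfl, rfl⟩ := exists_of_edge_right hi
        obtain ⟨hu, hv⟩ := mem_Icc_of_edge he'
        rw [Finset.mem_Icc] at hu hv
        rintro ⟨-, h⟩
        rw [show max 1 (u' + (H.n - 1) - (H.n - 1)) = u' by omega,
          show max 1 (v' + (H.n - 1) - (H.n - 1)) = v' by omega] at h
        refine h4 j u' v' he' ?_
        simpa using h

theorem sum_nbc_add {M : Type*} [AddCommMonoid M] (f : Finset ℕ → M) :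
    ∑ F ∈ (H + K).nbc, f F = ∑ F₁ ∈ H.nbc, ∑ F₂ ∈ K.nbc, f (joinE H F₁ F₂) := by
  rw [← Finset.sum_product']
  symm
  have hsub : ∀ {L : LabeledGraph} {F}, F ∈ L.nbc → F ⊆ Finset.range L.edges.length :=
    fun h => (isNonBroken_iff.1 (mem_nbc.1 h)).1
  refine Finset.sum_bij (fun p _ => joinE H p.1 p.2) ?_ ?_ ?_ (fun _ _ => rfl)
  · intro p hp
    rw [Finset.mem_product] at hp
    exact (joinE_mem_nbc (hsub hp.1)).2 hp
  · rintro ⟨A, B⟩ hp ⟨A', B'⟩ hp' h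
    rw [Finset.mem_product] at hp hp'
    dsimp only at h hp hp'
    rw [Finset.ext_iff] at h
    simp only [mem_joinE] at h
    congr 1
    · ext i
      refine ⟨fun hi => ?_, fun hi => ?_⟩
      · rcases (h i).1 (Or.inl hi) with h1 | ⟨j, hj, h1⟩
        · exact h1
        · have := Finset.mem_range.1 (hsub hp.1 hi); omega
      · rcases (h i).2 (Or.inl hi) with h1 | ⟨j, hj, h1⟩
        · exact h1
        · have := Finset.mem_range.1 (hsub hp'.1 hi); omega
    · ext i
      refine ⟨fun hi => ?_, fun hi => ?_⟩
      · rcases (h _).1 (Or.inr ⟨i, hi, rfl⟩) with h1 | ⟨j, hj, h1⟩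
        · have := Finset.mem_range.1 (hsub hp'.1 h1); omega
        · rwa [← Nat.add_right_cancel h1]
      · rcases (h _).2 (Or.inr ⟨i, hi, rfl⟩) with h1 | ⟨j, hj, h1⟩
        · have := Finset.mem_range.1 (hsub hp.1 h1); omega
        · rwa [← Nat.add_right_cancel h1]
  · intro F hF
    have h1 : F = joinE H {i ∈ F | i < H.edges.length}
        {i ∈ Finset.range K.edges.length | i + H.edges.length ∈ F} := by
      ext i
      simp only [mem_joinE, Finset.mem_filter, Finset.mem_range]
      constructor
      · intro hi
        have := Finset.mem_range.1 (hsub hF hi)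
        rw [add_length] at this
        rcases lt_or_ge i H.edges.length with hlt | hge
        · exact Or.inl ⟨hi, hlt⟩
        · refine Or.inr ⟨i - H.edges.length, ⟨by omega, ?_⟩, by omega⟩
          rwa [Nat.sub_add_cancel hge]
      · rintro (⟨h, -⟩ | ⟨j, ⟨-, h⟩, rfl⟩)
        · exact h
        · exact h
    refine ⟨(_, _), ?_, h1.symm⟩
    rw [Finset.mem_product]
    refine (joinE_mem_nbc ?_).1 (h1 ▸ hF)
    intro i hi
    exact Finset.mem_range.2 (Finset.mem_filter.1 hi).2

theorem n_mem_Icc (G : LabeledGraph) : G.n ∈ Finset.Icc 1 G.n := Finset.mem_Icc.2 ⟨G.pos, le_rfl⟩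

theorem one_mem_Icc (G : LabeledGraph) : 1 ∈ Finset.Icc 1 G.n := Finset.mem_Icc.2 ⟨le_rfl, G.pos⟩

theorem mem_erase_left {V : Finset ℕ} (hV : V ∈ (H.comps F₁).erase (H.comp F₁ H.n)) (hx : x ∈ V) :
    1 ≤ x ∧ x < H.n := by
  rw [Finset.mem_erase] at hV
  have h1 := Finset.mem_Icc.1 (subset_of_mem_comps hV.2 hx)
  refine ⟨h1.1, lt_of_le_of_ne h1.2 ?_⟩
  rintro rfl
  exact hV.1 (eq_comp_of_mem hV.2 hx)

theorem mem_erase_right {V : Finset ℕ} (hV : V ∈ (K.comps F₂).erase (K.comp F₂ 1)) (hx : x ∈ V) :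
    1 < x ∧ x ≤ K.n := by
  rw [Finset.mem_erase] at hV
  have h1 := Finset.mem_Icc.1 (subset_of_mem_comps hV.2 hx)
  refine ⟨lt_of_le_of_ne h1.1 ?_, h1.2⟩
  rintro rfl
  exact hV.1 (eq_comp_of_mem hV.2 hx)

theorem mem_joinV (hx : x ∈ joinV H K F₁ F₂) :
    (H.sub F₁).Reachable H.n (min x H.n) ∧ (K.sub F₂).Reachable 1 (max 1 (x - (H.n - 1))) := by
  have hn := H.pos
  rcases Finset.mem_union.1 hx with h | h
  · have h1 := Finset.mem_Icc.1 (comp_subset h)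
    rw [mem_comp (n_mem_Icc H)] at h
    rw [min_eq_left h1.2, show max 1 (x - (H.n - 1)) = 1 by omega]
    exact ⟨h, SimpleGraph.Reachable.refl _⟩
  · obtain ⟨y, hy, rfl⟩ := mem_shiftV.1 h
    have h1 := Finset.mem_Icc.1 (comp_subset hy)
    rw [mem_comp (one_mem_Icc K)] at hy
    rw [show min (y + (H.n - 1)) H.n = H.n by omega,
      show max 1 (y + (H.n - 1) - (H.n - 1)) = y by omega]
    exact ⟨SimpleGraph.Reachable.refl _, hy⟩

theorem mem_joinV_iff : x ∈ joinV H K F₁ F₂ ↔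
    (H.sub F₁).Reachable H.n (min x H.n) ∧ (K.sub F₂).Reachable 1 (max 1 (x - (H.n - 1))) := by
  have hn := H.pos
  refine ⟨mem_joinV, fun ⟨h1, h2⟩ => Finset.mem_union.2 ?_⟩
  rcases le_total x H.n with hx | hx
  · rw [min_eq_left hx] at h1
    exact Or.inl ((mem_comp (n_mem_Icc H)).2 h1)
  · refine Or.inr (mem_shiftV.2 ⟨_, (mem_comp (one_mem_Icc K)).2 h2, by omega⟩)

/-- Except for the two components through the common vertex, which are merged, the components of
`H` and `K` are kept. -/
theorem comps_join (hF : F₁ ⊆ Finset.range H.edges.length) :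
    (H + K).comps (joinE H F₁ F₂) = insert (joinV H K F₁ F₂)
      ((H.comps F₁).erase (H.comp F₁ H.n) ∪
        ((K.comps F₂).erase (K.comp F₂ 1)).image (shiftV H)) := by
  have hn := H.pos
  have hk := K.pos
  apply comps_eq
  · intro V hV
    rw [Finset.mem_insert, Finset.mem_union, Finset.mem_image] at hV
    simp only [Finset.mem_Icc, add_n]
    rcases hV with rfl | hV | ⟨V, hV, rfl⟩
    · exact ⟨H.n, ⟨hn, by omega⟩, Finset.mem_union_left _ (self_mem_comp (n_mem_Icc H))⟩
    · obtain ⟨v, hv⟩ := nonempty_of_mem_comps (Finset.mem_of_mem_erase hV)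
      have := mem_erase_left hV hv
      exact ⟨v, ⟨by omega, by omega⟩, hv⟩
    · obtain ⟨v, hv⟩ := nonempty_of_mem_comps (Finset.mem_of_mem_erase hV)
      have := mem_erase_right hV hv
      exact ⟨v + (H.n - 1), ⟨by omega, by omega⟩, mem_shiftV.2 ⟨v, hv, rfl⟩⟩
  · intro V hV x hx u
    rw [reachable_join hF]
    rw [Finset.mem_insert, Finset.mem_union, Finset.mem_image] at hV
    rcases hV with rfl | hV | ⟨V, hV, rfl⟩
    · rw [mem_joinV_iff] at hx ⊢
      exact ⟨fun h => ⟨hx.1.symm.trans h.1, hx.2.symm.trans h.2⟩,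
        fun h => ⟨hx.1.trans h.1, hx.2.trans h.2⟩⟩
    · have h1 := mem_erase_left hV hx
      have hV' := Finset.mem_of_mem_erase hV
      have hxI : x ∈ Finset.Icc 1 H.n := Finset.mem_Icc.2 ⟨h1.1, h1.2.le⟩
      have hVx := eq_comp_of_mem hV' hx
      rw [min_eq_left h1.2.le, show max 1 (x - (H.n - 1)) = 1 by omega]
      constructor
      · intro hu
        have h2 := mem_erase_left hV hu
        rw [min_eq_left h2.2.le, show max 1 (u - (H.n - 1)) = 1 by omega]
        rw [hVx, mem_comp hxI] at hu
        exact ⟨hu, SimpleGraph.Reachable.refl _⟩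
      · rintro ⟨h2, -⟩
        have h3 : min u H.n ∈ V := by rwa [hVx, mem_comp hxI]
        have h4 := mem_erase_left hV h3
        rwa [min_eq_left (by omega)] at h3
    · obtain ⟨y, hy, rfl⟩ := mem_shiftV.1 hx
      have h1 := mem_erase_right hV hy
      have hV' := Finset.mem_of_mem_erase hV
      have hyI : y ∈ Finset.Icc 1 K.n := Finset.mem_Icc.2 ⟨h1.1.le, h1.2⟩
      have hVy := eq_comp_of_mem hV' hy
      rw [show min (y + (H.n - 1)) H.n = H.n by omega,
        show max 1 (y + (H.n - 1) - (H.n - 1)) = y by omega, mem_shiftV]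
      constructor
      · rintro ⟨z, hz, rfl⟩
        have h2 := mem_erase_right hV hz
        rw [show min (z + (H.n - 1)) H.n = H.n by omega,
          show max 1 (z + (H.n - 1) - (H.n - 1)) = z by omega]
        rw [hVy, mem_comp hyI] at hz
        exact ⟨SimpleGraph.Reachable.refl _, hz⟩
      · rintro ⟨-, h2⟩
        have h3 : max 1 (u - (H.n - 1)) ∈ V := by rwa [hVy, mem_comp hyI]
        have h4 := mem_erase_right hV h3
        exact ⟨_, h3, by omega⟩
  · intro v hv
    rw [Finset.mem_Icc, add_n] at hv
    by_cases hj : v ∈ joinV H K F₁ F₂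
    · exact ⟨_, Finset.mem_insert_self _ _, hj⟩
    rw [mem_joinV_iff] at hj
    rcases le_total v H.n with h1 | h1
    · have hvI : v ∈ Finset.Icc 1 H.n := Finset.mem_Icc.2 ⟨hv.1, h1⟩
      refine ⟨H.comp F₁ v, Finset.mem_insert_of_mem (Finset.mem_union_left _
        (Finset.mem_erase.2 ⟨fun h => hj ?_, comp_mem_comps hvI⟩)), self_mem_comp hvI⟩
      rw [comp_eq_iff hvI] at h
      rw [min_eq_left h1, show max 1 (v - (H.n - 1)) = 1 by omega]
      exact ⟨h.symm, SimpleGraph.Reachable.refl _⟩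
    · have hvI : v - (H.n - 1) ∈ Finset.Icc 1 K.n := Finset.mem_Icc.2 ⟨by omega, by omega⟩
      refine ⟨shiftV H (K.comp F₂ (v - (H.n - 1))), Finset.mem_insert_of_mem
        (Finset.mem_union_right _ (Finset.mem_image_of_mem _
          (Finset.mem_erase.2 ⟨fun h => hj ?_, comp_mem_comps hvI⟩))),
        mem_shiftV.2 ⟨_, self_mem_comp hvI, by omega⟩⟩
      rw [comp_eq_iff hvI] at h
      rw [min_eq_right h1, show max 1 (v - (H.n - 1)) = v - (H.n - 1) by omega]
      exact ⟨SimpleGraph.Reachable.refl _, h.symm⟩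

theorem n_mem_joinV : H.n ∈ joinV H K F₁ F₂ :=
  Finset.mem_union_left _ (self_mem_comp (n_mem_Icc H))

theorem prod_comps_join {R : Type*} [CommMonoid R] (hF : F₁ ⊆ Finset.range H.edges.length)
    (w : Finset ℕ → R) :
    ∏ V ∈ (H + K).comps (joinE H F₁ F₂), w V = w (joinV H K F₁ F₂) *
      ((∏ V ∈ (H.comps F₁).erase (H.comp F₁ H.n), w V) *
        ∏ V ∈ (K.comps F₂).erase (K.comp F₂ 1), w (shiftV H V)) := by
  have hn := H.pos
  rw [comps_join hF, Finset.prod_insert, Finset.prod_union, Finset.prod_image]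
  · exact fun V _ V' _ h => Finset.map_injective _ h
  · rw [Finset.disjoint_left]
    intro V hV hV'
    obtain ⟨W, hW, rfl⟩ := Finset.mem_image.1 hV'
    obtain ⟨y, hy⟩ := nonempty_of_mem_comps (Finset.mem_of_mem_erase hW)
    have h1 := mem_erase_right hW hy
    have h2 := mem_erase_left hV (mem_shiftV.2 ⟨y, hy, rfl⟩)
    omega
  · intro h
    rcases Finset.mem_union.1 h with h | h
    · exact lt_irrefl _ (mem_erase_left h n_mem_joinV).2
    · obtain ⟨W, hW, h⟩ := Finset.mem_image.1 h
      have h1 := n_mem_joinV (H := H) (K := K) (F₁ := F₁) (F₂ := F₂)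
      rw [← h] at h1
      obtain ⟨y, hy, h2⟩ := mem_shiftV.1 h1
      have := mem_erase_right hW hy
      omega

theorem card_joinV : (joinV H K F₁ F₂).card + 1 =
    (H.comp F₁ H.n).card + (K.comp F₂ 1).card := by
  have hn := H.pos
  have h1 : H.comp F₁ H.n ∩ shiftV H (K.comp F₂ 1) = {H.n} := by
    ext x
    rw [Finset.mem_inter, mem_shiftV, Finset.mem_singleton]
    constructor
    · rintro ⟨h1, y, hy, rfl⟩
      have h2 := Finset.mem_Icc.1 (comp_subset h1)
      have h3 := Finset.mem_Icc.1 (comp_subset hy)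
      omega
    · rintro rfl
      exact ⟨self_mem_comp (n_mem_Icc H), 1, self_mem_comp (one_mem_Icc K), by omega⟩
  have h2 := Finset.card_union_add_card_inter (H.comp F₁ H.n) (shiftV H (K.comp F₂ 1))
  rw [h1, Finset.card_singleton, shiftV, Finset.card_map] at h2
  exact h2

theorem one_mem_joinV : 1 ∈ joinV H K F₁ F₂ ↔ 1 ∈ H.comp F₁ H.n := by
  have hn := H.pos
  refine ⟨fun h => ?_, fun h => Finset.mem_union_left _ h⟩
  rcases Finset.mem_union.1 h with h | h
  · exact h
  · obtain ⟨y, hy, h1⟩ := mem_shiftV.1 h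
    have h2 := Finset.mem_Icc.1 (comp_subset hy)
    have h3 : H.n = 1 := by omega
    have h4 := self_mem_comp (F := F₁) (n_mem_Icc H)
    rwa [h3] at h4 ⊢

end LabeledGraph

/-! ### Weights of compositions -/

section Weights

variable {R : Type*} [CommRing R] (z : R) (x Ψ : ℕ → R)

/-- The sum of `z ^ ℓ(α) x_α` over all compositions `α` of `n`. -/
def compSum (n : ℕ) : R := ∑ α ∈ compositions n, z ^ α.length * (α.map x).prod

/-- The part of `compSum` that belongs to compositions with last part at least `k`, where `k` is
positive. -/
def lastCompSum (k n : ℕ) : R := ∑ p ∈ Finset.Icc k n, z * x p * compSum z x (n - p)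

/-- The weight of a composition, the first part of which counts `Ψ` and the others `x`. -/
def listWeight (α : List ℕ) : R := z ^ (α.length - 1) * (Ψ (α.headD 0) * (α.tail.map x).prod)

/-- The total weight of all compositions of `n`. -/
def headSum (n : ℕ) : R := ∑ α ∈ compositions n, listWeight z x Ψ α

/-- The total weight of all compositions of `n` with last part at least `k`. -/
def lastSum (k n : ℕ) : R :=
  ∑ α ∈ compositions n, if k ≤ α.getLastD 0 then listWeight z x Ψ α else 0

theorem compSum_zero : compSum z x 0 = 1 := by
  simp [compSum, compositions_zero]

theorem compSum_eq {n : ℕ} (hn : 1 ≤ n) :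
    compSum z x n = ∑ p ∈ Finset.Icc 1 n, z * x p * compSum z x (n - p) := by
  rw [compSum, sum_compositions hn]
  refine Finset.sum_congr rfl fun j _ => ?_
  rw [compSum, Finset.mul_sum]
  refine Finset.sum_congr rfl fun β _ => ?_
  simp only [List.length_cons, List.map_cons, List.prod_cons, pow_succ]
  ring

theorem headSum_eq {n : ℕ} (hn : 1 ≤ n) :
    headSum z x Ψ n = ∑ j ∈ Finset.Icc 1 n, Ψ j * compSum z x (n - j) := by
  rw [headSum, sum_compositions hn]
  refine Finset.sum_congr rfl fun j _ => ?_
  rw [compSum, Finset.mul_sum]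
  refine Finset.sum_congr rfl fun β _ => ?_
  simp only [listWeight, List.length_cons, List.headD_cons, List.tail_cons, Nat.add_sub_cancel]
  ring

theorem lastCompSum_of_lt {k n : ℕ} (h : n < k) : lastCompSum z x k n = 0 := by
  rw [lastCompSum, Finset.Icc_eq_empty (by omega), Finset.sum_empty]

/-- Reversing the compositions turns the condition on the last part into one on the first part. -/
theorem sum_last_ge {k n : ℕ} (hk : 1 ≤ k) (hn : 1 ≤ n) :
    (∑ α ∈ compositions n, if k ≤ α.getLastD 0 then z ^ α.length * (α.map x).prod else 0) =
      lastCompSum z x k n := by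
  rw [← sum_compositions_reverse, sum_compositions hn, lastCompSum]
  have h1 : Finset.Icc k n ⊆ Finset.Icc 1 n := Finset.Icc_subset_Icc_left hk
  rw [← Finset.sum_subset h1]
  · refine Finset.sum_congr rfl fun p hp => ?_
    rw [compSum, Finset.mul_sum]
    refine Finset.sum_congr rfl fun β _ => ?_
    rw [Finset.mem_Icc] at hp
    simp only [List.reverse_cons, List.getLastD_concat, if_pos hp.1, List.length_append,
      List.length_reverse, List.length_singleton, List.map_append, List.map_reverse,
      List.prod_append, List.prod_reverse, List.map_singleton, List.prod_singleton, pow_succ]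
    ring
  · intro p hp hp'
    refine Finset.sum_eq_zero fun β _ => ?_
    rw [Finset.mem_Icc] at hp hp'
    rw [List.reverse_cons, List.getLastD_concat, if_neg (by omega)]

theorem lastSum_eq {k n : ℕ} (hk : 1 ≤ k) (hn : 1 ≤ n) :
    lastSum z x Ψ k n = (if k ≤ n then Ψ n else 0) +
      ∑ j ∈ Finset.Icc 1 n, Ψ j * lastCompSum z x k (n - j) := by
  have h1 : (if k ≤ n then Ψ n else 0) =
      ∑ j ∈ Finset.Icc 1 n, if j = n then (if k ≤ n then Ψ j else 0) else 0 := by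
    rw [Finset.sum_ite_eq' (Finset.Icc 1 n) n (fun j => if k ≤ n then Ψ j else 0),
      if_pos (Finset.mem_Icc.2 ⟨hn, le_rfl⟩)]
  rw [h1, ← Finset.sum_add_distrib, lastSum, sum_compositions hn]
  refine Finset.sum_congr rfl fun j hj => ?_
  rw [Finset.mem_Icc] at hj
  rcases hj.2.eq_or_lt with rfl | hlt
  · rw [Nat.sub_self, compositions_zero, Finset.sum_singleton, lastCompSum_of_lt _ _ (by omega)]
    simp [listWeight]
  · rw [if_neg (by omega), zero_add, ← sum_last_ge z x hk (by omega), Finset.mul_sum]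
    refine Finset.sum_congr rfl fun β hβ => ?_
    obtain ⟨p, γ, rfl⟩ := List.exists_cons_of_ne_nil (ne_nil_of_mem_compositions (by omega) hβ)
    rw [show (j :: p :: γ).getLastD 0 = (p :: γ).getLastD 0 by simp]
    split_ifs
    · simp only [listWeight, List.headD_cons, List.tail_cons, List.length_cons, Nat.add_sub_cancel]
      ring
    · simp

theorem headSum_single {k n : ℕ} (hk : 1 ≤ k) (hn : 1 ≤ n) :
    headSum z x (Pi.single k 1) n = if k ≤ n then compSum z x (n - k) else 0 := by
  rw [headSum_eq _ _ _ hn]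
  simp only [Pi.single_apply, ite_mul, one_mul, zero_mul]
  rw [Finset.sum_ite_eq']
  simp [hk]

/-- Cut a composition of `d + t` at the part that crosses the distance `t` from its beginning. -/
theorem compSum_add (d : ℕ) {t : ℕ} (ht : 1 ≤ t) :
    compSum z x (d + t) =
      ∑ k ∈ Finset.Icc 1 t, compSum z x (t - k) * lastCompSum z x k (d + k) := by
  induction t using Nat.strong_induction_on with
  | _ t ih =>
    obtain ⟨t, rfl⟩ := Nat.exists_eq_add_of_le' ht
    rw [Finset.sum_Icc_succ_top (by omega), Nat.sub_self, compSum_zero, one_mul,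
      compSum_eq _ _ (by omega), lastCompSum]
    have hsplit : Finset.Icc 1 (d + (t + 1)) =
        Finset.Icc 1 t ∪ Finset.Icc (t + 1) (d + (t + 1)) := by
      ext p; simp only [Finset.mem_union, Finset.mem_Icc]; omega
    rw [hsplit, Finset.sum_union (by
      rw [Finset.disjoint_left]; intro p; simp only [Finset.mem_Icc]; omega)]
    congr 1
    have h1 : ∀ p ∈ Finset.Icc 1 t, z * x p * compSum z x (d + (t + 1) - p) =
        ∑ k ∈ Finset.Icc 1 (t + 1 - p),
          z * x p * (compSum z x (t + 1 - p - k) * lastCompSum z x k (d + k)) := by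
      intro p hp
      rw [Finset.mem_Icc] at hp
      rw [show d + (t + 1) - p = d + (t + 1 - p) by omega, ih _ (by omega) (by omega),
        Finset.mul_sum]
    have h2 : ∀ k ∈ Finset.Icc 1 t, compSum z x (t + 1 - k) * lastCompSum z x k (d + k) =
        ∑ p ∈ Finset.Icc 1 (t + 1 - k),
          z * x p * (compSum z x (t + 1 - p - k) * lastCompSum z x k (d + k)) := by
      intro k hk
      rw [Finset.mem_Icc] at hk
      rw [compSum_eq _ _ (by omega), Finset.sum_mul]
      refine Finset.sum_congr rfl fun p _ => ?_
      rw [show t + 1 - k - p = t + 1 - p - k by omega]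
      ring
    rw [Finset.sum_congr rfl h1, Finset.sum_congr rfl h2]
    refine Finset.sum_comm' fun p k => ?_
    simp only [Finset.mem_Icc]
    omega

/-- Cut a composition of `m + t - 1` at the part that crosses the distance `t` from its end: if
the parts after that one add up to `t - k`, then the crossing part is at least `k`. -/
theorem headSum_add {m t : ℕ} (hm : 1 ≤ m) (ht : 1 ≤ t) :
    headSum z x Ψ (m + t - 1) =
      ∑ k ∈ Finset.Icc 1 t, lastSum z x Ψ k (m + k - 1) * compSum z x (t - k) := by
  rw [headSum_eq _ _ _ (by omega)]
  have h1 : ∀ k ∈ Finset.Icc 1 t, lastSum z x Ψ k (m + k - 1) * compSum z x (t - k) =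
      Ψ (m + k - 1) * compSum z x (t - k) + ∑ j ∈ Finset.Icc 1 (m - 1),
        Ψ j * (compSum z x (t - k) * lastCompSum z x k (m - 1 - j + k)) := by
    intro k hk
    rw [Finset.mem_Icc] at hk
    rw [lastSum_eq _ _ _ hk.1 (by omega), if_pos (by omega), add_mul, Finset.sum_mul]
    congr 1
    symm
    refine Finset.sum_subset_zero_on_sdiff (Finset.Icc_subset_Icc_right (by omega)) ?_ ?_
    · intro j hj
      rw [Finset.mem_sdiff, Finset.mem_Icc, Finset.mem_Icc] at hj
      rw [lastCompSum_of_lt _ _ (by omega), mul_zero, zero_mul]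
    · intro j hj
      rw [Finset.mem_Icc] at hj
      rw [show m - 1 - j + k = m + k - 1 - j by omega]
      ring
  rw [Finset.sum_congr rfl h1, Finset.sum_add_distrib, Finset.sum_comm]
  have hsplit : Finset.Icc 1 (m + t - 1) =
      Finset.Icc 1 (m - 1) ∪ Finset.Icc m (m + t - 1) := by
    ext p; simp only [Finset.mem_union, Finset.mem_Icc]; omega
  rw [hsplit, Finset.sum_union (by
    rw [Finset.disjoint_left]; intro p; simp only [Finset.mem_Icc]; omega), add_comm]
  congr 1
  · refine Finset.sum_bij' (fun j _ => j + 1 - m) (fun k _ => m + k - 1) ?_ ?_ ?_ ?_ ?_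
    · intro j; simp only [Finset.mem_Icc]; omega
    · intro j; simp only [Finset.mem_Icc]; omega
    · intro j; simp only [Finset.mem_Icc]; omega
    · intro j; simp only [Finset.mem_Icc]; omega
    · intro j hj
      rw [Finset.mem_Icc] at hj
      rw [show m + (j + 1 - m) - 1 = j by omega,
        show t - (j + 1 - m) = m + t - 1 - j by omega]
  · refine Finset.sum_congr rfl fun j hj => ?_
    rw [Finset.mem_Icc] at hj
    rw [← Finset.mul_sum, ← compSum_add _ _ _ ht,
      show m - 1 - j + t = m + t - 1 - j by omega]

end Weights

/-! ### Weighted sums over forest triples and their factorization -/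

namespace LabeledGraph

variable {R : Type*} [CommRing R] (z : R) (x : ℕ → R)

/-- The weight of a tree triple: every part `p` of the composition beyond the first counts `z x_p`,
and the first part counts `x`, or `ψ α₁ r` on the tree that contains vertex `1`. -/
noncomputable def treeWeight (ψ : ℕ → ℕ → R) (T : TreeTriple) : R :=
  z ^ (T.α.length - 1) *
    ((if 1 ∈ T.V then ψ T.firstPart T.r else x T.firstPart) * (T.α.tail.map x).prod)

/-- The total weight of all forest triples of `G`. The value `z = -1` gives the signed sums, the
value `z = 0` selects the unit forest triples. -/
noncomputable def forestSum (G : LabeledGraph) (ψ : ℕ → ℕ → R) : R :=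
  ∑ S ∈ G.FT_finite.toFinset, ∏ T ∈ S, treeWeight z x ψ T

/-- The function `ψ` summed over the admissible values of `r`. -/
def sumR (ψ : ℕ → ℕ → R) (j : ℕ) : R := ∑ r ∈ Finset.Icc 1 j, ψ j r

/-- The total weight of all ways to label a tree with vertex set `V`. -/
noncomputable def compWeight (Ψ : ℕ → R) (V : Finset ℕ) : R :=
  if 1 ∈ V then headSum z x Ψ V.card else headSum z x (fun j => j * x j) V.card

/-- The total weight of all ways to label, so that the last part is at least `k`, a tree with `n`
vertices; the flag says whether the tree contains vertex `1`. -/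
noncomputable def endWeight (Ψ : ℕ → R) (k : ℕ) (V : Finset ℕ) (n : ℕ) : R :=
  if 1 ∈ V then lastSum z x Ψ k n else lastSum z x (fun j => j * x j) k n

/-- The sum over the edge sets of `H` without broken circuits in which the component of the last
vertex is enlarged by `k - 1` vertices and gets a composition with last part at least `k`. -/
noncomputable def joinCoeff (H : LabeledGraph) (Ψ : ℕ → R) (k : ℕ) : R :=
  ∑ F ∈ H.nbc, endWeight z x Ψ k (H.comp F H.n) ((H.comp F H.n).card + k - 1) *
    ∏ V ∈ (H.comps F).erase (H.comp F H.n), compWeight z x Ψ V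

/-- The indicator function of `α₁ = i` and `r = ρ`. -/
def indicator (R : Type*) [CommRing R] (i ρ j r : ℕ) : R := if j = i ∧ r = ρ then 1 else 0

variable {z x} {ψ : ℕ → ℕ → R} {G H K : LabeledGraph}

theorem sum_treeWeight (V E : Finset ℕ) (α : List ℕ) :
    ∑ r ∈ Finset.Icc 1 (α.headD 0), treeWeight z x ψ ⟨V, E, α, r⟩ =
      if 1 ∈ V then listWeight z x (sumR ψ) α else listWeight z x (fun j => j * x j) α := by
  unfold treeWeight listWeight TreeTriple.firstPart sumR
  dsimp only
  split_ifs with h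
  · rw [← Finset.mul_sum, ← Finset.sum_mul]
  · rw [Finset.sum_const, Nat.card_Icc, Nat.add_sub_cancel, nsmul_eq_mul]
    ring

theorem sum_sum_treeWeight (V E : Finset ℕ) :
    ∑ α ∈ compositions V.card, ∑ r ∈ Finset.Icc 1 (α.headD 0), treeWeight z x ψ ⟨V, E, α, r⟩ =
      compWeight z x (sumR ψ) V := by
  simp only [sum_treeWeight, compWeight]
  split_ifs <;> rfl

theorem forestSum_eq : forestSum z x G ψ =
    ∑ F ∈ G.nbc, ∏ V ∈ G.comps F, compWeight z x (sumR ψ) V := by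
  simp only [forestSum, sum_FT, sum_sum_treeWeight]

theorem subset_range_of_mem_nbc {F : Finset ℕ} (h : F ∈ G.nbc) :
    F ⊆ Finset.range G.edges.length := (isNonBroken_iff.1 (mem_nbc.1 h)).1

theorem card_comp_pos {F : Finset ℕ} {v : ℕ} (hv : v ∈ Finset.Icc 1 G.n) :
    1 ≤ (G.comp F v).card := Finset.card_pos.2 ⟨v, self_mem_comp hv⟩

theorem sumR_indicator {i ρ : ℕ} (h1 : 1 ≤ ρ) (h2 : ρ ≤ i) :
    sumR (indicator R i ρ) = Pi.single i 1 := by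
  funext j
  rw [sumR, Pi.single_apply]
  split_ifs with h
  · subst h
    rw [Finset.sum_eq_single ρ]
    · simp [indicator]
    · intro b _ hb; simp [indicator, hb]
    · intro hb; rw [Finset.mem_Icc] at hb; omega
  · exact Finset.sum_eq_zero fun r _ => by simp [indicator, h]

theorem compWeight_shiftV {V F : Finset ℕ} {Ψ : ℕ → R}
    (hV : V ∈ (K.comps F).erase (K.comp F 1)) :
    compWeight z x Ψ (shiftV H V) = headSum z x (fun j => j * x j) V.card := by
  rw [compWeight, if_neg, shiftV, Finset.card_map]
  intro h
  obtain ⟨y, hy, h1⟩ := mem_shiftV.1 h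
  have := mem_erase_right hV hy
  omega

theorem compWeight_erase {V F : Finset ℕ} {Ψ : ℕ → R}
    (hV : V ∈ (K.comps F).erase (K.comp F 1)) :
    compWeight z x Ψ V = headSum z x (fun j => j * x j) V.card := by
  rw [compWeight, if_neg]
  intro h
  have := mem_erase_right hV h
  omega

/-- The composition on the tree through the common vertex of `H + K` is cut where it leaves `K`;
this factors the sum over the forest triples of `H + K`. -/
theorem forestSum_add : forestSum z x (H + K) ψ =
    ∑ k ∈ Finset.Icc 1 K.n,
      forestSum z x K (indicator R k 1) * joinCoeff z x H (sumR ψ) k := by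
  simp only [forestSum_eq, joinCoeff, Finset.sum_mul_sum]
  rw [sum_nbc_add, Finset.sum_comm, Finset.sum_comm (s := Finset.Icc 1 K.n)]
  refine Finset.sum_congr rfl fun F₂ _ => ?_
  rw [Finset.sum_comm]
  refine Finset.sum_congr rfl fun F₁ hF₁ => ?_
  have h1 := one_mem_Icc K
  have ht : 1 ≤ (K.comp F₂ 1).card := card_comp_pos h1
  have hm : 1 ≤ (H.comp F₁ H.n).card := card_comp_pos (n_mem_Icc H)
  have htn : (K.comp F₂ 1).card ≤ K.n := by
    simpa using Finset.card_le_card (comp_subset (G := K) (F := F₂) (v := 1))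
  rw [prod_comps_join (subset_range_of_mem_nbc hF₁),
    Finset.prod_congr rfl (fun V hV => compWeight_shiftV hV)]
  have h2 : ∀ k ∈ Finset.Icc 1 K.n, ∏ V ∈ K.comps F₂, compWeight z x (sumR (indicator R k 1)) V =
      (if k ≤ (K.comp F₂ 1).card then compSum z x ((K.comp F₂ 1).card - k) else 0) *
        ∏ V ∈ (K.comps F₂).erase (K.comp F₂ 1), headSum z x (fun j => j * x j) V.card := by
    intro k hk
    rw [Finset.mem_Icc] at hk
    rw [← Finset.mul_prod_erase _ _ (comp_mem_comps h1),
      Finset.prod_congr rfl (fun V hV => compWeight_erase hV), sumR_indicator le_rfl hk.1,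
      compWeight, if_pos (self_mem_comp h1), headSum_single _ _ hk.1 ht]
  have h3 : compWeight z x (sumR ψ) (joinV H K F₁ F₂) =
      ∑ k ∈ Finset.Icc 1 (K.comp F₂ 1).card,
        endWeight z x (sumR ψ) k (H.comp F₁ H.n) ((H.comp F₁ H.n).card + k - 1) *
          compSum z x ((K.comp F₂ 1).card - k) := by
    have hc := card_joinV (H := H) (K := K) (F₁ := F₁) (F₂ := F₂)
    simp only [compWeight, one_mem_joinV, endWeight]
    rw [show (joinV H K F₁ F₂).card = (H.comp F₁ H.n).card + (K.comp F₂ 1).card - 1 by omega]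
    split_ifs
    · exact headSum_add _ _ _ hm ht
    · exact headSum_add _ _ _ hm ht
  rw [h3, Finset.sum_mul]
  refine Finset.sum_subset_zero_on_sdiff (Finset.Icc_subset_Icc_right htn) ?_ ?_
  · intro k hk
    rw [Finset.mem_sdiff, Finset.mem_Icc, Finset.mem_Icc] at hk
    rw [h2 k (Finset.mem_Icc.2 hk.1), if_neg (by omega), zero_mul, zero_mul]
  · intro k hk
    rw [Finset.mem_Icc] at hk
    rw [h2 k (Finset.mem_Icc.2 ⟨hk.1, hk.2.trans htn⟩), if_pos hk.2]
    ring

theorem comp_full {U : LabeledGraph} (hU : U.IsTree) :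
    U.comp (Finset.range U.edges.length) 1 = Finset.Icc 1 U.n := by
  ext v
  rw [mem_comp (one_mem_Icc U)]
  refine ⟨mem_Icc_of_reachable (one_mem_Icc U), fun hv => ?_⟩
  rw [Finset.mem_Icc] at hv
  exact hU.1 1 v le_rfl U.pos hv.1 hv.2

theorem full_mem_nbc {U : LabeledGraph} (hU : U.IsTree) :
    Finset.range U.edges.length ∈ U.nbc := by
  rw [mem_nbc]
  refine ⟨fun i hi => Finset.mem_range.1 hi, ?_⟩
  rintro B ⟨C, hC, -⟩
  exact absurd hC (hU.2 C)

/-- The tree triple is not at the common vertex of `H + U`, or it contains all edges of `U` and its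
last part is at least the number of vertices of `U`. -/
def CoversTree (H U : LabeledGraph) (T : TreeTriple) : Prop :=
  H.n ∈ T.V → (∀ i, H.edges.length ≤ i → i < (H + U).edges.length → i ∈ T.E) ∧ U.n ≤ T.lastPart

theorem edgesIn_joinV_iff {U : LabeledGraph} (hU : U.IsTree) {F₁ F₂ : Finset ℕ}
    (hF₁ : F₁ ⊆ Finset.range H.edges.length) (hF₂ : F₂ ⊆ Finset.range U.edges.length) :
    (∀ i, H.edges.length ≤ i → i < (H + U).edges.length →
      i ∈ (H + U).edgesIn (joinE H F₁ F₂) (joinV H U F₁ F₂)) ↔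
      F₂ = Finset.range U.edges.length := by
  rw [add_length]
  constructor
  · intro h
    refine Finset.Subset.antisymm hF₂ fun i hi => ?_
    rw [Finset.mem_range] at hi
    have h1 := (mem_edgesIn.1 (h (i + H.edges.length) (by omega) (by omega))).1
    rcases mem_joinE.1 h1 with h1 | ⟨j, hj, h2⟩
    · have := Finset.mem_range.1 (hF₁ h1); omega
    · rwa [← Nat.add_right_cancel h2]
  · rintro rfl i h1 h2
    obtain ⟨j, rfl⟩ := Nat.exists_eq_add_of_le' h1
    have hj : j < U.edges.length := by omega
    refine mem_edgesIn.2 ⟨mem_joinE.2 (Or.inr ⟨j, Finset.mem_range.2 hj, rfl⟩), _,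
      by rw [edge_right, List.getElem?_eq_getElem hj]; rfl, ?_⟩
    intro v hv
    obtain ⟨y, hy, rfl⟩ := Sym2.mem_map.1 hv
    refine Finset.mem_union_right _ (mem_shiftV.2 ⟨y, ?_, rfl⟩)
    rw [comp_full hU, Finset.mem_Icc]
    exact U.mem_range _ (List.getElem_mem hj) y hy

open scoped Classical in
/-- When `U` is a tree, the forest triples of `H + U` that contain all edges of `U` correspond to
the edge sets of `H`, and the coefficients of `H` count them. Only the number of vertices of `U`
matters. -/
theorem sum_coversTree {U : LabeledGraph} (hU : U.IsTree) :
    ∑ S ∈ (H + U).FT_finite.toFinset,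
        ∏ T ∈ S, (if CoversTree H U T then treeWeight z x ψ T else 0) =
      joinCoeff z x H (sumR ψ) U.n := by
  rw [sum_FT (H + U) (fun T => if CoversTree H U T then treeWeight z x ψ T else 0),
    sum_nbc_add, joinCoeff]
  refine Finset.sum_congr rfl fun F₁ hF₁ => ?_
  have hs₁ := subset_range_of_mem_nbc hF₁
  rw [Finset.sum_eq_single_of_mem _ (full_mem_nbc hU)]
  · rw [prod_comps_join hs₁ (fun V => ∑ α ∈ compositions V.card, ∑ r ∈ Finset.Icc 1 (α.headD 0),
        if CoversTree H U ⟨V, _, α, r⟩ then treeWeight z x ψ ⟨V, _, α, r⟩ else 0)]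
    have he : (U.comps (Finset.range U.edges.length)).erase
        (U.comp (Finset.range U.edges.length) 1) = ∅ := by
      rw [Finset.eq_empty_iff_forall_notMem]
      intro V hV
      obtain ⟨v, hv⟩ := nonempty_of_mem_comps (Finset.mem_of_mem_erase hV)
      have h1 := subset_of_mem_comps (Finset.mem_of_mem_erase hV) hv
      rw [← comp_full hU, mem_comp (one_mem_Icc U)] at h1
      rw [eq_comp_of_mem (Finset.mem_of_mem_erase hV) hv, comp_eq_of_reachable h1] at hV
      simp at hV
    rw [he, Finset.prod_empty, mul_one]
    congr 1
    · have hc := card_joinV (H := H) (K := U) (F₁ := F₁) (F₂ := Finset.range U.edges.length)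
      rw [comp_full hU, Nat.card_Icc, Nat.add_sub_cancel] at hc
      rw [show (H.comp F₁ H.n).card + U.n - 1 =
        (joinV H U F₁ (Finset.range U.edges.length)).card by omega]
      have h1 : ∀ α r, CoversTree H U ⟨joinV H U F₁ (Finset.range U.edges.length),
          (H + U).edgesIn (joinE H F₁ (Finset.range U.edges.length))
            (joinV H U F₁ (Finset.range U.edges.length)), α, r⟩ ↔ U.n ≤ α.getLastD 0 := by
        intro α r
        unfold CoversTree TreeTriple.lastPart
        simp only [edgesIn_joinV_iff hU hs₁ (Finset.Subset.refl _), true_and, n_mem_joinV,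
          forall_const]
      simp only [h1]
      unfold endWeight lastSum
      split_ifs with h3
      all_goals
        refine Finset.sum_congr rfl fun α _ => ?_
        by_cases h2 : U.n ≤ α.getLastD 0
        · simp only [if_pos h2, sum_treeWeight, one_mem_joinV, h3, if_true, if_false]
        · simp only [if_neg h2, Finset.sum_const_zero]
    · refine Finset.prod_congr rfl fun V hV => ?_
      have h1 : ∀ E α r, CoversTree H U ⟨V, E, α, r⟩ := by
        intro E α r h
        exact absurd (mem_erase_left hV h).2 (lt_irrefl _)
      simp only [h1, if_true, sum_sum_treeWeight]
  · intro F₂ hF₂ hne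
    have hs₂ := subset_range_of_mem_nbc hF₂
    rw [prod_comps_join hs₁ (fun V => ∑ α ∈ compositions V.card, ∑ r ∈ Finset.Icc 1 (α.headD 0),
        if CoversTree H U ⟨V, _, α, r⟩ then treeWeight z x ψ ⟨V, _, α, r⟩ else 0)]
    have h1 : ∀ α r, ¬ CoversTree H U ⟨joinV H U F₁ F₂,
        (H + U).edgesIn (joinE H F₁ F₂) (joinV H U F₁ F₂), α, r⟩ := by
      intro α r h
      exact hne ((edgesIn_joinV_iff hU hs₁ hs₂).1 (h n_mem_joinV).1)
    simp [h1]

/-- Exactly one tree triple of a forest triple contains vertex `1`. -/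
theorem existsUnique_min {S : Finset TreeTriple} (hS : S ∈ G.FT) : ∃! T, T ∈ S ∧ 1 ∈ T.V := by
  obtain ⟨F, -, -, h⟩ := hS
  exact h 1 le_rfl G.pos

theorem firstPart_mul_tail {S : Finset TreeTriple} (hS : S ∈ G.FT) {T : TreeTriple} (hT : T ∈ S) :
    T.firstPart :: T.α.tail = T.α := by
  obtain ⟨F, -, h, -⟩ := hS
  obtain ⟨-, -, h1, h2⟩ := h T hT
  unfold TreeTriple.firstPart at h2 ⊢
  cases hα : T.α with
  | nil => rw [hα] at h2; simp at h2; omega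
  | cons a l => rfl

theorem prod_map_sum {ι : Type*} (s : Finset ι) (f : ι → Multiset ℕ) :
    ((∑ i ∈ s, f i).map x).prod = ∏ i ∈ s, ((f i).map x).prod := by
  rw [← Multiset.coe_mapAddMonoidHom, map_sum, Multiset.prod_sum]

theorem prod_treeWeight {S : Finset TreeTriple} (hS : S ∈ G.FT) :
    ∏ T ∈ S, treeWeight z x (fun j _ => x j) T =
      z ^ (∑ T ∈ S, (T.α.length - 1)) * ((typeOf S).map x).prod := by
  simp only [treeWeight, ite_self]
  rw [Finset.prod_mul_distrib, Finset.prod_pow_eq_pow_sum, typeOf, prod_map_sum]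
  congr 1
  refine Finset.prod_congr rfl fun T hT => ?_
  rw [← List.prod_cons, ← List.map_cons, firstPart_mul_tail hS hT, Multiset.map_coe,
    Multiset.prod_coe]

open scoped Classical in
theorem prod_treeWeight_indicator {S : Finset TreeTriple} (hS : S ∈ G.FT) (i ρ : ℕ) :
    ∏ T ∈ S, treeWeight z x (indicator R i ρ) T =
      if ∃ T ∈ S, 1 ∈ T.V ∧ T.firstPart = i ∧ T.r = ρ then
        z ^ (∑ T ∈ S, (T.α.length - 1)) * ((reducedType S).map x).prod else 0 := by
  obtain ⟨T₀, ⟨h1, h2⟩, h3⟩ := existsUnique_min hS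
  split_ifs with h
  · obtain ⟨T, hT, hT1, hi, hρ⟩ := h
    obtain rfl := h3 T ⟨hT, hT1⟩
    simp only [treeWeight]
    rw [Finset.prod_mul_distrib, Finset.prod_pow_eq_pow_sum, reducedType, prod_map_sum]
    congr 1
    refine Finset.prod_congr rfl fun T' hT' => ?_
    split_ifs with h4
    · obtain rfl := h3 T' ⟨hT', h4⟩
      rw [indicator, if_pos ⟨hi, hρ⟩, one_mul, Multiset.map_coe, Multiset.prod_coe]
    · rw [← List.prod_cons, ← List.map_cons, firstPart_mul_tail hS hT', Multiset.map_coe,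
        Multiset.prod_coe]
  · refine Finset.prod_eq_zero h1 ?_
    rw [treeWeight, if_pos h2, indicator, if_neg, zero_mul, mul_zero]
    exact fun h5 => h ⟨T₀, h1, h2, h5⟩

end LabeledGraph

/-! ### Sums over finite sets by their gaps -/

section Gaps

variable {R : Type*} [CommRing R] (w : ℕ → R)

/-- The largest element of `M` below `e`. -/
def prevMem (M : Finset ℕ) (e : ℕ) : ℕ := ({m ∈ M | m < e}).sup id

/-- The product of the weights of the distances between consecutive elements of `M`, where `p` is
the least element of `M`. -/
def gapProd (p : ℕ) (M : Finset ℕ) : R := ∏ e ∈ M.erase p, w (e - prevMem M e)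

/-- The sets of natural numbers with least element `p` and largest element `q`. -/
def setsBetween (p q : ℕ) : Finset (Finset ℕ) := {M ∈ (Finset.Icc p q).powerset | p ∈ M ∧ q ∈ M}

variable {w} {M : Finset ℕ} {p q e : ℕ}

theorem mem_setsBetween : M ∈ setsBetween p q ↔ (∀ m ∈ M, p ≤ m ∧ m ≤ q) ∧ p ∈ M ∧ q ∈ M := by
  simp [setsBetween, Finset.subset_iff]

theorem le_prevMem {m : ℕ} (hm : m ∈ M) (h : m < e) : m ≤ prevMem M e :=
  Finset.le_sup (f := id) (Finset.mem_filter.2 ⟨hm, h⟩)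

theorem prevMem_mem (hp : p ∈ M) (h : p < e) : prevMem M e ∈ M ∧ prevMem M e < e := by
  obtain ⟨m, hm, h1⟩ := Finset.exists_mem_eq_sup {m ∈ M | m < e}
    ⟨p, Finset.mem_filter.2 ⟨hp, h⟩⟩ id
  rw [prevMem, h1]
  exact Finset.mem_filter.1 hm

theorem prevMem_insert_top (hq : q ∈ M) (hM : ∀ m ∈ M, m ≤ q) (he : q < e) :
    prevMem (insert e M) e = q := by
  apply le_antisymm
  · have h := prevMem_mem (Finset.mem_insert_of_mem (a := q) (b := e) hq) he
    rcases Finset.mem_insert.1 h.1 with h1 | h1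
    · omega
    · exact hM _ h1
  · exact le_prevMem (Finset.mem_insert_of_mem hq) he

theorem prevMem_insert_of_le {e' : ℕ} (h : e' ≤ e) : prevMem (insert e M) e' = prevMem M e' := by
  rw [prevMem, prevMem, Finset.filter_insert, if_neg (by omega)]

theorem gapProd_insert (hM : M ∈ setsBetween p q) (he : q < e) :
    gapProd w p (insert e M) = w (e - q) * gapProd w p M := by
  rw [mem_setsBetween] at hM
  obtain ⟨h1, h2, h3⟩ := hM
  have hpe : p < e := lt_of_le_of_lt (h1 q h3).1 he
  have heM : e ∉ M := fun h => by have := (h1 e h).2; omega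
  rw [gapProd, Finset.erase_insert_of_ne (by omega), Finset.prod_insert
    (fun h => heM (Finset.mem_of_mem_erase h)),
    prevMem_insert_top h3 (fun m hm => (h1 m hm).2) he, gapProd]
  congr 1
  refine Finset.prod_congr rfl fun m hm => ?_
  rw [prevMem_insert_of_le ((h1 m (Finset.mem_of_mem_erase hm)).2.trans he.le)]

/-- Peel off the largest element to sum over all sets with given extreme elements. -/
theorem sum_gapProd (h : p ≤ q) :
    ∑ M ∈ setsBetween p q, gapProd w p M = compSum 1 w (q - p) := by
  induction q using Nat.strong_induction_on with
  | _ q ih =>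
    rcases h.eq_or_lt with rfl | hlt
    · have h1 : setsBetween p p = {{p}} := by
        ext M
        rw [mem_setsBetween, Finset.mem_singleton, Finset.eq_singleton_iff_unique_mem]
        constructor
        · rintro ⟨h1, h2, -⟩
          exact ⟨h2, fun m hm => by have := h1 m hm; omega⟩
        · rintro ⟨h1, h2⟩
          exact ⟨fun m hm => by have := h2 m hm; omega, h1, h1⟩
      rw [h1, Finset.sum_singleton, gapProd, Finset.erase_singleton, Finset.prod_empty,
        Nat.sub_self, compSum_zero]
    · have h1 : ∑ M ∈ setsBetween p q, gapProd w p M =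
          ∑ q' ∈ Finset.Ico p q, ∑ M ∈ setsBetween p q', w (q - q') * gapProd w p M := by
        rw [Finset.sum_sigma']
        symm
        refine Finset.sum_bij (fun s _ => insert q s.2) ?_ ?_ ?_ ?_
        · rintro ⟨q', M⟩ hs
          simp only [Finset.mem_sigma, Finset.mem_Ico, mem_setsBetween] at hs ⊢
          obtain ⟨⟨h1, h2⟩, h3, h4, h5⟩ := hs
          refine ⟨fun m hm => ?_, Finset.mem_insert_of_mem h4, Finset.mem_insert_self _ _⟩
          rcases Finset.mem_insert.1 hm with rfl | hm
          · exact ⟨h, le_rfl⟩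
          · have := h3 m hm; omega
        · rintro ⟨q₁, M₁⟩ hs₁ ⟨q₂, M₂⟩ hs₂ heq
          simp only [Finset.mem_sigma, Finset.mem_Ico, mem_setsBetween] at hs₁ hs₂ heq
          obtain ⟨⟨h1, h2⟩, h3, h4, h5⟩ := hs₁
          obtain ⟨⟨h1', h2'⟩, h3', h4', h5'⟩ := hs₂
          have hn₁ : q ∉ M₁ := fun h => by have := (h3 q h).2; omega
          have hn₂ : q ∉ M₂ := fun h => by have := (h3' q h).2; omega
          obtain rfl : M₁ = M₂ := by
            rw [← Finset.erase_insert hn₁, heq, Finset.erase_insert hn₂]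
          obtain rfl : q₁ = q₂ := le_antisymm (h3' _ h5).2 (h3 _ h5').2
          rfl
        · intro M hM
          rw [mem_setsBetween] at hM
          obtain ⟨h1, h2, h3⟩ := hM
          have hne := prevMem_mem h2 hlt
          refine ⟨⟨prevMem M q, M.erase q⟩, ?_, Finset.insert_erase h3⟩
          simp only [Finset.mem_sigma, Finset.mem_Ico, mem_setsBetween, Finset.mem_erase]
          refine ⟨⟨(h1 _ hne.1).1, hne.2⟩, fun m hm => ⟨(h1 m hm.2).1, ?_⟩, ⟨by omega, h2⟩,
            ⟨by omega, hne.1⟩⟩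
          exact le_prevMem hm.2 (lt_of_le_of_ne (h1 m hm.2).2 hm.1)
        · rintro ⟨q', M⟩ hs
          rw [Finset.mem_sigma, Finset.mem_Ico] at hs
          exact (gapProd_insert hs.2 hs.1.2).symm
      rw [h1, compSum_eq _ _ (by omega)]
      refine Finset.sum_bij' (fun q' _ => q - q') (fun j _ => q - j) ?_ ?_ ?_ ?_ ?_
      · intro q'; simp only [Finset.mem_Ico, Finset.mem_Icc]; omega
      · intro q'; simp only [Finset.mem_Ico, Finset.mem_Icc]; omega
      · intro q'; simp only [Finset.mem_Ico]; omega
      · intro q'; simp only [Finset.mem_Icc]; omega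
      · intro q' hq'
        rw [Finset.mem_Ico] at hq'
        rw [← Finset.mul_sum, ih q' hq'.2 hq'.1, one_mul, show q - p - (q - q') = q' - p by omega]

/-- Sort the nonempty subsets of an initial segment by their extreme elements. -/
theorem sum_nonempty_subsets {A : Type*} [AddCommMonoid A] (n : ℕ) (f : Finset ℕ → A) :
    ∑ M ∈ (Finset.range n).powerset with M.Nonempty, f M =
      ∑ p ∈ Finset.range n, ∑ q ∈ Finset.Ico p n, ∑ M ∈ setsBetween p q, f M := by
  rw [Finset.sum_sigma', Finset.sum_sigma']
  symm
  refine Finset.sum_bij (fun s _ => s.2) ?_ ?_ ?_ (fun _ _ => rfl)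
  · rintro ⟨⟨p, q⟩, M⟩ h
    simp only [Finset.mem_sigma, Finset.mem_range, Finset.mem_Ico, mem_setsBetween] at h
    rw [Finset.mem_filter, Finset.mem_powerset]
    refine ⟨fun m hm => Finset.mem_range.2 ?_, p, h.2.2.1⟩
    have := h.2.1 m hm
    omega
  · rintro ⟨⟨p, q⟩, M⟩ h ⟨⟨p', q'⟩, M'⟩ h' rfl
    simp only [Finset.mem_sigma, Finset.mem_range, Finset.mem_Ico, mem_setsBetween] at h h'
    obtain rfl : p = p' := le_antisymm (h.2.1 _ h'.2.2.1).1 (h'.2.1 _ h.2.2.1).1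
    obtain rfl : q = q' := le_antisymm (h'.2.1 _ h.2.2.2).2 (h.2.1 _ h'.2.2.2).2
    rfl
  · intro M hM
    rw [Finset.mem_filter, Finset.mem_powerset] at hM
    obtain ⟨hs, hne⟩ := hM
    refine ⟨⟨⟨M.min' hne, M.max' hne⟩, M⟩, ?_, rfl⟩
    simp only [Finset.mem_sigma, Finset.mem_range, Finset.mem_Ico, mem_setsBetween]
    exact ⟨⟨Finset.mem_range.1 (hs (M.min'_mem hne)), M.min'_le _ (M.max'_mem hne),
      Finset.mem_range.1 (hs (M.max'_mem hne))⟩,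
      fun m hm => ⟨M.min'_le _ hm, M.le_max' _ hm⟩, M.min'_mem hne, M.max'_mem hne⟩

end Gaps

/-! ### The edge sets of the cycle without broken circuits -/

namespace LabeledGraph

variable {a : ℕ} {ha : 2 ≤ a} {F : Finset ℕ} {i u v : ℕ}

theorem cycle_length : (cycle a ha).edges.length = a := by
  simp [cycle]; omega

theorem cycle_edge (hi : i < a - 1) : (cycle a ha).edges[i]? = some s(i + 1, i + 2) := by
  unfold cycle
  rw [List.getElem?_append_left (by simpa using hi)]
  simp [hi, add_comm 1 i]

theorem cycle_edge_last : (cycle a ha).edges[a - 1]? = some s(a, 1) := by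
  unfold cycle
  rw [List.getElem?_append_right (by simp)]
  simp

theorem edge_cycle (h : (cycle a ha).edges[i]? = some s(u, v)) :
    (i < a - 1 ∧ (u = i + 1 ∧ v = i + 2 ∨ u = i + 2 ∧ v = i + 1)) ∨
      (i = a - 1 ∧ (u = a ∧ v = 1 ∨ u = 1 ∧ v = a)) := by
  have hi := lt_of_edge h
  rw [cycle_length] at hi
  rcases lt_or_ge i (a - 1) with h1 | h1
  · rw [cycle_edge h1, Option.some_inj, Sym2.eq_iff] at h
    exact Or.inl ⟨h1, by omega⟩
  · obtain rfl : i = a - 1 := by omega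
    rw [cycle_edge_last, Option.some_inj, Sym2.eq_iff] at h
    exact Or.inr ⟨rfl, by omega⟩

theorem reachable_interval (hu : 1 ≤ u) (huv : u ≤ v) (hv : v ≤ a)
    (h : ∀ e, u ≤ e + 1 → e + 2 ≤ v → e ∈ F) : ((cycle a ha).sub F).Reachable u v := by
  induction v, huv using Nat.le_induction with
  | base => exact SimpleGraph.Reachable.refl _
  | succ v huv ih =>
    refine (ih (by omega) (fun e h1 h2 => h e h1 (by omega))).trans ?_
    obtain ⟨e, rfl⟩ := Nat.exists_eq_add_of_le' (hu.trans huv)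
    exact reachable_of_edge (h e (by omega) le_rfl) (cycle_edge (by omega))

/-- The only broken circuit of the cycle consists of all edges but the closing one. -/
theorem mem_nbc_cycle : F ∈ (cycle a ha).nbc ↔
    F ⊆ Finset.range a ∧ ∃ m < a - 1, m ∉ F := by
  rw [mem_nbc, isNonBroken_iff, cycle_length]
  refine and_congr_right fun hF => ⟨fun h => ?_, ?_⟩
  · by_contra! hall
    refine h (a - 1) 1 a (by rw [cycle_edge_last, Sym2.eq_swap]) ?_
    refine reachable_interval le_rfl (by omega) le_rfl fun e h1 h2 => ?_
    exact Finset.mem_filter.2 ⟨hall e (by omega), by omega⟩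
  · rintro ⟨m, hm, hmF⟩ i u v hi hr
    rcases edge_cycle hi with ⟨h1, h2⟩ | ⟨h1, h2⟩
    · have := eq_of_reachable (fun x => x ≤ i + 1) (fun j hj x y he => by
        have hj' := (Finset.mem_filter.1 hj).2
        have := edge_cycle he
        apply propext
        omega) hr
      have := this.to_iff
      omega
    · have := eq_of_reachable (fun x => x ≤ m + 1) (fun j hj x y he => by
        have hj' := Finset.mem_filter.1 hj
        have hjm : j ≠ m := fun h => hmF (h ▸ hj'.1)
        have := edge_cycle he
        apply propext
        omega) hr
      have := this.to_iff
      omega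

/-- An edge set of the cycle without broken circuits is given by the nonempty set `M` of omitted
edges other than the closing one, and by whether it contains the closing edge. -/
theorem sum_nbc_cycle {A : Type*} [AddCommMonoid A] (f : Finset ℕ → A) :
    ∑ F ∈ (cycle a ha).nbc, f F =
      ∑ M ∈ (Finset.range (a - 1)).powerset with M.Nonempty,
        (f (Finset.range (a - 1) \ M) + f (insert (a - 1) (Finset.range (a - 1) \ M))) := by
  rw [Finset.sum_add_distrib, ← Finset.sum_filter_not_add_sum_filter _ (fun F => a - 1 ∈ F)]
  have hinv : ∀ F ∈ (cycle a ha).nbc, Finset.range (a - 1) \ F ∈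
      (Finset.range (a - 1)).powerset.filter Finset.Nonempty := by
    intro F hF
    obtain ⟨-, m, hm, hmF⟩ := mem_nbc_cycle.1 hF
    rw [Finset.mem_filter, Finset.mem_powerset]
    exact ⟨Finset.sdiff_subset, m, Finset.mem_sdiff.2 ⟨Finset.mem_range.2 hm, hmF⟩⟩
  congr 1
  · refine Finset.sum_bij' (fun F _ => Finset.range (a - 1) \ F)
      (fun M _ => Finset.range (a - 1) \ M) ?_ ?_ ?_ ?_ ?_
    · exact fun F hF => hinv F (Finset.mem_filter.1 hF).1
    · intro M hM
      rw [Finset.mem_filter, Finset.mem_powerset] at hM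
      obtain ⟨h1, m, hm⟩ := hM
      rw [Finset.mem_filter, mem_nbc_cycle]
      refine ⟨⟨fun i hi => ?_, m, Finset.mem_range.1 (h1 hm), ?_⟩, ?_⟩
      · simp only [Finset.mem_sdiff, Finset.mem_range] at hi ⊢; omega
      · simp [hm]
      · simp
    · intro F hF
      rw [Finset.mem_filter, mem_nbc_cycle] at hF
      obtain ⟨⟨h1, -⟩, h2⟩ := hF
      rw [Finset.sdiff_sdiff_eq_self]
      intro i hi
      have := Finset.mem_range.1 (h1 hi)
      have : i ≠ a - 1 := fun h => h2 (h ▸ hi)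
      rw [Finset.mem_range]; omega
    · intro M hM
      rw [Finset.mem_filter, Finset.mem_powerset] at hM
      exact Finset.sdiff_sdiff_eq_self hM.1
    · intro F hF
      rw [Finset.mem_filter, mem_nbc_cycle] at hF
      obtain ⟨⟨h1, -⟩, h2⟩ := hF
      rw [Finset.sdiff_sdiff_eq_self]
      intro i hi
      have := Finset.mem_range.1 (h1 hi)
      have : i ≠ a - 1 := fun h => h2 (h ▸ hi)
      rw [Finset.mem_range]; omega
  · have hback : ∀ F ∈ (cycle a ha).nbc.filter (fun F => a - 1 ∈ F),
        insert (a - 1) (Finset.range (a - 1) \ (Finset.range (a - 1) \ F)) = F := by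
      intro F hF
      rw [Finset.mem_filter, mem_nbc_cycle] at hF
      obtain ⟨⟨h1, -⟩, h2⟩ := hF
      ext i
      simp only [Finset.mem_insert, Finset.mem_sdiff, Finset.mem_range]
      constructor
      · rintro (rfl | h)
        · exact h2
        · by_contra h3; exact h.2 ⟨h.1, h3⟩
      · intro hi
        have := Finset.mem_range.1 (h1 hi)
        by_cases h3 : i = a - 1
        · exact Or.inl h3
        · exact Or.inr ⟨by omega, fun h => h.2 hi⟩
    refine Finset.sum_bij' (fun F _ => Finset.range (a - 1) \ F)
      (fun M _ => insert (a - 1) (Finset.range (a - 1) \ M)) ?_ ?_ ?_ ?_ ?_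
    · exact fun F hF => hinv F (Finset.mem_filter.1 hF).1
    · intro M hM
      rw [Finset.mem_filter, Finset.mem_powerset] at hM
      obtain ⟨h1, m, hm⟩ := hM
      have hm' := Finset.mem_range.1 (h1 hm)
      rw [Finset.mem_filter, mem_nbc_cycle]
      refine ⟨⟨fun i hi => ?_, m, hm', ?_⟩, Finset.mem_insert_self _ _⟩
      · simp only [Finset.mem_insert, Finset.mem_sdiff, Finset.mem_range] at hi ⊢; omega
      · simp only [Finset.mem_insert, Finset.mem_sdiff, hm, not_true, and_false, or_false]; omega
    · exact hback
    · intro M hM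
      rw [Finset.mem_filter, Finset.mem_powerset] at hM
      ext i
      have := @hM.1 i
      simp only [Finset.mem_insert, Finset.mem_sdiff, Finset.mem_range] at this ⊢
      constructor
      · rintro ⟨h1, h2⟩
        by_contra h3; exact h2 (Or.inr ⟨h1, h3⟩)
      · intro h
        refine ⟨this h, ?_⟩
        rintro (h1 | h1)
        · have := this h; omega
        · exact h1.2 h
    · intro F hF
      rw [hback F hF]

end LabeledGraph

/-! ### The components of an edge set of the cycle -/

namespace LabeledGraph

variable {G : LabeledGraph} {a : ℕ} {ha : 2 ≤ a} {F M V : Finset ℕ} {p q e u v : ℕ}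

/-- A vertex set that is connected and closed along edges is a component. -/
theorem mem_iff_reachable {c : ℕ}
    (hcl : ∀ i ∈ F, ∀ x y, G.edges[i]? = some s(x, y) → (x ∈ V ↔ y ∈ V))
    (hc : ∀ v ∈ V, (G.sub F).Reachable c v) :
    ∀ v ∈ V, ∀ u, u ∈ V ↔ (G.sub F).Reachable v u := by
  intro v hv u
  refine ⟨fun hu => (hc v hv).symm.trans (hc u hu), fun h => ?_⟩
  have := eq_of_reachable (· ∈ V) (fun i hi x y he => propext (hcl i hi x y he)) h
  exact this.to_iff.1 hv

/-- The vertices between the edge of the cycle at position `e` and the preceding edge in `M`. -/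
def block (M : Finset ℕ) (e : ℕ) : Finset ℕ := Finset.Icc (prevMem M e + 2) (e + 1)

theorem mem_block : v ∈ block M e ↔ prevMem M e + 2 ≤ v ∧ v ≤ e + 1 := Finset.mem_Icc

variable (ha) in
/-- `F` is an edge set of the cycle that omits, apart possibly from the closing edge, exactly
the edges at the positions in `M`. -/
def Omits (F M : Finset ℕ) (p q : ℕ) : Prop :=
  q < a - 1 ∧ M ∈ setsBetween p q ∧ F ⊆ Finset.range (cycle a ha).edges.length ∧
    ∀ i < a - 1, i ∈ F ↔ i ∉ M

theorem Omits.closed_block (h : Omits ha F M p q) (he : e ∈ M.erase p) :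
    ∀ i ∈ F, ∀ x y, (cycle a ha).edges[i]? = some s(x, y) → (x ∈ block M e ↔ y ∈ block M e) := by
  obtain ⟨hq, hM, -, hF⟩ := h
  rw [mem_setsBetween] at hM
  obtain ⟨hne, heM⟩ := Finset.mem_erase.1 he
  have hpe : p < e := lt_of_le_of_ne (hM.1 e heM).1 (Ne.symm hne)
  have heq := (hM.1 e heM).2
  obtain ⟨h1, h2⟩ := prevMem_mem hM.2.1 hpe
  intro i hi x y hxy
  rw [mem_block, mem_block]
  rcases edge_cycle hxy with ⟨h3, h4⟩ | ⟨h3, h4⟩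
  · have h5 := (hF i h3).1 hi
    have h6 : i ≠ e := fun h => h5 (h ▸ heM)
    have h7 : i ≠ prevMem M e := fun h => h5 (h ▸ h1)
    omega
  · omega

theorem Omits.connected_block (h : Omits ha F M p q) (he : e ∈ M.erase p) :
    ∀ v ∈ block M e, ((cycle a ha).sub F).Reachable (prevMem M e + 2) v := by
  obtain ⟨hq, hM, -, hF⟩ := h
  rw [mem_setsBetween] at hM
  obtain ⟨hne, heM⟩ := Finset.mem_erase.1 he
  have hpe : p < e := lt_of_le_of_ne (hM.1 e heM).1 (Ne.symm hne)
  have heq := (hM.1 e heM).2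
  intro v hv
  rw [mem_block] at hv
  refine reachable_interval (by omega) hv.1 (by omega) fun i h1 h2 => ?_
  refine (hF i (by omega)).2 fun hiM => ?_
  have := le_prevMem hiM (show i < e by omega)
  omega

theorem Omits.block_subset (h : Omits ha F M p q) (he : e ∈ M.erase p) (hv : v ∈ block M e) :
    p + 2 ≤ v ∧ v ≤ q + 1 := by
  obtain ⟨hq, hM, -, hF⟩ := h
  rw [mem_setsBetween] at hM
  obtain ⟨hne, heM⟩ := Finset.mem_erase.1 he
  have hpe : p < e := lt_of_le_of_ne (hM.1 e heM).1 (Ne.symm hne)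
  have heq := (hM.1 e heM).2
  have := le_prevMem hM.2.1 hpe
  rw [mem_block] at hv
  omega

theorem Omits.exists_block (h : Omits ha F M p q) (h1 : p + 2 ≤ v) (h2 : v ≤ q + 1) :
    ∃ e ∈ M.erase p, v ∈ block M e := by
  obtain ⟨hq, hM, -, hF⟩ := h
  rw [mem_setsBetween] at hM
  have hne : ({m ∈ M | v ≤ m + 1} : Finset ℕ).Nonempty :=
    ⟨q, Finset.mem_filter.2 ⟨hM.2.2, h2⟩⟩
  have hmin := Finset.min'_mem _ hne
  set e := Finset.min' _ hne with he
  rw [Finset.mem_filter] at hmin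
  refine ⟨e, Finset.mem_erase.2 ⟨by omega, hmin.1⟩, mem_block.2 ⟨?_, hmin.2⟩⟩
  have h3 := prevMem_mem hM.2.1 (show p < e by omega)
  by_contra h4
  have h5 : prevMem M e ∈ ({m ∈ M | v ≤ m + 1} : Finset ℕ) :=
    Finset.mem_filter.2 ⟨h3.1, by omega⟩
  have := Finset.min'_le _ _ h5
  omega

theorem Omits.self_mem_block (h : Omits ha F M p q) (he : e ∈ M.erase p) : e + 1 ∈ block M e := by
  obtain ⟨hq, hM, -, hF⟩ := h
  rw [mem_setsBetween] at hM
  obtain ⟨hne, heM⟩ := Finset.mem_erase.1 he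
  have hpe : p < e := lt_of_le_of_ne (hM.1 e heM).1 (Ne.symm hne)
  have := (prevMem_mem hM.2.1 hpe).2
  rw [mem_block]
  omega

theorem Omits.comps_of_not_mem (h : Omits ha F M p q) (hF : a - 1 ∉ F) :
    (cycle a ha).comps F =
      insert (Finset.Icc (q + 2) a)
        (insert (Finset.Icc 1 (p + 1)) ((M.erase p).image (block M))) := by
  have h' := h
  obtain ⟨hq, hM, -, hFM⟩ := h'
  rw [mem_setsBetween] at hM
  have hpq := (hM.1 _ hM.2.2).1
  have hp1 : p ∉ F := fun h => (hFM p (by omega)).1 h hM.2.1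
  have hq1 : q ∉ F := fun h => (hFM q (by omega)).1 h hM.2.2
  apply comps_eq
  · intro V hV
    simp only [Finset.mem_insert, Finset.mem_image] at hV
    rcases hV with rfl | rfl | ⟨e, he, rfl⟩
    · exact ⟨a, n_mem_Icc _, Finset.mem_Icc.2 ⟨by omega, le_rfl⟩⟩
    · exact ⟨1, one_mem_Icc _, Finset.mem_Icc.2 ⟨by omega, by omega⟩⟩
    · have h1 := h.self_mem_block he
      have h2 := h.block_subset he h1
      exact ⟨e + 1, Finset.mem_Icc.2 ⟨by omega, show e + 1 ≤ a by omega⟩, h1⟩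
  · intro V hV
    simp only [Finset.mem_insert, Finset.mem_image] at hV
    rcases hV with rfl | rfl | ⟨e, he, rfl⟩
    · refine mem_iff_reachable (c := q + 2) ?_ ?_
      · intro i hi x y hxy
        have h1 : i ≠ q := fun h => hq1 (h ▸ hi)
        have h2 : i ≠ a - 1 := fun h => hF (h ▸ hi)
        have := edge_cycle hxy
        simp only [Finset.mem_Icc]
        omega
      · intro v hv
        rw [Finset.mem_Icc] at hv
        refine reachable_interval (by omega) hv.1 hv.2 fun i h1 h2 =>
          (hFM i (by omega)).2 fun h3 => ?_
        have := hM.1 i h3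
        omega
    · refine mem_iff_reachable (c := 1) ?_ ?_
      · intro i hi x y hxy
        have h1 : i ≠ p := fun h => hp1 (h ▸ hi)
        have h2 : i ≠ a - 1 := fun h => hF (h ▸ hi)
        have := edge_cycle hxy
        simp only [Finset.mem_Icc]
        omega
      · intro v hv
        rw [Finset.mem_Icc] at hv
        refine reachable_interval le_rfl hv.1 (by omega) fun i h1 h2 =>
          (hFM i (by omega)).2 fun h3 => ?_
        have := hM.1 i h3
        omega
    · exact mem_iff_reachable (h.closed_block he) (h.connected_block he)
  · intro v hv
    rw [Finset.mem_Icc] at hv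
    rcases le_or_gt v (p + 1) with h1 | h1
    · exact ⟨_, Finset.mem_insert_of_mem (Finset.mem_insert_self _ _), Finset.mem_Icc.2 ⟨hv.1, h1⟩⟩
    rcases le_or_gt v (q + 1) with h2 | h2
    · obtain ⟨e, he, hve⟩ := h.exists_block h1 h2
      exact ⟨_, Finset.mem_insert_of_mem (Finset.mem_insert_of_mem (Finset.mem_image_of_mem _ he)),
        hve⟩
    · exact ⟨_, Finset.mem_insert_self _ _, Finset.mem_Icc.2 ⟨h2, hv.2⟩⟩

theorem Omits.comps_of_mem (h : Omits ha F M p q) (hF : a - 1 ∈ F) :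
    (cycle a ha).comps F =
      insert (Finset.Icc 1 (p + 1) ∪ Finset.Icc (q + 2) a) ((M.erase p).image (block M)) := by
  have h' := h
  obtain ⟨hq, hM, -, hFM⟩ := h'
  rw [mem_setsBetween] at hM
  have hpq := (hM.1 _ hM.2.2).1
  have hp1 : p ∉ F := fun h => (hFM p (by omega)).1 h hM.2.1
  have hq1 : q ∉ F := fun h => (hFM q (by omega)).1 h hM.2.2
  apply comps_eq
  · intro V hV
    simp only [Finset.mem_insert, Finset.mem_image] at hV
    rcases hV with rfl | ⟨e, he, rfl⟩
    · exact ⟨1, one_mem_Icc _, Finset.mem_union_left _ (Finset.mem_Icc.2 ⟨by omega, by omega⟩)⟩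
    · have h1 := h.self_mem_block he
      have h2 := h.block_subset he h1
      exact ⟨e + 1, Finset.mem_Icc.2 ⟨by omega, show e + 1 ≤ a by omega⟩, h1⟩
  · intro V hV
    simp only [Finset.mem_insert, Finset.mem_image] at hV
    rcases hV with rfl | ⟨e, he, rfl⟩
    · refine mem_iff_reachable (c := 1) ?_ ?_
      · intro i hi x y hxy
        have h1 : i ≠ p := fun h => hp1 (h ▸ hi)
        have h2 : i ≠ q := fun h => hq1 (h ▸ hi)
        have := edge_cycle hxy
        simp only [Finset.mem_Icc, Finset.mem_union]
        omega
      · intro v hv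
        rw [Finset.mem_union, Finset.mem_Icc, Finset.mem_Icc] at hv
        rcases hv with hv | hv
        · refine reachable_interval le_rfl hv.1 (by omega)
            fun i h1 h2 => (hFM i (by omega)).2 fun h3 => ?_
          have := hM.1 i h3
          omega
        · have h1 : ((cycle a ha).sub F).Reachable v a := by
            refine reachable_interval (by omega) hv.2 le_rfl
              fun i h1 h2 => (hFM i (by omega)).2 fun h3 => ?_
            have := hM.1 i h3
            omega
          exact (h1.trans (reachable_of_edge hF cycle_edge_last)).symm
    · exact mem_iff_reachable (h.closed_block he) (h.connected_block he)
  · intro v hv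
    rw [Finset.mem_Icc] at hv
    rcases le_or_gt v (p + 1) with h1 | h1
    · exact ⟨_, Finset.mem_insert_self _ _,
        Finset.mem_union_left _ (Finset.mem_Icc.2 ⟨hv.1, h1⟩)⟩
    rcases le_or_gt v (q + 1) with h2 | h2
    · obtain ⟨e, he, hve⟩ := h.exists_block h1 h2
      exact ⟨_, Finset.mem_insert_of_mem (Finset.mem_image_of_mem _ he), hve⟩
    · exact ⟨_, Finset.mem_insert_self _ _,
        Finset.mem_union_right _ (Finset.mem_Icc.2 ⟨h2, hv.2⟩)⟩

variable {R : Type*} [CommRing R] {z : R} {x Ψ : ℕ → R}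

theorem Omits.prod_blocks (h : Omits ha F M p q) :
    ∏ V ∈ (M.erase p).image (block M), compWeight z x Ψ V =
      gapProd (headSum z x fun j => j * x j) p M := by
  rw [Finset.prod_image, gapProd]
  · refine Finset.prod_congr rfl fun e he => ?_
    rw [compWeight, if_neg, block, Nat.card_Icc]
    · congr 1; omega
    · intro h1
      have := h.block_subset he h1
      omega
  · intro e he e' he' heq
    have h1 := h.self_mem_block he
    have h2 := h.self_mem_block he'
    rw [heq, mem_block] at h1
    rw [← heq, mem_block] at h2
    omega

/-- The summand of `joinCoeff` for an edge set that omits the edges at positions `p ≤ ⋯ ≤ q` and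
the closing edge. -/
theorem Omits.term_of_not_mem (h : Omits ha F M p q) (hF : a - 1 ∉ F) (k : ℕ) :
    endWeight z x Ψ k ((cycle a ha).comp F (cycle a ha).n)
        (((cycle a ha).comp F (cycle a ha).n).card + k - 1) *
      ∏ V ∈ ((cycle a ha).comps F).erase ((cycle a ha).comp F (cycle a ha).n),
        compWeight z x Ψ V =
    headSum z x Ψ (p + 1) * lastSum z x (fun j => j * x j) k (a - 1 - q + k - 1) *
      gapProd (headSum z x fun j => j * x j) p M := by
  have h1 := h.comps_of_not_mem hF
  have hq := h.1
  have hM := mem_setsBetween.1 h.2.1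
  have hpq := (hM.1 _ hM.2.2).1
  have h2 : (cycle a ha).comp F (cycle a ha).n = Finset.Icc (q + 2) a := by
    symm
    apply eq_comp_of_mem
    · rw [h1]; exact Finset.mem_insert_self _ _
    · exact Finset.mem_Icc.2 ⟨show q + 2 ≤ a by omega, le_rfl⟩
  rw [h1, h2, Finset.erase_insert, Finset.prod_insert, h.prod_blocks, endWeight, if_neg, compWeight,
    if_pos, Nat.card_Icc, Nat.card_Icc]
  · rw [show a + 1 - (q + 2) = a - 1 - q by omega, show p + 1 + 1 - 1 = p + 1 by omega]
    ring
  · exact Finset.mem_Icc.2 ⟨le_rfl, by omega⟩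
  · simp
  · intro h3
    obtain ⟨e, he, h4⟩ := Finset.mem_image.1 h3
    have h5 : 1 ∈ block M e := h4 ▸ Finset.mem_Icc.2 ⟨le_rfl, by omega⟩
    have := h.block_subset he h5
    omega
  · intro h3
    have h6 : a ∈ Finset.Icc (q + 2) a := Finset.mem_Icc.2 ⟨by omega, le_rfl⟩
    rcases Finset.mem_insert.1 h3 with h4 | h4
    · rw [h4, Finset.mem_Icc] at h6; omega
    · obtain ⟨e, he, h4⟩ := Finset.mem_image.1 h4
      rw [← h4] at h6
      have := h.block_subset he h6
      omega

/-- The summand of `joinCoeff` for an edge set that omits the edges at positions `p ≤ ⋯ ≤ q` but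
not the closing edge. -/
theorem Omits.term_of_mem (h : Omits ha F M p q) (hF : a - 1 ∈ F) (k : ℕ) :
    endWeight z x Ψ k ((cycle a ha).comp F (cycle a ha).n)
        (((cycle a ha).comp F (cycle a ha).n).card + k - 1) *
      ∏ V ∈ ((cycle a ha).comps F).erase ((cycle a ha).comp F (cycle a ha).n),
        compWeight z x Ψ V =
    lastSum z x Ψ k (p + 1 + (a - 1 - q) + k - 1) *
      gapProd (headSum z x fun j => j * x j) p M := by
  have h1 := h.comps_of_mem hF
  have hq := h.1
  have hM := mem_setsBetween.1 h.2.1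
  have hpq := (hM.1 _ hM.2.2).1
  have h2 : (cycle a ha).comp F (cycle a ha).n = Finset.Icc 1 (p + 1) ∪ Finset.Icc (q + 2) a := by
    symm
    apply eq_comp_of_mem
    · rw [h1]; exact Finset.mem_insert_self _ _
    · exact Finset.mem_union_right _ (Finset.mem_Icc.2 ⟨show q + 2 ≤ a by omega, le_rfl⟩)
  rw [h1, h2, Finset.erase_insert, h.prod_blocks, endWeight, if_pos, Finset.card_union_of_disjoint,
    Nat.card_Icc, Nat.card_Icc]
  · rw [show a + 1 - (q + 2) = a - 1 - q by omega, show p + 1 + 1 - 1 = p + 1 by omega]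
  · rw [Finset.disjoint_left]
    intro v
    simp only [Finset.mem_Icc]
    omega
  · exact Finset.mem_union_left _ (Finset.mem_Icc.2 ⟨le_rfl, by omega⟩)
  · intro h3
    have h6 : 1 ∈ Finset.Icc 1 (p + 1) ∪ Finset.Icc (q + 2) a :=
      Finset.mem_union_left _ (Finset.mem_Icc.2 ⟨le_rfl, by omega⟩)
    obtain ⟨e, he, h4⟩ := Finset.mem_image.1 h3
    rw [← h4] at h6
    have := h.block_subset he h6
    omega

/-- The coefficients of the cycle, sorted by the first omitted edge `p` and by the last omitted edge
`q` other than the closing edge. -/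
theorem joinCoeff_cycle (k : ℕ) : joinCoeff z x (cycle a ha) Ψ k =
    ∑ p ∈ Finset.range (a - 1), ∑ q ∈ Finset.Ico p (a - 1),
      (headSum z x Ψ (p + 1) * lastSum z x (fun j => j * x j) k (a - 1 - q + k - 1) +
        lastSum z x Ψ k (p + 1 + (a - 1 - q) + k - 1)) *
          compSum 1 (headSum z x fun j => j * x j) (q - p) := by
  rw [joinCoeff, sum_nbc_cycle, sum_nonempty_subsets]
  refine Finset.sum_congr rfl fun p _ => Finset.sum_congr rfl fun q hq => ?_
  rw [Finset.mem_Ico] at hq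
  rw [← sum_gapProd hq.1, Finset.mul_sum]
  refine Finset.sum_congr rfl fun M hM => ?_
  have h1 : Omits ha (Finset.range (a - 1) \ M) M p q := by
    refine ⟨hq.2, hM, fun i hi => ?_, fun i hi => by simp [hi]⟩
    rw [cycle_length]
    simp only [Finset.mem_sdiff, Finset.mem_range] at hi ⊢
    omega
  have h2 : Omits ha (insert (a - 1) (Finset.range (a - 1) \ M)) M p q := by
    refine ⟨hq.2, hM, fun i hi => ?_, fun i hi => ?_⟩
    · rw [cycle_length]
      simp only [Finset.mem_insert, Finset.mem_sdiff, Finset.mem_range] at hi ⊢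
      omega
    · simp only [Finset.mem_insert, Finset.mem_sdiff, Finset.mem_range, hi, true_and]
      exact or_iff_right (by omega)
  rw [h1.term_of_not_mem (by simp), h2.term_of_mem (Finset.mem_insert_self _ _), ← add_mul]

end LabeledGraph

/-! ### Generating functions for compositions -/

section Series

open PowerSeries

variable {R : Type*} [CommRing R]

/-- The convolution that counts the edge sets of the cycle without the closing edge: the tree at
vertex `1` has `p + 1` vertices, the trees between it and the last one have `q - p` in total. -/
theorem sum_triple_eq_coeff {P L : ℕ → R} (h : ℕ → R) (b : ℕ) {k : ℕ} (hP : P 0 = 0)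
    (hL : ∀ n < k, L n = 0) :
    ∑ p ∈ Finset.range b, ∑ q ∈ Finset.Ico p b, P (p + 1) * L (b - q + k - 1) * h (q - p) =
      coeff (b + k) (mk P * mk h * mk L) := by
  rw [coeff_mul, Finset.Nat.sum_antidiagonal_eq_sum_range_succ_mk]
  simp only [coeff_mk]
  have h1 : Finset.range (b + 1) ⊆ Finset.range (b + k).succ := by
    intro i; simp only [Finset.mem_range]; omega
  rw [← Finset.sum_subset h1 (by
    intro i hi hi'
    rw [Finset.mem_range] at hi hi'
    rw [hL _ (by omega), mul_zero]), Finset.sum_range_succ']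
  have h2 : coeff 0 (mk P * mk h) = 0 := by
    rw [coeff_mul]; simp [hP]
  rw [h2, zero_mul, add_zero]
  have h3 : ∀ q ∈ Finset.range b, coeff (q + 1) (mk P * mk h) * L (b + k - (q + 1)) =
      ∑ p ∈ Finset.range (q + 1), P (p + 1) * L (b - q + k - 1) * h (q - p) := by
    intro q hq
    rw [Finset.mem_range] at hq
    rw [coeff_mul, Finset.Nat.sum_antidiagonal_eq_sum_range_succ_mk, Finset.sum_range_succ']
    simp only [coeff_mk, hP, zero_mul, add_zero, Nat.add_sub_add_right]
    rw [Finset.sum_mul, show b + k - (q + 1) = b - q + k - 1 by omega]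
    exact Finset.sum_congr rfl fun p _ => by ring
  rw [Finset.sum_congr rfl h3]
  refine Finset.sum_comm' fun p q => ?_
  simp only [Finset.mem_range, Finset.mem_Ico]
  omega

/-- The convolution that counts the edge sets of the cycle with the closing edge: the summand
depends only on the difference `q - p`, and the number of such pairs gives the factor `n - k`. -/
theorem sum_double_eq_coeff {L : ℕ → R} (h : ℕ → R) (b : ℕ) {k : ℕ} (hL : ∀ n < k, L n = 0) :
    ∑ p ∈ Finset.range b, ∑ q ∈ Finset.Ico p b, L (p + 1 + (b - q) + k - 1) * h (q - p) =
      coeff (b + k) (mk h * mk fun n => ((n : R) - k) * L n) := by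
  rw [coeff_mul, Finset.Nat.sum_antidiagonal_eq_sum_range_succ_mk]
  simp only [coeff_mk]
  have h1 : Finset.range b ⊆ Finset.range (b + k).succ := by
    intro i; simp only [Finset.mem_range]; omega
  rw [← Finset.sum_subset h1 (by
    intro i hi hi'
    rw [Finset.mem_range] at hi hi'
    rcases (not_lt.1 hi').eq_or_lt with rfl | h2
    · rw [show b + k - b = k by omega, sub_self, zero_mul, mul_zero]
    · rw [hL _ (by omega), mul_zero, mul_zero])]
  have h2 : ∀ d ∈ Finset.range b, h d * (((b + k - d : ℕ) : R) - k) * L (b + k - d) =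
      ∑ p ∈ Finset.range (b - d), L (p + 1 + (b - (p + d)) + k - 1) * h d := by
    intro d hd
    rw [Finset.mem_range] at hd
    rw [Finset.sum_congr rfl (g := fun _ => L (b + k - d) * h d) (fun p hp => by
      rw [Finset.mem_range] at hp
      rw [show p + 1 + (b - (p + d)) + k - 1 = b + k - d by omega]), Finset.sum_const,
      Finset.card_range, nsmul_eq_mul, show b + k - d = (b - d) + k by omega]
    push_cast
    ring
  simp only [← mul_assoc]
  rw [Finset.sum_congr rfl h2, Finset.sum_sigma', Finset.sum_sigma']
  refine Finset.sum_bij' (fun s _ => ⟨s.2 - s.1, s.1⟩) (fun s _ => ⟨s.2, s.2 + s.1⟩) ?_ ?_ ?_ ?_ ?_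
  · rintro ⟨p, q⟩; simp only [Finset.mem_sigma, Finset.mem_range, Finset.mem_Ico]; omega
  · rintro ⟨p, q⟩; simp only [Finset.mem_sigma, Finset.mem_range, Finset.mem_Ico]; omega
  · rintro ⟨p, q⟩ h; simp only [Finset.mem_sigma, Finset.mem_range, Finset.mem_Ico] at h
    rw [show p + (q - p) = q by omega]
  · rintro ⟨p, q⟩ h; simp
  · rintro ⟨p, q⟩ h
    simp only [Finset.mem_sigma, Finset.mem_range, Finset.mem_Ico] at h
    rw [show p + (q - p) = q by omega]

/-- The operator `t d/dt`. -/
noncomputable def euler (f : PowerSeries R) : PowerSeries R := mk fun n => (n : R) * coeff n f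

theorem euler_mul (f g : PowerSeries R) : euler (f * g) = euler f * g + f * euler g := by
  ext n
  simp only [euler, coeff_mk, map_add, coeff_mul]
  rw [Finset.mul_sum, ← Finset.sum_add_distrib]
  refine Finset.sum_congr rfl fun p hp => ?_
  rw [← Finset.HasAntidiagonal.mem_antidiagonal.1 hp]
  push_cast
  ring

theorem euler_add (f g : PowerSeries R) : euler (f + g) = euler f + euler g := by
  ext n; simp only [euler, coeff_mk, map_add, mul_add]

theorem euler_sub (f g : PowerSeries R) : euler (f - g) = euler f - euler g := by
  ext n; simp only [euler, coeff_mk, map_sub, mul_sub]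

theorem euler_one : euler (1 : PowerSeries R) = 0 := by
  ext n; simp only [euler, coeff_mk, coeff_one]; split_ifs with h <;> simp [h]

theorem euler_X_pow (i : ℕ) : euler (X ^ i : PowerSeries R) = (i : PowerSeries R) * X ^ i := by
  ext n
  rw [← map_natCast (C (R := R)) i, coeff_C_mul]
  simp only [euler, coeff_mk, coeff_X_pow]
  split_ifs with h <;> simp [h]

variable (z : R) (x : ℕ → R)

/-- The series `∑ x_n t^n` over `n ≥ k`. -/
noncomputable def tailSeries (k : ℕ) : PowerSeries R := mk fun n => if k ≤ n then x n else 0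

/-- The series `∑ n x_n t^n` over `n ≥ k`. -/
noncomputable def tailSeries' (k : ℕ) : PowerSeries R := mk fun n => if k ≤ n then n * x n else 0

theorem euler_tailSeries (k : ℕ) : euler (tailSeries x k) = tailSeries' x k := by
  ext n; simp only [euler, tailSeries, tailSeries', coeff_mk]; split_ifs <;> simp

theorem compSum_series :
    mk (compSum z x) = 1 + C z * tailSeries x 1 * mk (compSum z x) := by
  ext n
  rcases Nat.eq_zero_or_pos n with rfl | hn
  · rw [coeff_mk, compSum_zero, map_add, coeff_mul]
    simp [tailSeries]
  · rw [coeff_mk, compSum_eq _ _ hn, map_add, coeff_one, if_neg (by omega), zero_add, coeff_mul,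
      Finset.Nat.sum_antidiagonal_eq_sum_range_succ_mk]
    simp only [coeff_C_mul, tailSeries, coeff_mk]
    refine Finset.sum_subset_zero_on_sdiff (fun i => ?_) (fun i hi => ?_) (fun i hi => ?_)
    · simp only [Finset.mem_Icc, Finset.mem_range]; omega
    · simp only [Finset.mem_sdiff, Finset.mem_Icc, Finset.mem_range] at hi
      rw [if_neg (by omega), mul_zero, zero_mul]
    · rw [if_pos (Finset.mem_Icc.1 hi).1]

theorem headSum_zero {Ψ : ℕ → R} (h : Ψ 0 = 0) : headSum z x Ψ 0 = 0 := by
  simp [headSum, compositions_zero, listWeight, h]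

theorem headSum_series {Ψ : ℕ → R} (h : Ψ 0 = 0) :
    mk (headSum z x Ψ) = mk Ψ * mk (compSum z x) := by
  ext n
  rcases Nat.eq_zero_or_pos n with rfl | hn
  · rw [coeff_mk, headSum_zero _ _ h, coeff_mul]
    simp [h]
  · rw [coeff_mk, headSum_eq _ _ _ hn, coeff_mul,
      Finset.Nat.sum_antidiagonal_eq_sum_range_succ_mk]
    simp only [coeff_mk]
    refine Finset.sum_subset_zero_on_sdiff (fun i => ?_) (fun i hi => ?_) (fun i hi => rfl)
    · simp only [Finset.mem_Icc, Finset.mem_range]; omega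
    · simp only [Finset.mem_sdiff, Finset.mem_Icc, Finset.mem_range] at hi
      rw [show i = 0 by omega, h, zero_mul]

theorem lastSum_of_lt {Ψ : ℕ → R} {k n : ℕ} (h : n < k) : lastSum z x Ψ k n = 0 := by
  refine Finset.sum_eq_zero fun α hα => if_neg ?_
  have h1 := (mem_compositions.1 hα).2
  rcases List.eq_nil_or_concat α with rfl | ⟨β, p, rfl⟩
  · simp; omega
  · rw [List.concat_eq_append, List.sum_append] at h1
    simp only [List.concat_eq_append, List.getLastD_concat]
    simp at h1
    omega

theorem lastCompSum_series (k : ℕ) :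
    mk (lastCompSum z x k) = C z * tailSeries x k * mk (compSum z x) := by
  ext n
  rw [coeff_mk, coeff_mul, Finset.Nat.sum_antidiagonal_eq_sum_range_succ_mk, lastCompSum]
  simp only [coeff_C_mul, tailSeries, coeff_mk]
  refine Finset.sum_subset_zero_on_sdiff (fun i => ?_) (fun i hi => ?_) (fun i hi => ?_)
  · simp only [Finset.mem_Icc, Finset.mem_range]; omega
  · simp only [Finset.mem_sdiff, Finset.mem_Icc, Finset.mem_range] at hi
    rw [if_neg (by omega), mul_zero, zero_mul]
  · rw [if_pos (Finset.mem_Icc.1 hi).1]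

theorem lastSum_series {Ψ : ℕ → R} (h : Ψ 0 = 0) {k : ℕ} (hk : 1 ≤ k) :
    mk (lastSum z x Ψ k) = (mk fun n => if k ≤ n then Ψ n else 0) +
      mk Ψ * (C z * tailSeries x k * mk (compSum z x)) := by
  rw [← lastCompSum_series]
  ext n
  rcases Nat.eq_zero_or_pos n with rfl | hn
  · rw [coeff_mk, lastSum_of_lt _ _ (by omega), map_add, coeff_mul]
    simp [h]
  · rw [coeff_mk, lastSum_eq _ _ _ hk hn, map_add, coeff_mul,
      Finset.Nat.sum_antidiagonal_eq_sum_range_succ_mk]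
    simp only [coeff_mk]
    congr 1
    refine Finset.sum_subset_zero_on_sdiff (fun i => ?_) (fun i hi => ?_) (fun i hi => rfl)
    · simp only [Finset.mem_Icc, Finset.mem_range]; omega
    · simp only [Finset.mem_sdiff, Finset.mem_Icc, Finset.mem_range] at hi
      rw [show i = 0 by omega, h, zero_mul]

end Series

/-! ### The generating function of the cycle -/

section CycleSeries

open PowerSeries

variable {R : Type*} [CommRing R] (z : R) (x : ℕ → R)

/-- The generating function of paths, all components of which are labelled. -/
noncomputable def pathSeries : PowerSeries R :=
  mk (compSum 1 (headSum z x fun j => j * x j))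

theorem mk_natCast_mul : (mk fun j : ℕ => (j : R) * x j) = tailSeries' x 1 := by
  ext n
  rcases Nat.eq_zero_or_pos n with rfl | hn
  · simp [tailSeries']
  · rw [tailSeries', coeff_mk, coeff_mk, if_pos (show 1 ≤ n from hn)]

theorem mk_single (i : ℕ) : (mk (Pi.single i 1) : PowerSeries R) = X ^ i := by
  ext n
  rw [coeff_mk, coeff_X_pow, Pi.single_apply]

theorem pathSeries_eq : pathSeries z x = 1 +
    tailSeries' x 1 * mk (compSum z x) * pathSeries z x := by
  have h0 : (fun j : ℕ => (j : R) * x j) 0 = 0 := by simp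
  have h1 : tailSeries (headSum z x fun j => j * x j) 1 =
      tailSeries' x 1 * mk (compSum z x) := by
    rw [← mk_natCast_mul, ← headSum_series z x h0]
    ext n
    rcases Nat.eq_zero_or_pos n with rfl | hn
    · rw [coeff_mk, headSum_zero _ _ h0]; simp [tailSeries]
    · rw [tailSeries, coeff_mk, coeff_mk, if_pos (show 1 ≤ n from hn)]
  have h2 := compSum_series 1 (headSum z x fun j => j * x j)
  rwa [h1, map_one, one_mul] at h2

theorem tail_single {i : ℕ} (k : ℕ) :
    (mk fun n => if k ≤ n then (Pi.single i 1 : ℕ → R) n else 0) =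
      if k ≤ i then (X ^ i : PowerSeries R) else 0 := by
  ext n
  simp only [coeff_mk, Pi.single_apply]
  split_ifs with h1 h2 h3 h3 <;> simp [coeff_X_pow] <;> omega

/-- The generating function in the cycle length of the coefficients of the cycle. -/
theorem joinCoeff_cycle_series {a : ℕ} (ha : 2 ≤ a) {i k : ℕ} (hi : 1 ≤ i) (hk : 1 ≤ k) :
    LabeledGraph.joinCoeff z x (LabeledGraph.cycle a ha) (Pi.single i 1) k =
      coeff (a - 1 + k) (X ^ i * mk (compSum z x) * pathSeries z x *
          (tailSeries' x k + tailSeries' x 1 * (C z * tailSeries x k * mk (compSum z x))) +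
        pathSeries z x * (euler ((if k ≤ i then X ^ i else 0) +
            X ^ i * (C z * tailSeries x k * mk (compSum z x))) -
          C (k : R) * ((if k ≤ i then X ^ i else 0) +
            X ^ i * (C z * tailSeries x k * mk (compSum z x))))) := by
  have hΨ : (Pi.single i 1 : ℕ → R) 0 = 0 := Pi.single_eq_of_ne (by omega) _
  have h0 : (fun j : ℕ => (j : R) * x j) 0 = 0 := by simp
  have hL := lastSum_series z x hΨ hk
  have hL0 := lastSum_series z x (Ψ := fun j : ℕ => (j : R) * x j) h0 hk
  rw [tail_single, mk_single] at hL
  rw [mk_natCast_mul] at hL0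
  have hP := headSum_series z x hΨ
  rw [mk_single] at hP
  rw [← hL, ← hP, LabeledGraph.joinCoeff_cycle]
  simp only [add_mul, Finset.sum_add_distrib]
  rw [sum_triple_eq_coeff _ _ (headSum_zero _ _ hΨ) (fun n hn => lastSum_of_lt _ _ hn),
    sum_double_eq_coeff _ _ (fun n hn => lastSum_of_lt _ _ hn), hL0, map_add]
  rw [show (mk fun n : ℕ => ((n : R) - k) * lastSum z x (Pi.single i 1) k n) =
    euler (mk (lastSum z x (Pi.single i 1) k)) - C (k : R) * mk (lastSum z x (Pi.single i 1) k) by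
      ext n; simp only [euler, map_sub, coeff_mk, coeff_C_mul]; ring]
  rfl

/-- The inverse of `1 - ∑ (n - 1) x_n t^n`. -/
noncomputable def coreSeries : PowerSeries R := pathSeries (-1) x * mk (compSum (-1) x)

theorem compSum_neg_one_mul : mk (compSum (-1) x) * (1 + tailSeries x 1) = 1 := by
  have h := compSum_series (-1) x
  rw [map_neg, map_one] at h
  linear_combination h

/-- The sums over all compositions cancel against `1 + ∑ x_n t^n`. -/
theorem pathSeries_neg_one : pathSeries (-1) x = coreSeries x * (1 + tailSeries x 1) := by
  rw [coreSeries, mul_assoc, compSum_neg_one_mul, mul_one]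

theorem coreSeries_eq : coreSeries x = 1 + (tailSeries' x 1 - tailSeries x 1) * coreSeries x := by
  have h1 := pathSeries_eq (-1) x
  have h2 := pathSeries_neg_one x
  have h3 : coreSeries x = pathSeries (-1) x * mk (compSum (-1) x) := rfl
  linear_combination h1 - h2 - tailSeries' x 1 * h3

theorem euler_compSum_neg_one : euler (mk (compSum (-1) x)) =
    -(mk (compSum (-1) x) ^ 2 * tailSeries' x 1) := by
  have h := compSum_neg_one_mul x
  have h1 := congrArg euler h
  rw [euler_mul, euler_add, euler_one, euler_tailSeries, zero_add] at h1
  linear_combination (mk (compSum (-1) x)) * h1 - euler (mk (compSum (-1) x)) * h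

/-- The signed coefficient of the cycle after all cancellations. -/
theorem joinCoeff_cycle_neg_one {a : ℕ} (ha : 2 ≤ a) {i k : ℕ} (hi : 1 ≤ i) (hk : 1 ≤ k) :
    LabeledGraph.joinCoeff (-1) x (LabeledGraph.cycle a ha) (Pi.single i 1) k =
      coeff (a - 1 + k) (((i : PowerSeries R) - (k : PowerSeries R)) * X ^ i *
        ((if k ≤ i then pathSeries (-1) x else 0) - tailSeries x k * coreSeries x)) := by
  rw [joinCoeff_cycle_series _ _ _ hi hk]
  congr 1
  have h1 : euler (if k ≤ i then X ^ i else 0 : PowerSeries R) =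
      (i : PowerSeries R) * (if k ≤ i then X ^ i else 0) := by
    split_ifs
    · exact euler_X_pow i
    · ext n; simp [euler]
  have h2 : (pathSeries (-1) x * if k ≤ i then X ^ i else 0) =
      X ^ i * (if k ≤ i then pathSeries (-1) x else 0) := by
    split_ifs
    · ring
    · simp
  have h3 : coreSeries x = pathSeries (-1) x * mk (compSum (-1) x) := rfl
  simp only [map_neg, map_one, map_natCast, euler_add, euler_mul, h1, euler_X_pow,
    euler_tailSeries, euler_compSum_neg_one, h3]
  have h4 : euler (-1 : PowerSeries R) = 0 := by
    have h := euler_sub (0 : PowerSeries R) 1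
    rw [zero_sub, euler_one] at h
    rw [h]; ext n; simp [euler]
  rw [h4]
  linear_combination ((i : PowerSeries R) - (k : PowerSeries R)) * h2

theorem compSum_zero_series : (mk (compSum 0 x) : PowerSeries R) = 1 := by
  have h := compSum_series 0 x
  simpa using h

/-- The coefficient of the cycle for unit forest triples. -/
theorem joinCoeff_cycle_zero {a : ℕ} (ha : 2 ≤ a) {i k : ℕ} (hi : 1 ≤ i) (hk : 1 ≤ k) :
    LabeledGraph.joinCoeff 0 x (LabeledGraph.cycle a ha) (Pi.single i 1) k =
      coeff (a - 1 + k) (X ^ i * (pathSeries 0 x * tailSeries' x k +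
        (if k ≤ i then ((i : PowerSeries R) - (k : PowerSeries R)) * pathSeries 0 x else 0))) := by
  rw [joinCoeff_cycle_series _ _ _ hi hk]
  congr 1
  simp only [compSum_zero_series, map_zero, zero_mul, mul_zero, add_zero, mul_one, map_natCast]
  split_ifs
  · rw [euler_X_pow]; ring
  · rw [show euler (0 : PowerSeries R) = 0 by ext n; simp [euler]]; ring

theorem pathSeries_zero : pathSeries 0 x = 1 + tailSeries' x 1 * pathSeries 0 x := by
  have h := pathSeries_eq 0 x
  rwa [compSum_zero_series, mul_one] at h

end CycleSeries

/-! ### Positivity of the coefficients of the cycle -/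

section Positivity

open PowerSeries

/-- The polynomials with nonnegative coefficients. -/
def nonnegPoly : Subsemiring (MvPolynomial ℕ ℤ) where
  carrier := {f | ∀ m, 0 ≤ f.coeff m}
  mul_mem' := by
    intro f g hf hg m
    rw [MvPolynomial.coeff_mul]
    exact Finset.sum_nonneg fun p _ => mul_nonneg (hf _) (hg _)
  one_mem' := by
    intro m
    rw [MvPolynomial.coeff_one]
    split_ifs <;> simp
  add_mem' := by
    intro f g hf hg m
    rw [MvPolynomial.coeff_add]
    exact add_nonneg (hf m) (hg m)
  zero_mem' := by intro m; simp

theorem X_mem_nonnegPoly (n : ℕ) : (MvPolynomial.X n : MvPolynomial ℕ ℤ) ∈ nonnegPoly := by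
  classical
  intro m
  rw [MvPolynomial.coeff_X]
  split_ifs <;> simp

/-- The power series all coefficients of which are polynomials with nonnegative coefficients. -/
def nonnegSeries : Subsemiring (PowerSeries (MvPolynomial ℕ ℤ)) where
  carrier := {f | ∀ n, coeff n f ∈ nonnegPoly}
  mul_mem' := by
    intro f g hf hg n
    rw [coeff_mul]
    exact nonnegPoly.sum_mem fun p _ => nonnegPoly.mul_mem (hf _) (hg _)
  one_mem' := by
    intro n
    rw [coeff_one]
    split_ifs
    · exact nonnegPoly.one_mem
    · exact nonnegPoly.zero_mem
  add_mem' := by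
    intro f g hf hg n
    rw [map_add]
    exact nonnegPoly.add_mem (hf n) (hg n)
  zero_mem' := by intro n; rw [map_zero]; exact nonnegPoly.zero_mem

theorem mem_nonnegSeries_of_eq {f q : PowerSeries (MvPolynomial ℕ ℤ)} (hq : q ∈ nonnegSeries)
    (hq0 : coeff 0 q = 0) (h : f = 1 + q * f) : f ∈ nonnegSeries := by
  intro n
  induction n using Nat.strong_induction_on with
  | _ n ih =>
    rw [h, map_add, coeff_mul]
    refine nonnegPoly.add_mem (nonnegSeries.one_mem n) (nonnegPoly.sum_mem fun p hp => ?_)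
    have hp' := Finset.HasAntidiagonal.mem_antidiagonal.1 hp
    rcases Nat.eq_zero_or_pos p.1 with h1 | h1
    · rw [h1, hq0, zero_mul]; exact nonnegPoly.zero_mem
    · exact nonnegPoly.mul_mem (hq _) (ih _ (by omega))

/-- The variables of the polynomial ring. -/
noncomputable abbrev polyX : ℕ → MvPolynomial ℕ ℤ := MvPolynomial.X

theorem X_pow_mem (i : ℕ) : (X ^ i : PowerSeries (MvPolynomial ℕ ℤ)) ∈ nonnegSeries := by
  intro n
  rw [coeff_X_pow]
  split_ifs
  · exact nonnegPoly.one_mem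
  · exact nonnegPoly.zero_mem

theorem tailSeries_mem (k : ℕ) : tailSeries polyX k ∈ nonnegSeries := by
  intro n
  rw [tailSeries, coeff_mk]
  split_ifs
  · exact X_mem_nonnegPoly n
  · exact nonnegPoly.zero_mem

theorem tailSeries'_mem (k : ℕ) : tailSeries' polyX k ∈ nonnegSeries := by
  intro n
  rw [tailSeries', coeff_mk]
  split_ifs
  · exact nonnegPoly.mul_mem (natCast_mem _ n) (X_mem_nonnegPoly n)
  · exact nonnegPoly.zero_mem

theorem tailSeries'_sub_mem {c k : ℕ} (h : c ≤ k) :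
    tailSeries' polyX k - c * tailSeries polyX k ∈ nonnegSeries := by
  intro n
  rw [← map_natCast (C (R := MvPolynomial ℕ ℤ)) c, map_sub, coeff_C_mul, tailSeries', tailSeries,
    coeff_mk, coeff_mk]
  split_ifs with h1
  · rw [← sub_mul, ← Nat.cast_sub (h.trans h1)]
    exact nonnegPoly.mul_mem (natCast_mem _ _) (X_mem_nonnegPoly n)
  · simp

theorem coreSeries_mem : coreSeries polyX ∈ nonnegSeries := by
  refine mem_nonnegSeries_of_eq ?_ ?_ (coreSeries_eq polyX)
  · have h := tailSeries'_sub_mem (le_refl 1)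
    rwa [Nat.cast_one, one_mul] at h
  · simp [tailSeries, tailSeries']

theorem pathSeries_zero_mem : pathSeries 0 polyX ∈ nonnegSeries :=
  mem_nonnegSeries_of_eq (tailSeries'_mem 1) (by simp [tailSeries']) (pathSeries_zero polyX)

theorem pathSeries_zero_sub : pathSeries 0 polyX - coreSeries polyX =
    coreSeries polyX * tailSeries polyX 1 * pathSeries 0 polyX := by
  linear_combination coreSeries polyX * pathSeries_zero polyX -
    pathSeries 0 polyX * coreSeries_eq polyX

theorem pathSeries_zero_sub' : pathSeries 0 polyX - pathSeries (-1) polyX =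
    coreSeries polyX * tailSeries polyX 1 * (tailSeries' polyX 1 * pathSeries 0 polyX) := by
  linear_combination pathSeries_zero_sub - pathSeries_neg_one polyX +
    coreSeries polyX * tailSeries polyX 1 * pathSeries_zero polyX

/-- The signed coefficients of the cycle are nonnegative: `i - k` has the sign of the difference in
`joinCoeff_cycle_neg_one`. -/
theorem joinCoeff_cycle_nonneg {a : ℕ} (ha : 2 ≤ a) {i k : ℕ} (hi : 1 ≤ i) (hk : 1 ≤ k) :
    LabeledGraph.joinCoeff (-1) polyX (LabeledGraph.cycle a ha) (Pi.single i 1) k ∈ nonnegPoly := by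
  rw [joinCoeff_cycle_neg_one _ _ hi hk]
  refine (?_ : _ ∈ nonnegSeries) _
  split_ifs with h
  · rw [← Nat.cast_sub h, pathSeries_neg_one]
    have h1 : tailSeries polyX 1 - tailSeries polyX k ∈ nonnegSeries := by
      intro n
      rw [map_sub, tailSeries, tailSeries, coeff_mk, coeff_mk]
      split_ifs
      · simp
      · rw [sub_zero]; exact X_mem_nonnegPoly n
      · omega
      · simp
    have h2 := nonnegSeries.mul_mem
      (nonnegSeries.mul_mem (natCast_mem nonnegSeries (i - k)) (X_pow_mem i))
      (nonnegSeries.mul_mem coreSeries_mem (nonnegSeries.add_mem nonnegSeries.one_mem h1))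
    convert h2 using 1
    ring
  · have h2 := nonnegSeries.mul_mem
      (nonnegSeries.mul_mem (natCast_mem nonnegSeries (k - i)) (X_pow_mem i))
      (nonnegSeries.mul_mem (tailSeries_mem k) coreSeries_mem)
    convert h2 using 1
    rw [Nat.cast_sub (by omega)]
    ring

/-- The signed coefficients of the cycle are bounded by the numbers of unit forest triples. -/
theorem joinCoeff_cycle_le {a : ℕ} (ha : 2 ≤ a) {i k : ℕ} (hi : 1 ≤ i) (hk : 1 ≤ k) :
    LabeledGraph.joinCoeff 0 polyX (LabeledGraph.cycle a ha) (Pi.single i 1) k -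
      LabeledGraph.joinCoeff (-1) polyX (LabeledGraph.cycle a ha) (Pi.single i 1) k ∈
        nonnegPoly := by
  rw [joinCoeff_cycle_neg_one _ _ hi hk, joinCoeff_cycle_zero _ _ hi hk, ← map_sub]
  refine (?_ : _ ∈ nonnegSeries) _
  have hA := nonnegSeries.mul_mem coreSeries_mem (tailSeries_mem 1)
  split_ifs with h
  · have h1 := nonnegSeries.mul_mem (X_pow_mem i)
      (nonnegSeries.mul_mem pathSeries_zero_mem (tailSeries'_mem k))
    have h2 := nonnegSeries.mul_mem
      (nonnegSeries.mul_mem (natCast_mem nonnegSeries (i - k)) (X_pow_mem i))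
      (nonnegSeries.add_mem
        (nonnegSeries.mul_mem hA (nonnegSeries.mul_mem (tailSeries'_mem 1) pathSeries_zero_mem))
        (nonnegSeries.mul_mem (tailSeries_mem k) coreSeries_mem))
    rw [← pathSeries_zero_sub'] at h2
    convert nonnegSeries.add_mem h1 h2 using 1
    rw [Nat.cast_sub h]
    ring
  · have h1 := nonnegSeries.mul_mem (X_pow_mem i) (nonnegSeries.add_mem
      (nonnegSeries.mul_mem (nonnegSeries.mul_mem hA pathSeries_zero_mem) (tailSeries'_mem k))
      (nonnegSeries.mul_mem coreSeries_mem (tailSeries'_sub_mem (Nat.sub_le k i))))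
    rw [← pathSeries_zero_sub] at h1
    convert h1 using 1
    rw [Nat.cast_sub (by omega)]
    ring

end Positivity

/-! ### From involutions to inequalities and back -/

section Involution

variable {A K : Type*} {key : A → K} {sgn : A → ℤ} {unit : A → Prop} {s : Finset A}

/-- `φ` restricts to an involution of `s` that preserves `key`, changes the sign of every element
that it moves, and fixes only units. -/
def IsCancelling (key : A → K) (sgn : A → ℤ) (unit : A → Prop) (s : Finset A) (φ : A → A) : Prop :=
  ∀ S ∈ s, φ S ∈ s ∧ φ (φ S) = S ∧ key (φ S) = key S ∧ (φ S ≠ S → sgn (φ S) = -sgn S) ∧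
    (φ S = S → unit S)

/-- Off the fixed points the signs cancel, and the fixed points are units of the same class. -/
theorem IsCancelling.sum_bounds [DecidableEq K] [DecidablePred unit] {φ : A → A}
    (h : IsCancelling key sgn unit s φ)
    (hu : ∀ S ∈ s, unit S → sgn S = 1) (c : K) :
    0 ≤ ∑ S ∈ s with key S = c, sgn S ∧
      ∑ S ∈ s with key S = c, sgn S ≤ ∑ S ∈ s with key S = c, if unit S then 1 else 0 := by
  classical
  have h1 : ∑ S ∈ s with key S = c, sgn S =
      ∑ S ∈ {S ∈ s | key S = c} with φ S = S, (1 : ℤ) := by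
    rw [← Finset.sum_filter_add_sum_filter_not _ (fun S => φ S = S)]
    have h2 : ∑ S ∈ {S ∈ s | key S = c} with ¬ φ S = S, sgn S = 0 := by
      refine Finset.sum_involution (fun S _ => φ S) ?_ ?_ ?_ ?_
      · intro S hS
        simp only [Finset.mem_filter] at hS
        rw [(h S hS.1.1).2.2.2.1 hS.2]
        ring
      · intro S hS _
        exact (Finset.mem_filter.1 hS).2
      · intro S hS
        simp only [Finset.mem_filter] at hS ⊢
        obtain ⟨h3, h4, h5, -⟩ := h S hS.1.1
        exact ⟨⟨h3, h5.trans hS.1.2⟩, fun h6 => hS.2 (by rw [h4] at h6; exact h6.symm)⟩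
      · intro S hS
        simp only [Finset.mem_filter] at hS
        exact (h S hS.1.1).2.1
    rw [h2, add_zero]
    refine Finset.sum_congr rfl fun S hS => ?_
    simp only [Finset.mem_filter] at hS
    exact hu S hS.1.1 ((h S hS.1.1).2.2.2.2 hS.2)
  rw [h1, ← Finset.sum_filter]
  refine ⟨Finset.sum_nonneg fun _ _ => zero_le_one,
    Finset.sum_le_sum_of_subset_of_nonneg ?_ fun _ _ _ => zero_le_one⟩
  intro S hS
  rw [Finset.mem_filter] at hS ⊢
  exact ⟨hS.1, (h S (Finset.mem_filter.1 hS.1).1).2.2.2.2 hS.2⟩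

/-- Conversely, a cancelling involution exists as soon as every class has a nonnegative signed
count that is at most the number of its units: match a negative element with a positive one, and
use a unit only if all positive elements of its class are units. -/
theorem exists_isCancelling [DecidableEq K] [DecidablePred unit]
    (hs : ∀ S ∈ s, sgn S = 1 ∨ sgn S = -1)
    (hu : ∀ S ∈ s, unit S → sgn S = 1)
    (h : ∀ c, 0 ≤ ∑ S ∈ s with key S = c, sgn S ∧
      ∑ S ∈ s with key S = c, sgn S ≤ ∑ S ∈ s with key S = c, if unit S then 1 else 0) :
    ∃ φ, IsCancelling key sgn unit s φ := by
  classical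
  induction hn : s.card using Nat.strong_induction_on generalizing s with
  | _ N ih =>
    by_cases hneg : ∃ n ∈ s, sgn n = -1
    -- match `n` with a positive `p` of its class, which exists as the signed count is nonnegative
    · obtain ⟨n, hns, hn1⟩ := hneg
      have hle : ∀ S ∈ s, sgn S = 1 ∨ sgn S ≤ -1 := fun S hS => (hs S hS).imp_right le_of_eq
      obtain ⟨p, hps, hpk, hp1, hpu⟩ : ∃ p ∈ s, key p = key n ∧ sgn p = 1 ∧
          (unit p → ∀ S ∈ s, key S = key n → sgn S = 1 → unit S) := by
        by_cases hex : ∃ p ∈ s, key p = key n ∧ sgn p = 1 ∧ ¬ unit p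
        · obtain ⟨p, h1, h2, h3, h4⟩ := hex
          exact ⟨p, h1, h2, h3, fun h5 => absurd h5 h4⟩
        · push Not at hex
          have h1 : ∃ p ∈ s, key p = key n ∧ sgn p = 1 := by
            by_contra! hno
            have h2 : ∑ S ∈ s with key S = key n, sgn S < 0 := by
              refine Finset.sum_neg (fun S hS => ?_) ⟨n, Finset.mem_filter.2 ⟨hns, rfl⟩⟩
              rw [Finset.mem_filter] at hS
              have := hle S hS.1
              have := hno S hS.1 hS.2
              omega
            exact absurd (h (key n)).1 (not_le.2 h2)
          obtain ⟨p, h1, h2, h3⟩ := h1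
          exact ⟨p, h1, h2, h3, fun _ => hex⟩
      have hnp : n ≠ p := by rintro rfl; omega
      have hps' : p ∈ s.erase n := Finset.mem_erase.2 ⟨hnp.symm, hps⟩
      set t := (s.erase n).erase p with ht
      have hts : ∀ S ∈ t, S ∈ s ∧ S ≠ n ∧ S ≠ p := by
        intro S hS
        rw [ht, Finset.mem_erase, Finset.mem_erase] at hS
        exact ⟨hS.2.2, hS.2.1, hS.1⟩
      have hsum : ∀ (f : A → ℤ) c, ∑ S ∈ s with key S = c, f S =
          (if key n = c then f n + f p else 0) + ∑ S ∈ t with key S = c, f S := by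
        intro f c
        rw [Finset.sum_filter, ← Finset.add_sum_erase _ _ hns, ← Finset.add_sum_erase _ _ hps',
          Finset.sum_filter, hpk]
        split_ifs <;> ring
      have hcard : t.card < N := by
        rw [← hn, ht]
        exact (Finset.card_erase_lt_of_mem hps').trans (Finset.card_erase_lt_of_mem hns)
      obtain ⟨φ, hφ⟩ := ih t.card hcard (fun S hS => hs S (hts S hS).1)
        (fun S hS => hu S (hts S hS).1) (by
          intro c
          have hc := h c
          have h1 := hsum sgn c
          have h2 := hsum (fun S => if unit S then 1 else 0) c
          rw [hn1, hp1] at h1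
          have hnu : ¬ unit n := fun h3 => by have := hu n hns h3; omega
          simp only [if_neg hnu] at h2
          by_cases hkc : key n = c
          · rw [if_pos hkc] at h1 h2
            by_cases hpu' : unit p
            -- all remaining positive elements of the class are units, so the upper bound is clear
            · have h3 : ∑ S ∈ t with key S = c, sgn S ≤
                  ∑ S ∈ t with key S = c, if unit S then 1 else 0 := by
                refine Finset.sum_le_sum fun S hS => ?_
                rw [Finset.mem_filter] at hS
                have h4 := hs S (hts S hS.1).1
                have h5 := hpu hpu' S (hts S hS.1).1 (hS.2.trans hkc.symm)
                split_ifs with h6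
                · omega
                · have : sgn S ≠ 1 := fun h7 => h6 (h5 h7)
                  omega
              exact ⟨by linarith, h3⟩
            · rw [if_neg hpu'] at h2
              exact ⟨by linarith, by linarith⟩
          · rw [if_neg hkc] at h1 h2
            exact ⟨by linarith, by linarith⟩) rfl
      refine ⟨fun S => if S = n then p else if S = p then n else φ S, fun S hS => ?_⟩
      by_cases h1 : S = n
      · subst h1
        simp only [if_true, if_neg hnp.symm]
        refine ⟨hps, trivial, hpk, fun _ => by omega, fun h2 => absurd h2.symm hnp⟩
      by_cases h2 : S = p
      · subst h2
        simp only [if_true, if_neg h1]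
        refine ⟨hns, trivial, hpk.symm, fun _ => by omega, fun h2 => absurd h2 hnp⟩
      have hSt : S ∈ t := by
        rw [ht, Finset.mem_erase, Finset.mem_erase]
        exact ⟨h2, h1, hS⟩
      obtain ⟨h3, h4⟩ := hφ S hSt
      obtain ⟨h5, h6, h7⟩ := hts _ h3
      simp only [if_neg h1, if_neg h2, if_neg h6, if_neg h7]
      exact ⟨h5, h4⟩
    · -- without negative elements, the bound forces every element to be a unit
      push Not at hneg
      have hpos : ∀ S ∈ s, sgn S = 1 := fun S hS => (hs S hS).resolve_right (hneg S hS)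
      refine ⟨id, fun S hS => ⟨hS, rfl, rfl, fun h1 => absurd rfl h1, fun _ => ?_⟩⟩
      by_contra hSu
      have h1 := (h (key S)).2
      refine absurd h1 (not_le.2 ?_)
      refine Finset.sum_lt_sum (fun S' hS' => ?_) ⟨S, Finset.mem_filter.2 ⟨hS, rfl⟩, ?_⟩
      · rw [hpos S' (Finset.mem_filter.1 hS').1]
        split_ifs <;> norm_num
      · rw [hpos S hS, if_neg hSu]
        norm_num

end Involution

namespace LabeledGraph

variable {G : LabeledGraph} {S : Finset TreeTriple}

/-- The pairs `(α₁, r)` on the tree triples that contain vertex `1`. -/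
def minLabels (S : Finset TreeTriple) : Set (ℕ × ℕ) :=
  {c | ∃ T ∈ S, 1 ∈ T.V ∧ c = (T.firstPart, T.r)}

/-- What a first-preserving involution preserves. -/
noncomputable def forestKey (S : Finset TreeTriple) : Multiset ℕ × Set (ℕ × ℕ) :=
  (reducedType S, minLabels S)

theorem minLabels_eq (hS : S ∈ G.FT) {T : TreeTriple} (hT : T ∈ S) (h1 : 1 ∈ T.V) :
    minLabels S = {(T.firstPart, T.r)} := by
  ext c
  constructor
  · rintro ⟨T', hT', h1', rfl⟩
    rw [(existsUnique_min hS).unique ⟨hT', h1'⟩ ⟨hT, h1⟩]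
    rfl
  · rintro rfl
    exact ⟨T, hT, h1, rfl⟩

theorem typeOf_eq (hS : S ∈ G.FT) {T : TreeTriple} (hT : T ∈ S) (h1 : 1 ∈ T.V) :
    typeOf S = T.firstPart ::ₘ reducedType S := by
  have h2 : ∑ T ∈ S, (if 1 ∈ T.V then ({T.firstPart} : Multiset ℕ) else 0) = {T.firstPart} := by
    rw [Finset.sum_eq_single_of_mem T hT, if_pos h1]
    intro T' hT' hne
    rw [if_neg]
    exact fun h1' => hne ((existsUnique_min hS).unique ⟨hT', h1'⟩ ⟨hT, h1⟩)
  rw [← Multiset.singleton_add, ← h2, reducedType, ← Finset.sum_add_distrib, typeOf]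
  refine Finset.sum_congr rfl fun T' hT' => ?_
  split_ifs
  · conv_lhs => rw [← firstPart_mul_tail hS hT']
    rw [Multiset.singleton_add, Multiset.cons_coe]
  · rw [zero_add]

theorem signOf_eq_or (S : Finset TreeTriple) : signOf S = 1 ∨ signOf S = -1 :=
  neg_one_pow_eq_or ℤ _

theorem isUnitForest_iff (hS : S ∈ G.FT) :
    IsUnitForest S ↔ ∑ T ∈ S, (T.α.length - 1) = 0 := by
  rw [Finset.sum_eq_zero_iff]
  refine forall₂_congr fun T hT => ?_
  have := congrArg List.length (firstPart_mul_tail hS hT)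
  rw [List.length_cons] at this
  omega

theorem signOf_of_unit (hS : S ∈ G.FT) (h : IsUnitForest S) : signOf S = 1 := by
  rw [signOf, (isUnitForest_iff hS).1 h, pow_zero]

/-- Preserving the type and `α₁` is the same as preserving the reduced type and `α₁`. -/
theorem hasFirstPreservingInvolution_iff : G.HasFirstPreservingInvolution ↔
    ∃ φ, IsCancelling forestKey signOf IsUnitForest G.FT_finite.toFinset φ := by
  classical
  constructor
  · rintro ⟨φ, ⟨h1, h2, h3, -⟩, h5, h6⟩
    refine ⟨fun S => if hS : S ∈ G.FT then φ ⟨S, hS⟩ else S, fun S hS => ?_⟩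
    rw [Set.Finite.mem_toFinset] at hS
    simp only [dif_pos hS, Subtype.coe_prop, dif_pos, Set.Finite.mem_toFinset, true_and]
    obtain ⟨T, ⟨hT, hT1⟩, -⟩ := existsUnique_min hS
    obtain ⟨T', ⟨hT', hT1'⟩, -⟩ := existsUnique_min (φ ⟨S, hS⟩).2
    obtain ⟨h7, h8⟩ := h6 ⟨S, hS⟩ T hT T' hT' hT1 hT1'
    refine ⟨by rw [h1], Prod.ext ?_ ?_, fun h => ?_, fun h => h5 ⟨S, hS⟩ (Subtype.ext h)⟩
    · have h9 := h2 ⟨S, hS⟩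
      rw [typeOf_eq hS hT hT1, typeOf_eq (φ ⟨S, hS⟩).2 hT' hT1', h7] at h9
      exact (Multiset.cons_inj_right _).1 h9
    · simp only [forestKey]
      rw [minLabels_eq hS hT hT1, minLabels_eq (φ ⟨S, hS⟩).2 hT' hT1', h7, h8]
    · have h9 := h3 ⟨S, hS⟩ (fun h' => h (congrArg Subtype.val h'))
      have h10 := signOf_eq_or S
      have h11 := signOf_eq_or (φ ⟨S, hS⟩ : Finset TreeTriple)
      dsimp only at h9
      omega
  · rintro ⟨φ, hφ⟩
    have hφ' : ∀ S : G.FT, _ := fun S => hφ S (by rw [Set.Finite.mem_toFinset]; exact S.2)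
    have hmem : ∀ S : G.FT, φ S ∈ G.FT := fun S => by
      have := (hφ' S).1
      rwa [Set.Finite.mem_toFinset] at this
    have hlab : ∀ S : G.FT, ∀ T ∈ (S : Finset TreeTriple), ∀ T' ∈ φ (S : Finset TreeTriple),
        1 ∈ T.V → 1 ∈ T'.V → T.firstPart = T'.firstPart ∧ T.r = T'.r := by
      intro S T hT T' hT' h1 h1'
      have h2 := congrArg Prod.snd (hφ' S).2.2.1
      simp only [forestKey] at h2
      rw [minLabels_eq S.2 hT h1, minLabels_eq (hmem S) hT' h1',
        Set.singleton_eq_singleton_iff] at h2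
      rw [Prod.mk.injEq] at h2
      exact ⟨h2.1.symm, h2.2.symm⟩
    refine ⟨fun S => ⟨φ S, hmem S⟩, ⟨fun S => Subtype.ext (hφ' S).2.1, fun S => ?_, fun S h => ?_,
      fun S h => ?_⟩, fun S h => ?_, hlab⟩
    · obtain ⟨T, ⟨hT, hT1⟩, -⟩ := existsUnique_min S.2
      obtain ⟨T', ⟨hT', hT1'⟩, -⟩ := existsUnique_min (hmem S)
      have h2 := congrArg Prod.fst (hφ' S).2.2.1
      simp only [forestKey] at h2
      rw [typeOf_eq S.2 hT hT1, typeOf_eq (hmem S) hT' hT1', h2, (hlab S T hT T' hT' hT1 hT1').1]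
    · have h1 := (hφ' S).2.2.2.1 (fun h' => h (Subtype.ext h'))
      have h2 := signOf_eq_or (S : Finset TreeTriple)
      dsimp only
      omega
    · exact signOf_of_unit S.2 ((hφ' S).2.2.2.2 (congrArg Subtype.val h))
    · exact (hφ' S).2.2.2.2 (congrArg Subtype.val h)

theorem prod_map_polyX (m : Multiset ℕ) :
    (m.map polyX).prod = MvPolynomial.monomial (Multiset.toFinsupp m) 1 := by
  induction m using Multiset.induction_on with
  | empty => simp
  | cons a m ih =>
    rw [Multiset.map_cons, Multiset.prod_cons, ih, ← Multiset.singleton_add, map_add,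
      Multiset.toFinsupp_singleton, polyX, MvPolynomial.X, MvPolynomial.monomial_mul, one_mul]

open scoped Classical in
/-- The coefficients of the generating polynomials count forest triples by what a first-preserving
involution preserves. -/
theorem coeff_forestSum (z : ℤ) (m : Multiset ℕ) (i ρ : ℕ) :
    (forestSum (MvPolynomial.C z) polyX G (indicator _ i ρ)).coeff (Multiset.toFinsupp m) =
      ∑ S ∈ G.FT_finite.toFinset with forestKey S = (m, {(i, ρ)}),
        z ^ (∑ T ∈ S, (T.α.length - 1)) := by
  rw [forestSum, MvPolynomial.coeff_sum, Finset.sum_filter]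
  refine Finset.sum_congr rfl fun S hS => ?_
  rw [Set.Finite.mem_toFinset] at hS
  rw [prod_treeWeight_indicator hS]
  obtain ⟨T, ⟨hT, hT1⟩, huniq⟩ := existsUnique_min hS
  have h1 : (∃ T ∈ S, 1 ∈ T.V ∧ T.firstPart = i ∧ T.r = ρ) ↔ minLabels S = {(i, ρ)} := by
    rw [minLabels_eq hS hT hT1, Set.singleton_eq_singleton_iff, Prod.mk.injEq]
    constructor
    · rintro ⟨T', hT', h1, h2⟩
      rwa [huniq T' ⟨hT', h1⟩] at h2
    · exact fun h => ⟨T, hT, hT1, h⟩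
  simp only [h1, forestKey, Prod.mk.injEq]
  by_cases h2 : minLabels S = {(i, ρ)}
  · rw [if_pos h2, prod_map_polyX, ← map_pow, MvPolynomial.coeff_C_mul,
      MvPolynomial.coeff_monomial]
    simp only [h2, and_true, EmbeddingLike.apply_eq_iff_eq]
    split_ifs <;> simp
  · rw [if_neg h2, if_neg (fun h => h2 h.2), MvPolynomial.coeff_zero]

open scoped Classical in
/-- In terms of generating polynomials, a first-preserving involution exists if and only if for all
labels of the tree at vertex `1` the signed sum over the forest triples has nonnegative
coefficients and is bounded by the sum over the unit forest triples. -/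
theorem hasFirstPreservingInvolution_iff_nonneg : G.HasFirstPreservingInvolution ↔
    ∀ i ρ, 1 ≤ ρ → ρ ≤ i → forestSum (-1) polyX G (indicator _ i ρ) ∈ nonnegPoly ∧
      forestSum 0 polyX G (indicator _ i ρ) - forestSum (-1) polyX G (indicator _ i ρ) ∈
        nonnegPoly := by
  have hunit : ∀ S ∈ G.FT_finite.toFinset, IsUnitForest S → signOf S = 1 := by
    intro S hS
    rw [Set.Finite.mem_toFinset] at hS
    exact signOf_of_unit hS
  have hneg : ∀ m i ρ, (forestSum (-1) polyX G (indicator _ i ρ)).coeff (Multiset.toFinsupp m) =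
      ∑ S ∈ G.FT_finite.toFinset with forestKey S = (m, {(i, ρ)}), signOf S := by
    intro m i ρ
    have h := coeff_forestSum (G := G) (-1) m i ρ
    rwa [map_neg, map_one] at h
  have hzero : ∀ m i ρ, (forestSum 0 polyX G (indicator _ i ρ)).coeff (Multiset.toFinsupp m) =
      ∑ S ∈ G.FT_finite.toFinset with forestKey S = (m, {(i, ρ)}),
        if IsUnitForest S then 1 else 0 := by
    intro m i ρ
    have h := coeff_forestSum (G := G) 0 m i ρ
    rw [map_zero] at h
    rw [h]
    refine Finset.sum_congr rfl fun S hS => ?_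
    rw [Finset.mem_filter, Set.Finite.mem_toFinset] at hS
    by_cases hu : IsUnitForest S
    · rw [if_pos hu, (isUnitForest_iff hS.1).1 hu, pow_zero]
    · rw [if_neg hu, zero_pow (fun h0 => hu ((isUnitForest_iff hS.1).2 h0))]
  rw [hasFirstPreservingInvolution_iff]
  constructor
  · rintro ⟨φ, hφ⟩ i ρ - -
    refine ⟨fun d => ?_, fun d => ?_⟩
    · obtain ⟨m, rfl⟩ := Multiset.toFinsupp.surjective d
      rw [hneg]
      exact (hφ.sum_bounds hunit _).1
    · obtain ⟨m, rfl⟩ := Multiset.toFinsupp.surjective d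
      rw [MvPolynomial.coeff_sub, hneg, hzero, sub_nonneg]
      exact (hφ.sum_bounds hunit _).2
  · intro h
    refine exists_isCancelling (fun S _ => signOf_eq_or S) hunit fun c => ?_
    by_cases hc : ∃ S ∈ G.FT_finite.toFinset, forestKey S = c
    · obtain ⟨S, hS, rfl⟩ := hc
      rw [Set.Finite.mem_toFinset] at hS
      obtain ⟨T, ⟨hT, hT1⟩, -⟩ := existsUnique_min hS
      have hr : 1 ≤ T.r ∧ T.r ≤ T.firstPart := by
        obtain ⟨F, -, hF, -⟩ := hS
        exact (hF T hT).2.2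
      obtain ⟨h1, h2⟩ := h T.firstPart T.r hr.1 hr.2
      have h3 := h1 (Multiset.toFinsupp (reducedType S))
      have h4 := h2 (Multiset.toFinsupp (reducedType S))
      rw [MvPolynomial.coeff_sub, sub_nonneg] at h4
      rw [hneg] at h3 h4
      rw [hzero] at h4
      have h5 : forestKey S = (reducedType S, {(T.firstPart, T.r)}) := by
        rw [forestKey, minLabels_eq hS hT hT1]
      rw [h5]
      exact ⟨h3, h4⟩
    · have h1 : ({S ∈ G.FT_finite.toFinset | forestKey S = c} : Finset _) = ∅ :=
        Finset.filter_eq_empty_iff.2 fun S hS h2 => hc ⟨S, hS, h2⟩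
      rw [h1]
      simp

/-- Adding a cycle in front of the graph keeps the bounds of
`hasFirstPreservingInvolution_iff_nonneg`, because the coefficients of the cycle satisfy the same
bounds. -/
theorem hasFirstPreservingInvolution_cycle_add {a : ℕ} (ha : 2 ≤ a)
    (hG : G.HasFirstPreservingInvolution) : (cycle a ha + G).HasFirstPreservingInvolution := by
  rw [hasFirstPreservingInvolution_iff_nonneg] at hG ⊢
  intro i ρ h1 h2
  rw [forestSum_add, forestSum_add, sumR_indicator h1 h2]
  constructor
  · refine nonnegPoly.sum_mem fun k hk => ?_
    have hk := (Finset.mem_Icc.1 hk).1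
    exact nonnegPoly.mul_mem (hG k 1 le_rfl hk).1 (joinCoeff_cycle_nonneg ha (h1.trans h2) hk)
  · rw [← Finset.sum_sub_distrib]
    refine nonnegPoly.sum_mem fun k hk => ?_
    have hk := (Finset.mem_Icc.1 hk).1
    have hA := hG k 1 le_rfl hk
    have hB := joinCoeff_cycle_nonneg ha (h1.trans h2) hk
    have hC := joinCoeff_cycle_le ha (h1.trans h2) hk
    have hA' := nonnegPoly.add_mem hA.2 hA.1
    have h3 := nonnegPoly.add_mem (nonnegPoly.mul_mem hA' hC) (nonnegPoly.mul_mem hA.2 hB)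
    -- `A₀ B₀ - A B = A₀ (B₀ - B) + (A₀ - A) B`
    convert h3 using 1
    ring

end LabeledGraph

/-! ### The identity of Newton and the theorem of Whitney -/

section Newton

open PowerSeries in
/-- The signed sum over compositions that appears in the forest triple formula is, up to sign, a
power sum. -/
theorem headSum_esymm (σ : Type*) [Fintype σ] {n : ℕ} (hn : 1 ≤ n) :
    headSum (-1) (MvPolynomial.esymm σ ℤ) (fun j => j * MvPolynomial.esymm σ ℤ j) n =
      (-1) ^ (n + 1) * MvPolynomial.psum σ ℤ n := by
  set e := MvPolynomial.esymm σ ℤ with he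
  have h1 : (mk fun n => if n = 0 then 0 else (-1) ^ (n + 1) * MvPolynomial.psum σ ℤ n) *
      (1 + tailSeries e 1) = tailSeries' e 1 := by
    have h2 : 1 + tailSeries e 1 = mk e := by
      ext1 n
      rw [map_add, coeff_one, tailSeries, coeff_mk, coeff_mk]
      rcases Nat.eq_zero_or_pos n with rfl | hn
      · simp [he]
      · rw [if_neg (by omega), if_pos (show 1 ≤ n from hn), zero_add]
    rw [h2]
    ext1 n
    rw [mul_comm, coeff_mul, tailSeries', coeff_mk]
    rcases Nat.eq_zero_or_pos n with rfl | hn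
    · simp
    · rw [if_pos (show 1 ≤ n from hn), he, MvPolynomial.mul_esymm_eq_sum, Finset.mul_sum,
        Finset.sum_filter]
      refine Finset.sum_congr rfl fun p hp => ?_
      rw [Finset.HasAntidiagonal.mem_antidiagonal] at hp
      rw [coeff_mk, coeff_mk]
      by_cases h3 : p.2 = 0
      · rw [if_pos h3, if_neg (by omega), mul_zero]
      · rw [if_neg h3, if_pos (by omega), show n + 1 = p.2 + 1 + p.1 by omega, pow_add _ (p.2 + 1)]
        have h4 : ((-1 : MvPolynomial σ ℤ) ^ p.1) * (-1) ^ p.1 = 1 := by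
          rw [← mul_pow]; simp
        linear_combination (-e p.1 * (-1) ^ (p.2 + 1) * MvPolynomial.psum σ ℤ p.2) * h4
  have h2 := compSum_neg_one_mul e
  have h3 := headSum_series (-1) e (Ψ := fun j => j * e j) (by simp)
  rw [mk_natCast_mul] at h3
  have h4 : mk (headSum (-1) e fun j => j * e j) =
      mk fun n => if n = 0 then 0 else (-1) ^ (n + 1) * MvPolynomial.psum σ ℤ n := by
    linear_combination h3 - mk (compSum (-1) e) * h1 +
      (mk fun n => if n = 0 then 0 else (-1) ^ (n + 1) * MvPolynomial.psum σ ℤ n) * h2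
  have h5 := congrArg (coeff n) h4
  rwa [coeff_mk, coeff_mk, if_neg (by omega)] at h5

theorem map_headSum {R R' : Type*} [CommRing R] [CommRing R'] (f : R →+* R') (z : R)
    (x Ψ : ℕ → R) (n : ℕ) :
    f (headSum z x Ψ n) = headSum (f z) (fun j => f (x j)) (fun j => f (Ψ j)) n := by
  simp only [headSum, listWeight, map_sum, map_mul, map_pow, map_list_prod, List.map_map]
  rfl

theorem coeff_esymm {σ : Type*} [Fintype σ] (k : ℕ) (d : σ →₀ ℕ) :
    (MvPolynomial.esymm σ ℤ k).coeff d = if (∀ j, d j ≤ 1) ∧ d.degree = k then 1 else 0 := by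
  classical
  have h1 : ∀ (t : Finset σ) j, (∑ i ∈ t, Finsupp.single i 1 : σ →₀ ℕ) j =
      if j ∈ t then 1 else 0 := by
    intro t j
    rw [Finsupp.finsetSum_apply]
    simp only [Finsupp.single_apply, Finset.sum_ite_eq']
  have h2 : ∀ t : Finset σ, (∑ i ∈ t, Finsupp.single i 1 : σ →₀ ℕ) = d ↔
      (∀ j, d j ≤ 1) ∧ t = d.support := by
    intro t
    constructor
    · rintro rfl
      refine ⟨fun j => ?_, ?_⟩
      · rw [h1]; split_ifs <;> simp
      · ext j
        rw [Finsupp.mem_support_iff, h1]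
        simp
    · rintro ⟨h3, rfl⟩
      ext j
      have := h3 j
      rw [h1]
      split_ifs with h4
      · rw [Finsupp.mem_support_iff] at h4; omega
      · rw [Finsupp.notMem_support_iff] at h4; exact h4.symm
  rw [MvPolynomial.esymm_eq_sum_monomial, MvPolynomial.coeff_sum]
  simp only [MvPolynomial.coeff_monomial, h2]
  by_cases h3 : ∀ j, d j ≤ 1
  · have h4 : d.degree = d.support.card := by
      rw [Finsupp.degree_apply, Finset.card_eq_sum_ones]
      refine Finset.sum_congr rfl fun j hj => ?_
      have := h3 j
      rw [Finsupp.mem_support_iff] at hj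
      omega
    simp [h3, h4, Finset.mem_powersetCard]
  · simp [h3]

end Newton

namespace LabeledGraph

variable {G : LabeledGraph} {F : Finset ℕ} {m : ℕ} {β : Type*}

/-- The edge sets without broken circuits among the first `m` edges. -/
noncomputable def nbcBelow (G : LabeledGraph) (m : ℕ) : Finset (Finset ℕ) := by
  classical exact (Finset.range m).powerset.filter fun F =>
    ∀ i < m, ∀ u v, G.edges[i]? = some s(u, v) → ¬ (G.sub {j ∈ F | j < i}).Reachable u v

theorem mem_nbcBelow : F ∈ G.nbcBelow m ↔ F ⊆ Finset.range m ∧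
    ∀ i < m, ∀ u v, G.edges[i]? = some s(u, v) → ¬ (G.sub {j ∈ F | j < i}).Reachable u v := by
  classical
  simp [nbcBelow]

theorem nbcBelow_length : G.nbcBelow G.edges.length = G.nbc := by
  ext F
  rw [mem_nbcBelow, mem_nbc, isNonBroken_iff]
  exact and_congr_right fun _ => ⟨fun h i u v he => h i (lt_of_edge he) u v he,
    fun h i _ => h i⟩

theorem filter_lt_of_subset (h : F ⊆ Finset.range m) : {j ∈ F | j < m} = F :=
  Finset.filter_true_of_mem fun _ hj => Finset.mem_range.1 (h hj)

/-- The edge `m` either makes a set contain a broken circuit, or can be added at will. -/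
theorem nbcBelow_succ {u v : ℕ} (he : G.edges[m]? = some s(u, v)) (F : Finset ℕ) :
    F ∈ G.nbcBelow (m + 1) ↔ F ⊆ Finset.range (m + 1) ∧ F.erase m ∈ G.nbcBelow m ∧
      ¬ (G.sub (F.erase m)).Reachable u v := by
  have h0 : ∀ i ≤ m, {j ∈ F.erase m | j < i} = {j ∈ F | j < i} := by
    intro i hi
    ext j
    simp only [Finset.mem_filter, Finset.mem_erase]
    constructor
    · exact fun h => ⟨h.1.2, h.2⟩
    · exact fun h => ⟨⟨by omega, h.1⟩, h.2⟩
  rw [mem_nbcBelow, mem_nbcBelow]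
  refine and_congr_right fun hF => ?_
  have hF' : F.erase m ⊆ Finset.range m := by
    intro i hi
    rw [Finset.mem_erase] at hi
    have := Finset.mem_range.1 (hF hi.2)
    rw [Finset.mem_range]; omega
  have h1 : {j ∈ F | j < m} = F.erase m := by
    rw [← h0 m le_rfl, filter_lt_of_subset hF']
  constructor
  · intro h
    refine ⟨⟨hF', fun i hi u v he => ?_⟩, ?_⟩
    · rw [h0 i hi.le]
      exact h i (by omega) u v he
    · rw [← h1]
      exact h m (by omega) u v he
  · rintro ⟨⟨-, h2⟩, h3⟩ i hi u' v' he'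
    rcases Nat.lt_succ_iff_lt_or_eq.1 hi with h4 | rfl
    · rw [← h0 i h4.le]
      exact h2 i h4 u' v' he'
    · rw [h1]
      rw [he, Option.some_inj, Sym2.eq_iff] at he'
      rcases he' with ⟨rfl, rfl⟩ | ⟨rfl, rfl⟩
      · exact h3
      · exact fun h => h3 h.symm

/-- The colouring `κ` is constant along the edges in `F`. -/
def IsMono (G : LabeledGraph) (κ : ℕ → β) (F : Finset ℕ) : Prop :=
  ∀ i ∈ F, ∀ u v, G.edges[i]? = some s(u, v) → κ u = κ v

theorem isMono_insert {u v : ℕ} (he : G.edges[m]? = some s(u, v)) {κ : ℕ → β} :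
    G.IsMono κ (insert m F) ↔ κ u = κ v ∧ G.IsMono κ F := by
  unfold IsMono
  rw [Finset.forall_mem_insert]
  refine and_congr_left fun _ => ⟨fun h => h u v he, fun h u' v' he' => ?_⟩
  rw [he, Option.some_inj, Sym2.eq_iff] at he'
  rcases he' with ⟨rfl, rfl⟩ | ⟨rfl, rfl⟩
  · exact h
  · exact h.symm

open scoped Classical in
/-- Whitney's broken circuit theorem for a single colouring, by induction on the edges in
increasing order. -/
theorem sum_nbcBelow (κ : ℕ → β) (hm : m ≤ G.edges.length) :
    (∑ F ∈ G.nbcBelow m, if G.IsMono κ F then (-1 : ℤ) ^ F.card else 0) =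
      if ∀ i < m, ∀ u v, G.edges[i]? = some s(u, v) → κ u ≠ κ v then 1 else 0 := by
  induction m with
  | zero =>
    have h1 : G.nbcBelow 0 = {∅} := by
      ext F
      rw [mem_nbcBelow]
      simp [Finset.range_zero]
    rw [h1, Finset.sum_singleton]
    simp [IsMono]
  | succ m ih =>
    obtain ⟨e, he⟩ : ∃ e, G.edges[m]? = some e := ⟨_, List.getElem?_eq_getElem (by omega)⟩
    induction e using Sym2.ind with
    | _ u v =>
    -- the sets to which the edge `m` can be added
    set N := (G.nbcBelow m).filter (fun F => ¬ (G.sub F).Reachable u v) with hN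
    have hmem : ∀ F ∈ N, m ∉ F := by
      intro F hF h
      rw [hN, Finset.mem_filter, mem_nbcBelow] at hF
      exact absurd (Finset.mem_range.1 (hF.1.1 h)) (lt_irrefl m)
    have h1 : G.nbcBelow (m + 1) = N ∪ N.image (insert m) := by
      ext F
      rw [nbcBelow_succ he, Finset.mem_union, Finset.mem_image]
      constructor
      · rintro ⟨h1, h2, h3⟩
        have hE : F.erase m ∈ N := Finset.mem_filter.2 ⟨h2, h3⟩
        by_cases h4 : m ∈ F
        · exact Or.inr ⟨_, hE, Finset.insert_erase h4⟩
        · exact Or.inl (by rwa [Finset.erase_eq_of_notMem h4] at hE)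
      · rintro (h | ⟨F, h, rfl⟩)
        · have h' := hmem F h
          rw [Finset.erase_eq_of_notMem h']
          rw [hN, Finset.mem_filter] at h
          exact ⟨(mem_nbcBelow.1 h.1).1.trans (Finset.range_subset_range.2 (by omega)), h⟩
        · have h' := hmem F h
          rw [Finset.erase_insert h']
          rw [hN, Finset.mem_filter] at h
          refine ⟨Finset.insert_subset (by simp) ?_, h⟩
          exact (mem_nbcBelow.1 h.1).1.trans (Finset.range_subset_range.2 (by omega))
    have h2 : Disjoint N (N.image (insert m)) := by
      rw [Finset.disjoint_left]
      intro F hF hF'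
      obtain ⟨F', -, rfl⟩ := Finset.mem_image.1 hF'
      exact hmem _ hF (Finset.mem_insert_self _ _)
    rw [h1, Finset.sum_union h2, Finset.sum_image (by
      intro F hF F' hF' h
      rw [← Finset.erase_insert (hmem F hF), ← Finset.erase_insert (hmem F' hF')]
      exact congrArg (fun F => Finset.erase F m) h), ← Finset.sum_add_distrib]
    have h3 : ∀ F ∈ N, ((if G.IsMono κ F then (-1 : ℤ) ^ F.card else 0) +
        if G.IsMono κ (insert m F) then (-1 : ℤ) ^ (insert m F).card else 0) =
        if κ u = κ v then 0 else if G.IsMono κ F then (-1 : ℤ) ^ F.card else 0 := by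
      intro F hF
      rw [isMono_insert he, Finset.card_insert_of_notMem (hmem F hF), pow_succ]
      by_cases hκ : κ u = κ v
      · by_cases hF' : G.IsMono κ F <;> simp [hκ, hF']
      · simp [hκ]
    rw [Finset.sum_congr rfl h3]
    by_cases hκ : κ u = κ v
    · simp only [hκ, if_true, Finset.sum_const_zero]
      rw [if_neg]
      exact fun h => h m (by omega) u v he hκ
    · simp only [hκ, if_false]
      have h4 : ∀ F ∈ G.nbcBelow m, F ∉ N →
          (if G.IsMono κ F then (-1 : ℤ) ^ F.card else 0) = 0 := by
        intro F hF hFN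
        rw [if_neg]
        intro hmono
        refine hFN (Finset.mem_filter.2 ⟨hF, fun hr => hκ ?_⟩)
        exact eq_of_reachable κ (fun i hi x y he => hmono i hi x y he) hr
      rw [Finset.sum_subset (Finset.filter_subset _ _) h4, ih (by omega)]
      refine if_congr ⟨fun h i hi u' v' he' => ?_, fun h i hi => h i (by omega)⟩ rfl rfl
      rcases Nat.lt_succ_iff_lt_or_eq.1 hi with h5 | rfl
      · exact h i h5 u' v' he'
      · rw [he, Option.some_inj, Sym2.eq_iff] at he'
        rcases he' with ⟨rfl, rfl⟩ | ⟨rfl, rfl⟩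
        · exact hκ
        · exact fun h => hκ h.symm

/-- Adding an edge between two components merges them. -/
theorem card_comps_insert {u v : ℕ} (he : G.edges[m]? = some s(u, v))
    (hr : ¬ (G.sub F).Reachable u v) :
    (G.comps (insert m F)).card + 1 = (G.comps F).card := by
  classical
  obtain ⟨hu, hv⟩ := mem_Icc_of_edge he
  have hsub : ∀ {x y}, (G.sub F).Reachable x y → (G.sub (insert m F)).Reachable x y :=
    reachable_mono (Finset.subset_insert _ _)
  have huv : (G.sub (insert m F)).Reachable u v := reachable_of_edge (Finset.mem_insert_self _ _) he
  have hne : G.comp F u ≠ G.comp F v := fun h => hr ((comp_eq_iff hu).1 h)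
  have h1 : G.comps (insert m F) = insert (G.comp F u ∪ G.comp F v)
      (((G.comps F).erase (G.comp F u)).erase (G.comp F v)) := by
    have hC : ∀ V ∈ G.comps F, V ≠ G.comp F u → u ∉ V := fun V hV h h' => h (eq_comp_of_mem hV h')
    have hC' : ∀ V ∈ G.comps F, V ≠ G.comp F v → v ∉ V := fun V hV h h' => h (eq_comp_of_mem hV h')
    have hcl : ∀ V ∈ G.comps F, ∀ i ∈ F, ∀ x y, G.edges[i]? = some s(x, y) → (x ∈ V ↔ y ∈ V) := by
      intro V hV i hi x y hxy
      have h2 := comp_eq_of_reachable (reachable_of_edge hi hxy)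
      obtain ⟨hx, hy⟩ := mem_Icc_of_edge hxy
      constructor
      · intro h
        rw [eq_comp_of_mem hV h, h2]; exact self_mem_comp hy
      · intro h
        rw [eq_comp_of_mem hV h, ← h2]; exact self_mem_comp hx
    apply comps_eq
    · intro V hV
      rcases Finset.mem_insert.1 hV with rfl | hV
      · exact ⟨u, hu, Finset.mem_union_left _ (self_mem_comp hu)⟩
      · rw [Finset.mem_erase, Finset.mem_erase] at hV
        obtain ⟨w, hw⟩ := nonempty_of_mem_comps hV.2.2
        exact ⟨w, subset_of_mem_comps hV.2.2 hw, hw⟩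
    · intro V hV
      rcases Finset.mem_insert.1 hV with rfl | hV
      · refine mem_iff_reachable (c := u) ?_ ?_
        · intro i hi x y hxy
          rcases Finset.mem_insert.1 hi with rfl | hi
          · rw [he, Option.some_inj, Sym2.eq_iff] at hxy
            have h2 : u ∈ G.comp F u ∪ G.comp F v := Finset.mem_union_left _ (self_mem_comp hu)
            have h3 : v ∈ G.comp F u ∪ G.comp F v := Finset.mem_union_right _ (self_mem_comp hv)
            rcases hxy with ⟨rfl, rfl⟩ | ⟨rfl, rfl⟩
            · exact iff_of_true h2 h3
            · exact iff_of_true h3 h2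
          · rw [Finset.mem_union, Finset.mem_union,
              hcl _ (comp_mem_comps hu) i hi x y hxy, hcl _ (comp_mem_comps hv) i hi x y hxy]
        · intro w hw
          rcases Finset.mem_union.1 hw with hw | hw
          · exact hsub ((mem_comp hu).1 hw)
          · exact huv.trans (hsub ((mem_comp hv).1 hw))
      · rw [Finset.mem_erase, Finset.mem_erase] at hV
        obtain ⟨h4, h3, h2⟩ := hV
        obtain ⟨w, hw, rfl⟩ := mem_comps.1 h2
        refine mem_iff_reachable (c := w) ?_ fun y hy => hsub ((mem_comp hw).1 hy)
        intro i hi x y hxy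
        rcases Finset.mem_insert.1 hi with rfl | hi
        · rw [he, Option.some_inj, Sym2.eq_iff] at hxy
          rcases hxy with ⟨rfl, rfl⟩ | ⟨rfl, rfl⟩
          · exact iff_of_false (hC _ h2 h3) (hC' _ h2 h4)
          · exact iff_of_false (hC' _ h2 h4) (hC _ h2 h3)
        · exact hcl _ h2 i hi x y hxy
    · intro w hw
      by_cases h2 : G.comp F w = G.comp F u
      · exact ⟨_, Finset.mem_insert_self _ _,
          Finset.mem_union_left _ (h2 ▸ self_mem_comp hw)⟩
      by_cases h3 : G.comp F w = G.comp F v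
      · exact ⟨_, Finset.mem_insert_self _ _,
          Finset.mem_union_right _ (h3 ▸ self_mem_comp hw)⟩
      · exact ⟨_, Finset.mem_insert_of_mem (Finset.mem_erase.2 ⟨h3, Finset.mem_erase.2
          ⟨h2, comp_mem_comps hw⟩⟩), self_mem_comp hw⟩
  have hv' : G.comp F v ∈ (G.comps F).erase (G.comp F u) :=
    Finset.mem_erase.2 ⟨hne.symm, comp_mem_comps hv⟩
  rw [h1, Finset.card_insert_of_notMem, Finset.card_erase_of_mem hv',
    Finset.card_erase_of_mem (comp_mem_comps hu)]
  · have := Finset.card_pos.2 ⟨_, hv'⟩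
    rw [Finset.card_erase_of_mem (comp_mem_comps hu)] at this
    omega
  · rw [Finset.mem_erase, Finset.mem_erase]
    rintro ⟨-, h2, h3⟩
    exact h2 (eq_comp_of_mem h3 (Finset.mem_union_left _ (self_mem_comp hu)))

theorem comps_empty_card : (G.comps ∅).card = G.n := by
  classical
  have h1 : Set.InjOn (G.comp ∅) (Finset.Icc 1 G.n) := by
    intro u hu v _ h
    exact eq_of_reachable (fun x => x) (fun i hi => absurd hi (Finset.notMem_empty i))
      ((comp_eq_iff hu).1 h)
  rw [comps, Finset.card_image_of_injOn h1, Nat.card_Icc, Nat.add_sub_cancel]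

/-- An edge set without broken circuits is a forest. -/
theorem card_add_card_comps (hm : m ≤ G.edges.length) (hF : F ∈ G.nbcBelow m) :
    F.card + (G.comps F).card = G.n := by
  induction m generalizing F with
  | zero =>
    have := (mem_nbcBelow.1 hF).1
    rw [Finset.range_zero, Finset.subset_empty] at this
    rw [this, comps_empty_card, Finset.card_empty, zero_add]
  | succ m ih =>
    obtain ⟨e, he⟩ : ∃ e, G.edges[m]? = some e := ⟨_, List.getElem?_eq_getElem (by omega)⟩
    induction e using Sym2.ind with
    | _ u v =>
    obtain ⟨h1, h2, h3⟩ := (nbcBelow_succ he F).1 hF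
    have h4 := ih (by omega) h2
    by_cases h5 : m ∈ F
    · have h6 := card_comps_insert he h3
      rw [Finset.insert_erase h5] at h6
      have h7 := Finset.card_erase_add_one h5
      omega
    · rwa [Finset.erase_eq_of_notMem h5] at h4

theorem sum_card_comps : ∑ V ∈ G.comps F, V.card = G.n := by
  classical
  have h1 : (G.comps F).biUnion id = Finset.Icc 1 G.n := by
    ext v
    rw [Finset.mem_biUnion]
    constructor
    · rintro ⟨V, hV, hv⟩
      exact subset_of_mem_comps hV hv
    · exact fun hv => ⟨_, comp_mem_comps hv, self_mem_comp hv⟩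
  have h2 := Finset.card_biUnion (s := G.comps F) (t := id) (by
    intro V hV V' hV' hne
    rw [Function.onFun, Finset.disjoint_left]
    intro v hv hv'
    exact hne ((eq_comp_of_mem hV hv).trans (eq_comp_of_mem hV' hv').symm))
  rw [h1, Nat.card_Icc, Nat.add_sub_cancel] at h2
  exact h2.symm

theorem prod_sign_comps {R : Type*} [CommRing R] (hF : F ∈ G.nbc) :
    ∏ V ∈ G.comps F, (-1 : R) ^ (V.card + 1) = (-1) ^ F.card := by
  rw [← nbcBelow_length] at hF
  have h1 := card_add_card_comps le_rfl hF
  rw [Finset.prod_pow_eq_pow_sum, Finset.sum_add_distrib, sum_card_comps, Finset.sum_const,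
    smul_eq_mul, mul_one, ← h1, add_assoc, pow_add, ← two_mul, pow_mul]
  simp

end LabeledGraph

/-! ### Forest triple formulas for the symmetric functions -/

namespace LabeledGraph

variable {G : LabeledGraph} {F : Finset ℕ} {β : Type*}

/-- A colouring of the vertices of `G`, extended to all natural numbers. -/
def extend (G : LabeledGraph) (κ : Finset.Icc 1 G.n → β) (v : ℕ) : Option β :=
  if h : v ∈ Finset.Icc 1 G.n then some (κ ⟨v, h⟩) else none

theorem extend_coe (κ : Finset.Icc 1 G.n → β) (v : Finset.Icc 1 G.n) :
    G.extend κ v = some (κ v) := by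
  rw [extend, dif_pos v.2]

open scoped Classical in
/-- The monomials of the colourings that are constant on the components of `F` add up to a product
of power sums. -/
theorem sum_isMono (G : LabeledGraph) (F : Finset ℕ) (N : ℕ) :
    (∑ κ : Finset.Icc 1 G.n → Fin N, if G.IsMono (G.extend κ) F then
      ∏ v, (MvPolynomial.X (κ v) : MvPolynomial (Fin N) ℤ) else 0) =
    ∏ V ∈ G.comps F, MvPolynomial.psum (Fin N) ℤ V.card := by
  have h1 : ∏ V ∈ G.comps F, MvPolynomial.psum (Fin N) ℤ V.card =
      ∑ c : (G.comps F) → Fin N, ∏ V : (G.comps F), MvPolynomial.X (c V) ^ V.1.card := by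
    rw [← Finset.prod_coe_sort]
    simp only [MvPolynomial.psum]
    rw [Finset.prod_univ_sum, Fintype.piFinset_univ]
  let π : Finset.Icc 1 G.n → G.comps F := fun v => ⟨G.comp F v, comp_mem_comps v.2⟩
  have hπ : Function.Surjective π := by
    rintro ⟨V, hV⟩
    obtain ⟨v, hv, rfl⟩ := mem_comps.1 hV
    exact ⟨⟨v, hv⟩, rfl⟩
  have hcard : ∀ V : G.comps F, (Finset.univ.filter (fun v => π v = V)).card = V.1.card := by
    rintro ⟨V, hV⟩
    rw [← Finset.card_map (Function.Embedding.subtype _)]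
    congr 1
    ext v
    simp only [Finset.mem_map, Finset.mem_filter, Finset.mem_univ, true_and,
      Function.Embedding.coe_subtype, Subtype.exists, π, Subtype.mk.injEq]
    constructor
    · rintro ⟨w, hw, rfl, rfl⟩
      exact self_mem_comp hw
    · intro hv
      exact ⟨v, subset_of_mem_comps hV hv, (eq_comp_of_mem hV hv).symm, rfl⟩
  rw [h1, ← Finset.sum_filter]
  symm
  refine Finset.sum_bij (fun c _ => c ∘ π) ?_ ?_ ?_ ?_
  · intro c _
    refine Finset.mem_filter.2 ⟨Finset.mem_univ _, fun i hi u v he => ?_⟩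
    obtain ⟨hu, hv⟩ := mem_Icc_of_edge he
    rw [extend, extend, dif_pos hu, dif_pos hv]
    have h2 : π ⟨u, hu⟩ = π ⟨v, hv⟩ := Subtype.ext (comp_eq_of_reachable (reachable_of_edge hi he))
    simp only [Function.comp_apply, h2]
  · intro c _ c' _ h
    exact hπ.injective_comp_right h
  · intro κ hκ
    have hmono := (Finset.mem_filter.1 hκ).2
    have h2 : ∀ v w, π v = π w → κ v = κ w := by
      intro v w h
      have h3 := (comp_eq_iff v.2).1 (congrArg Subtype.val h)
      have h4 := eq_of_reachable (G.extend κ) (fun i hi x y he => hmono i hi x y he) h3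
      rw [extend_coe, extend_coe] at h4
      exact Option.some_inj.1 h4
    refine ⟨fun V => κ (Function.surjInv hπ V), Finset.mem_univ _, ?_⟩
    funext v
    exact h2 _ _ (Function.surjInv_eq hπ (π v))
  · intro c _
    have h2 := Finset.prod_fiberwise' Finset.univ π (fun V => (MvPolynomial.X (c V) :
      MvPolynomial (Fin N) ℤ))
    simp only [Finset.prod_const, hcard] at h2
    exact h2

/-- Properness tested on edge positions, for colourings extended by `extend`. -/
theorem isProper_iff (κ : Finset.Icc 1 G.n → ℕ) : G.IsProper κ ↔
    ∀ i < G.edges.length, ∀ u v, G.edges[i]? = some s(u, v) → G.extend κ u ≠ G.extend κ v := by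
  constructor
  · intro h i _ u v he
    obtain ⟨hu, hv⟩ := mem_Icc_of_edge he
    rw [extend, extend, dif_pos hu, dif_pos hv, Ne, Option.some_inj]
    exact h ⟨u, hu⟩ ⟨v, hv⟩ (List.mem_of_getElem? he)
  · intro h u v he
    obtain ⟨i, hi⟩ := List.mem_iff_getElem?.1 he
    have h1 := h i (lt_of_edge hi) u v hi
    rwa [extend_coe, extend_coe, Ne, Option.some_inj] at h1

theorem extend_val {N : ℕ} (κ : Finset.Icc 1 G.n → Fin N) (v : ℕ) :
    G.extend (fun w => (κ w : ℕ)) v = (G.extend κ v).map Fin.val := by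
  unfold extend
  split_ifs <;> rfl

open scoped Classical in
/-- Whitney's theorem for the chromatic polynomial in finitely many variables. -/
theorem sum_isProper (G : LabeledGraph) (N : ℕ) :
    (∑ κ : Finset.Icc 1 G.n → Fin N, if G.IsProper (fun v => (κ v : ℕ)) then
      ∏ v, (MvPolynomial.X (κ v) : MvPolynomial (Fin N) ℤ) else 0) =
    ∑ F ∈ G.nbc, ∏ V ∈ G.comps F, (-1) ^ (V.card + 1) * MvPolynomial.psum (Fin N) ℤ V.card := by
  have h1 : ∀ κ : Finset.Icc 1 G.n → Fin N, (if G.IsProper (fun v => (κ v : ℕ)) then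
      ∏ v, (MvPolynomial.X (κ v) : MvPolynomial (Fin N) ℤ) else 0) =
      ∑ F ∈ G.nbc, (-1) ^ F.card * if G.IsMono (G.extend κ) F then
        ∏ v, (MvPolynomial.X (κ v) : MvPolynomial (Fin N) ℤ) else 0 := by
    intro κ
    have h2 := congrArg (Int.cast : ℤ → MvPolynomial (Fin N) ℤ)
      (sum_nbcBelow (G := G) (G.extend κ) le_rfl)
    have h3 : G.IsProper (fun v => (κ v : ℕ)) ↔ ∀ i < G.edges.length, ∀ u v,
        G.edges[i]? = some s(u, v) → G.extend κ u ≠ G.extend κ v := by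
      rw [isProper_iff]
      simp only [extend_val, ne_eq, (Option.map_injective Fin.val_injective).eq_iff]
    rw [nbcBelow_length] at h2
    push_cast at h2
    rw [if_congr h3 rfl rfl, ← one_mul (∏ v, MvPolynomial.X (κ v)), ← zero_mul (∏ v,
      (MvPolynomial.X (κ v) : MvPolynomial (Fin N) ℤ)), ← ite_mul, ← h2, Finset.sum_mul]
    refine Finset.sum_congr rfl fun F _ => ?_
    split_ifs <;> simp
  rw [Finset.sum_congr rfl fun κ _ => h1 κ, Finset.sum_comm]
  refine Finset.sum_congr rfl fun F hF => ?_
  rw [← Finset.mul_sum, sum_isMono, Finset.prod_mul_distrib, prod_sign_comps hF]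

open scoped Classical in
/-- The coefficients of the chromatic symmetric function, computed with finitely many colours. -/
theorem coeff_chromaticSymm (G : LabeledGraph) {N : ℕ} (d : Fin N →₀ ℕ) :
    MvPowerSeries.coeff (d.embDomain Fin.valEmbedding) G.chromaticSymm =
      (∑ κ : Finset.Icc 1 G.n → Fin N, if G.IsProper (fun v => (κ v : ℕ)) then
        ∏ v, (MvPolynomial.X (κ v) : MvPolynomial (Fin N) ℤ) else 0).coeff d := by
  have hcont : ∀ κ : Finset.Icc 1 G.n → Fin N,
      (∑ v, Finsupp.single ((κ v : Fin N) : ℕ) 1 : ℕ →₀ ℕ) =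
        (∑ v, Finsupp.single (κ v) 1).embDomain Fin.valEmbedding := by
    intro κ
    have h := map_sum (Finsupp.embDomain.addMonoidHom (M := ℕ) (Fin.valEmbedding (n := N)))
      (fun v => Finsupp.single (κ v) 1) Finset.univ
    simp only [Finsupp.embDomain.addMonoidHom, AddMonoidHom.coe_mk, ZeroHom.coe_mk,
      Finsupp.embDomain_single] at h
    exact h.symm
  have h1 : {κ : Finset.Icc 1 G.n → ℕ | G.IsProper κ ∧
      ∑ v, Finsupp.single (κ v) 1 = d.embDomain Fin.valEmbedding} =
      (fun κ v => ((κ v : Fin N) : ℕ)) '' ((Finset.univ.filter fun κ : Finset.Icc 1 G.n → Fin N =>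
        G.IsProper (fun v => (κ v : ℕ)) ∧ ∑ v, Finsupp.single (κ v) 1 = d : Finset _) :
          Set (Finset.Icc 1 G.n → Fin N)) := by
    ext κ
    simp only [Set.mem_ofPred_eq, Finset.coe_filter, Finset.mem_univ, true_and, Set.mem_image]
    constructor
    · rintro ⟨hp, hd⟩
      have hlt : ∀ v, κ v < N := by
        intro v
        by_contra hN
        have h2 : (∑ w, Finsupp.single (κ w) 1 : ℕ →₀ ℕ) (κ v) = 0 := by
          rw [hd]
          apply Finsupp.embDomain_of_notMem_range
          rintro ⟨j, hj⟩
          exact hN (hj ▸ j.2)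
        rw [Finsupp.finsetSum_apply] at h2
        have h3 := (Finset.sum_eq_zero_iff.1 h2) v (Finset.mem_univ _)
        simp at h3
      refine ⟨fun v => ⟨κ v, hlt v⟩, ⟨hp, ?_⟩, rfl⟩
      have h2 := hcont (fun v => ⟨κ v, hlt v⟩)
      exact Finsupp.embDomain_injective _ (h2.symm.trans hd)
    · rintro ⟨κ, ⟨hp, hd⟩, rfl⟩
      exact ⟨hp, by rw [hcont, hd]⟩
  have hinj : Function.Injective (fun (κ : Finset.Icc 1 G.n → Fin N) v => ((κ v : Fin N) : ℕ)) :=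
    fun κ κ' h => funext fun v => Fin.ext (congrFun h v)
  have h2 : MvPowerSeries.coeff (d.embDomain Fin.valEmbedding) G.chromaticSymm =
      (Set.ncard {κ : Finset.Icc 1 G.n → ℕ | G.IsProper κ ∧
        ∑ v, Finsupp.single (κ v) 1 = d.embDomain Fin.valEmbedding} : ℤ) := rfl
  rw [h2, h1, Set.ncard_image_of_injective _ hinj, Set.ncard_coe_finset, MvPolynomial.coeff_sum,
    Finset.card_filter]
  push_cast
  refine Finset.sum_congr rfl fun κ _ => ?_
  have h3 : ∏ v, (MvPolynomial.X (κ v) : MvPolynomial (Fin N) ℤ) =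
      MvPolynomial.monomial (∑ v, Finsupp.single (κ v) 1) 1 := by
    rw [MvPolynomial.monomial_sum_one]; rfl
  by_cases hp : G.IsProper (fun v => (κ v : ℕ))
  · simp only [hp, true_and, if_true]
    rw [h3, MvPolynomial.coeff_monomial]
  · simp [hp]

open scoped Classical in
/-- Setting all but the first `N` variables to zero turns `e_k` into `e_k(x_0, …, x_{N-1})`. -/
theorem killCompl_elem (N k : ℕ) :
    MvPowerSeries.killCompl (Fin.valEmbedding (n := N)) (elem k) =
      (MvPolynomial.esymm (Fin N) ℤ k : MvPowerSeries (Fin N) ℤ) := by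
  ext d
  rw [MvPowerSeries.coeff_killCompl, MvPolynomial.coeff_coe, coeff_esymm]
  have h1 : (∀ j, d.embDomain Fin.valEmbedding j ≤ 1) ↔ ∀ j, d j ≤ 1 := by
    constructor
    · intro h j
      have := h (Fin.valEmbedding j)
      rwa [Finsupp.embDomain_apply_self] at this
    · intro h j
      by_cases hj : j ∈ Set.range (Fin.valEmbedding (n := N))
      · obtain ⟨i, rfl⟩ := hj
        rw [Finsupp.embDomain_apply_self]
        exact h i
      · rw [Finsupp.embDomain_of_notMem_range _ _ _ hj]
        exact zero_le_one
  have h2 : (d.embDomain Fin.valEmbedding).degree = d.degree := by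
    rw [Finsupp.degree_apply, Finsupp.degree_apply, Finsupp.support_embDomain, Finset.sum_map]
    exact Finset.sum_congr rfl fun i _ => Finsupp.embDomain_apply_self _ _ _
  have h3 : MvPowerSeries.coeff (d.embDomain Fin.valEmbedding) (elem k) =
      if (∀ j, d.embDomain Fin.valEmbedding j ≤ 1) ∧
        (d.embDomain Fin.valEmbedding).degree = k then (1 : ℤ) else 0 := rfl
  rw [h3]
  simp only [h1, h2]
  congr

/-- The forest triple formula for the chromatic symmetric function. -/
theorem chromaticSymm_eq (G : LabeledGraph) :
    G.chromaticSymm = forestSum (-1) elem G (fun j _ => elem j) := by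
  ext d
  -- only the variables in the support of `d` matter, so finitely many colours suffice
  obtain ⟨N, hN⟩ : ∃ N, ∀ j ∈ d.support, j < N :=
    ⟨d.support.sup id + 1, fun j hj => Nat.lt_succ_of_le (Finset.le_sup (f := id) hj)⟩
  obtain ⟨d, rfl⟩ : ∃ d' : Fin N →₀ ℕ, d'.embDomain Fin.valEmbedding = d :=
    ⟨_, Finsupp.embDomain_comapDomain (f := Fin.valEmbedding) fun j hj => ⟨⟨j, hN j hj⟩, rfl⟩⟩
  rw [coeff_chromaticSymm, sum_isProper, ← MvPowerSeries.coeff_killCompl, ← MvPolynomial.coeff_coe]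
  congr 1
  have hw : ∀ V : Finset ℕ, compWeight (-1) elem (sumR fun j _ => elem j) V =
      headSum (-1) elem (fun j => j * elem j) V.card := by
    intro V
    have h1 : sumR (fun j _ => elem j) = fun j : ℕ => (j : MvPowerSeries ℕ ℤ) * elem j := by
      funext j
      rw [sumR, Finset.sum_const, Nat.card_Icc, Nat.add_sub_cancel, nsmul_eq_mul]
    rw [compWeight, h1, ite_self]
  have hkill : ∀ n, 1 ≤ n → MvPowerSeries.killCompl (Fin.valEmbedding (n := N))
      (headSum (-1) elem (fun j => j * elem j) n) =
      (((-1) ^ (n + 1) * MvPolynomial.psum (Fin N) ℤ n : MvPolynomial (Fin N) ℤ) :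
        MvPowerSeries (Fin N) ℤ) := by
    intro n hn
    have h1 := map_headSum (MvPowerSeries.killCompl (R := ℤ)
      (Fin.valEmbedding (n := N))).toRingHom (-1) elem (fun j => j * elem j) n
    have h2 := map_headSum (MvPolynomial.coeToMvPowerSeries.ringHom (σ := Fin N) (R := ℤ)) (-1)
      (MvPolynomial.esymm (Fin N) ℤ) (fun j => j * MvPolynomial.esymm (Fin N) ℤ j) n
    rw [headSum_esymm _ hn] at h2
    simp only [AlgHom.toRingHom_eq_coe, RingHom.coe_coe, map_neg, map_one, map_mul, map_natCast,
      killCompl_elem] at h1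
    simp only [map_neg, map_one, map_mul, map_natCast,
      MvPolynomial.coeToMvPowerSeries.ringHom_apply] at h2
    rw [h1, ← h2]
    simp
  simp only [forestSum_eq, hw, map_sum, map_prod]
  rw [← MvPolynomial.coeToMvPowerSeries.ringHom_apply, map_sum]
  refine Finset.sum_congr rfl fun F _ => ?_
  rw [map_prod]
  refine Finset.prod_congr rfl fun V hV => ?_
  rw [hkill _ (Finset.card_pos.2 (nonempty_of_mem_comps hV))]
  rfl

theorem signOf_smul (S : Finset TreeTriple) (μ : Multiset ℕ) : signOf S • elemProd μ =
    (-1) ^ (∑ T ∈ S, (T.α.length - 1)) * (μ.map elem).prod := by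
  rw [zsmul_eq_mul, signOf, elemProd]
  push_cast
  rfl

theorem chromaticPiece_eq (G : LabeledGraph) (i : ℕ) :
    G.chromaticPiece i = forestSum (-1) elem G (indicator _ i 1) := by
  classical
  rw [chromaticPiece, forestSum, finsum_mem_eq_sum_of_inter_support_eq
    (t := G.FT_finite.toFinset.filter (fun S => MinIs S i)), Finset.sum_filter]
  · refine Finset.sum_congr rfl fun S hS => ?_
    rw [Set.Finite.mem_toFinset] at hS
    rw [prod_treeWeight_indicator hS, signOf_smul]
    exact if_congr Iff.rfl rfl rfl
  · congr 1
    ext S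
    simp [FTPiece]

/-- Exactly one tree contains the common vertex `a`, so the condition on it may be imposed on all
trees. -/
theorem mem_FTPrime {a : ℕ} (ha : 2 ≤ a) {U : LabeledGraph} {S : Finset TreeTriple} :
    S ∈ FTPrime a ha U ↔ S ∈ (cycle a ha + U).FT ∧ ∀ T ∈ S, CoversTree (cycle a ha) U T := by
  refine and_congr_right fun hS => ?_
  have huniq : ∃! T, T ∈ S ∧ a ∈ T.V := by
    obtain ⟨F, -, -, h⟩ := hS
    refine h a (by omega) ?_
    have : (cycle a ha + U).n = a + U.n - 1 := rfl
    have := U.pos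
    omega
  constructor
  · rintro ⟨T, hT, haT, h1, h2⟩ T' hT' haT'
    obtain rfl := huniq.unique ⟨hT, haT⟩ ⟨hT', haT'⟩
    exact ⟨h1, h2⟩
  · intro h
    obtain ⟨T, ⟨hT, haT⟩, -⟩ := huniq
    exact ⟨T, hT, haT, h T hT haT⟩

open scoped Classical in
theorem prod_coversTree {R : Type*} [CommRing R] {H U : LabeledGraph} (S : Finset TreeTriple)
    (g : TreeTriple → R) :
    ∏ T ∈ S, (if CoversTree H U T then g T else 0) =
      if ∀ T ∈ S, CoversTree H U T then ∏ T ∈ S, g T else 0 := by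
  split_ifs with h
  · exact Finset.prod_congr rfl fun T hT => if_pos (h T hT)
  · push Not at h
    obtain ⟨T, hT, h1⟩ := h
    exact Finset.prod_eq_zero hT (if_neg h1)

theorem B_eq {a : ℕ} (ha : 2 ≤ a) {U : LabeledGraph} (hU : U.IsTree) :
    B a ha U = joinCoeff (-1) elem (cycle a ha) (sumR fun j _ => elem j) U.n := by
  classical
  rw [B, ← sum_coversTree hU, finsum_mem_eq_sum_of_inter_support_eq
    (t := (cycle a ha + U).FT_finite.toFinset.filter
      (fun S => ∀ T ∈ S, CoversTree (cycle a ha) U T)), Finset.sum_filter]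
  · refine Finset.sum_congr rfl fun S hS => ?_
    rw [Set.Finite.mem_toFinset] at hS
    rw [prod_coversTree, prod_treeWeight hS, signOf_smul]
  · congr 1
    ext S
    simp [mem_FTPrime]

theorem BPiece_eq {a : ℕ} (ha : 2 ≤ a) {U : LabeledGraph} (hU : U.IsTree) (i : ℕ) :
    BPiece a ha U i = joinCoeff (-1) elem (cycle a ha) (sumR (indicator _ i 1)) U.n := by
  classical
  rw [BPiece, ← sum_coversTree hU, finsum_mem_eq_sum_of_inter_support_eq
    (t := ((cycle a ha + U).FT_finite.toFinset.filter
      (fun S => ∀ T ∈ S, CoversTree (cycle a ha) U T)).filter (fun S => MinIs S i)),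
    Finset.sum_filter, Finset.sum_filter]
  · refine Finset.sum_congr rfl fun S hS => ?_
    rw [Set.Finite.mem_toFinset] at hS
    rw [prod_coversTree, prod_treeWeight_indicator hS, signOf_smul]
    exact if_congr Iff.rfl (if_congr Iff.rfl rfl rfl) rfl
  · congr 1
    ext S
    simp [mem_FTPrime]

end LabeledGraph

/-! ### Adding a cycle in front of a graph -/

theorem mainTheorem2 (a : ℕ) (ha : 2 ≤ a) (G' : LabeledGraph)
    (hG' : G'.HasFirstPreservingInvolution)
    (U : ℕ → LabeledGraph)
    (hU : ∀ k, 1 ≤ k → k ≤ G'.n → (U k).n = k ∧ (U k).IsTree) :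
    (LabeledGraph.cycle a ha + G').HasFirstPreservingInvolution ∧
    (LabeledGraph.cycle a ha + G').chromaticSymm =
      ∑ k ∈ Finset.Icc 1 G'.n, G'.chromaticPiece k * LabeledGraph.B a ha (U k) ∧
    ∀ i : ℕ, (LabeledGraph.cycle a ha + G').chromaticPiece i =
      ∑ k ∈ Finset.Icc 1 G'.n, G'.chromaticPiece k * LabeledGraph.BPiece a ha (U k) i := by
  refine ⟨LabeledGraph.hasFirstPreservingInvolution_cycle_add ha hG', ?_, fun i => ?_⟩
  · rw [LabeledGraph.chromaticSymm_eq, LabeledGraph.forestSum_add]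
    refine Finset.sum_congr rfl fun k hk => ?_
    rw [Finset.mem_Icc] at hk
    obtain ⟨h1, h2⟩ := hU k hk.1 hk.2
    rw [LabeledGraph.chromaticPiece_eq, LabeledGraph.B_eq ha h2, h1]
  · rw [LabeledGraph.chromaticPiece_eq, LabeledGraph.forestSum_add]
    refine Finset.sum_congr rfl fun k hk => ?_
    rw [Finset.mem_Icc] at hk
    obtain ⟨h1, h2⟩ := hU k hk.1 hk.2
    rw [LabeledGraph.chromaticPiece_eq, LabeledGraph.BPiece_eq ha h2, h1]
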